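/- **Setting.** Let $k$ be a commutative ring, $K$ an associative unital $k$-algebra (not necessarily commutative), $\alpha$ a $k$-algebra endomorphism of $K$, and $B=K[x,\alpha]$ the Ore extension, in which $x\lambda=\alpha(\lambda)x$ for $\lambda\in K$. Let $n\ge 2$ and $f=\sum_{i=0}^{n}\lambda_i x^{n-i}\in B$ with $\lambda_0=1$, $\alpha(\lambda_i)=\lambda_i$ and $\lambda_i\lambda=\alpha^i(\lambda)\lambda_i$ for all $1\le i\le n$ and $\lambda\in K$. Put $A=B/\langle f\rangle$. For $P\in B$ let $\overline P\in B$ be the quotient in the unique division $P=\overline P f+R$ with $R=0$ or $\deg R<n$; the image of $\overline P$ in $A$ is also written $\overline P$. All maps are $k$-linear, $\otimes=\otimes_K$, $\overline A=A/K$, and for a $K$-bimodule $X$ we write $X\otimes$ for $X/[X,K]$, where $[X,K]$ is the $k$-submodule generated by the $y\lambda-\lambda y$. Let $M$ be an $A$-bimodule, symmetric over $k$, and let $[M,K]_{\alpha^j}$ be the $k$-submodule of $M$ generated by the $m\,\alpha^j(\lambda)-\lambda m$ ($m\in M$, $\lambda\in K$). Let $(M\otimes\overline A^{\otimes *}\otimes,b)$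 be the normalized Hochschild complex relative to $K$, $$b[m\otimes a_1\otimes\cdots\otimes a_r]=[ma_1\otimes a_2\otimes\cdots\otimes a_r]+\sum_{j=1}^{r-1}(-1)^j[m\otimes\cdots\otimes a_ja_{j+1}\otimes\cdots\otimes a_r]+(-1)^r[a_rm\otimes a_1\otimes\cdots\otimes a_{r-1}],$$ whose homology is $\mathrm H^K_*(A,M)$, and let $b'$ be the boundary of the canonical normalized Hochschild resolution $A\otimes\overline A^{\otimes *}\otimes A$. For $m\ge 0$ let $\mathbb I_m=\{\mathbf i\in\mathbb Z^m:1\le i_j\le n\}$; for $\mathbf i\in\mathbb I_m$ let $\mathbb J_{\mathbf i}=\{\boldsymbol\ell\in\mathbb Z^m:1\le \ell_j<i_j\}$, $\boldsymbol\lambda_{\mathbf n-\mathbf i}=\lambda_{n-i_1}\cdots\lambda_{n-i_m}$, $|\mathbf i-\boldsymbol\ell|=\sum_j(i_j-\ell_j)$ and $\widetilde{\mathbf x}^{\boldsymbol\ell}=x\otimes x^{\ell_m}\otimes\cdots\otimes x\otimes x^{\ell_1}$. **Theorem 2.1.** (1) The following is a well-defined chain complex $C^S(A,M)$, and its homology is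 isomorphic, in each degree, to $\mathrm H^K_*(A,M)$: $C^S_{2m}=M/[M,K]_{\alpha^{mn}}$, $C^S_{2m+1}=M/[M,K]_{\alpha^{mn+1}}$, with boundaries $$d_{2m+1}[y]=[yx-xy],\qquad d_{2m}[y]=\sum_{i=1}^{n}\sum_{\ell=0}^{i-1}[\lambda_{n-i}x^{i-\ell-1}\,y\,x^{\ell}].$$ (2) The formulas (for $m\ge 0$, $y\in M$ and exponents $1\le i_1,i_2,\dots<n$) $$\phi_{2m}[y]=\sum_{\mathbf i\in\mathbb I_m}\sum_{\boldsymbol\ell\in\mathbb J_{\mathbf i}}[\boldsymbol\lambda_{\mathbf n-\mathbf i}\,y\,x^{|\mathbf i-\boldsymbol\ell|-m}\otimes\widetilde{\mathbf x}^{\boldsymbol\ell}],\qquad \phi_{2m+1}[y]=\sum_{\mathbf i\in\mathbb I_m}\sum_{\boldsymbol\ell\in\mathbb J_{\mathbf i}}[\boldsymbol\lambda_{\mathbf n-\mathbf i}\,y\,x^{|\mathbf i-\boldsymbol\ell|-m}\otimes\widetilde{\mathbf x}^{\boldsymbol\ell}\otimes x]$$ (so $\phi_0[y]=[y]$, $\phi_1[y]=[y\otimes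 x]$), $$\psi_{2m}[y\otimes x^{i_1}\otimes\cdots\otimes x^{i_{2m}}]=[y\,\overline{x^{i_1+i_2}}\cdots\overline{x^{i_{2m-1}+i_{2m}}}],$$ $$\psi_{2m+1}[y\otimes x^{i_1}\otimes\cdots\otimes x^{i_{2m+1}}]=\sum_{\ell=0}^{i_{2m+1}-1}[x^{i_{2m+1}-\ell-1}\,y\,\overline{x^{i_1+i_2}}\cdots\overline{x^{i_{2m-1}+i_{2m}}}\,x^{\ell}]$$ define chain maps $\phi:C^S(A,M)\to(M\otimes\overline A^{\otimes *}\otimes,b)$ and $\psi:(M\otimes\overline A^{\otimes *}\otimes,b)\to C^S(A,M)$, which are inverse to each other up to homotopy. (3) More precisely, $\psi\phi=\mathrm{id}$, and an explicit homotopy from $\phi\psi$ to $\mathrm{id}$ is obtained as follows. Let $A_{\alpha^j}\otimes A$ be the quotient of $A\otimes_k A$ by the elements $u\alpha^j(\lambda)\otimes v-u\otimes\lambda v$, with $j=mn$ in degree $2m$ and $j=mn+1$ in degree $2m+1$. There are $A$-bimodule maps $\phi'_r:A_{\alpha^j}\otimes A\to A\otimes\overline A^{\otimes r}\otimes A$ and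 $\psi'_r$ in the opposite direction ($j$ being that of degree $r$) with $$\phi'_{2m}(1\otimes1)=\sum_{\mathbf i\in\mathbb I_m}\sum_{\boldsymbol\ell\in\mathbb J_{\mathbf i}}\boldsymbol\lambda_{\mathbf n-\mathbf i}x^{|\mathbf i-\boldsymbol\ell|-m}\otimes\widetilde{\mathbf x}^{\boldsymbol\ell}\otimes1,\qquad\phi'_{2m+1}(1\otimes1)=\sum_{\mathbf i\in\mathbb I_m}\sum_{\boldsymbol\ell\in\mathbb J_{\mathbf i}}\boldsymbol\lambda_{\mathbf n-\mathbf i}x^{|\mathbf i-\boldsymbol\ell|-m}\otimes\widetilde{\mathbf x}^{\boldsymbol\ell}\otimes x\otimes1,$$ $$\psi'_{2m}(1\otimes x^{i_1}\otimes\cdots\otimes x^{i_{2m}}\otimes1)=\overline{x^{i_1+i_2}}\cdots\overline{x^{i_{2m-1}+i_{2m}}}\otimes1,$$ $$\psi'_{2m+1}(1\otimes x^{i_1}\otimes\cdots\otimes x^{i_{2m+1}}\otimes1)=\sum_{\ell=0}^{i_{2m+1}-1}\overline{x^{i_1+i_2}}\cdots\overline{x^{i_{2m-1}+i_{2m}}}\,x^{\ell}\otimes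 x^{i_{2m+1}-\ell-1}$$ (again for $1\le i_p<n$), and $A$-bimodule maps $\omega'_{r+1}:A\otimes\overline A^{\otimes r}\otimes A\to A\otimes\overline A^{\otimes r+1}\otimes A$ with $\omega'_1=0$ and, for $r\ge1$ and $\mathbf x\in A\otimes\overline A^{\otimes r}$, $$\omega'_{r+1}(\mathbf x\otimes1)=(-1)^{r+1}\bigl(\phi'_r\psi'_r-\mathrm{id}-\omega'_rb'_r\bigr)(\mathbf x\otimes1)\otimes1.$$ Let $\beta:M\otimes_{A^e}(A\otimes\overline A^{\otimes r+1}\otimes A)\to M\otimes\overline A^{\otimes r+1}\otimes$ be given by $\beta\bigl(y\otimes(x_0\otimes x_1\otimes\cdots\otimes x_{r+2})\bigr)=[x_{r+2}\,y\,x_0\otimes x_1\otimes\cdots\otimes x_{r+1}]$. Then the maps $$\omega_{r+1}:M\otimes\overline A^{\otimes r}\otimes\to M\otimes\overline A^{\otimes r+1}\otimes,\qquad\omega_{r+1}[y\otimes\mathbf x]=\beta\bigl(y\otimes_{A^e}\omega'_{r+1}(1\otimes\mathbf x\otimes1)\bigr),$$ are well defined and satisfy $\phi_0\psi_0-\mathrm{id}=b_1\omega_1$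 and $\phi_r\psi_r-\mathrm{id}=b_{r+1}\omega_{r+1}+\omega_rb_r$ for $r\ge1$. -/

import Mathlib

set_option linter.unusedSectionVars false
open scoped TensorProduct
open MulOpposite

section Contract
variable {A : Type*} [Mul A] {r : ℕ}

theorem contractNth_update_of_lt (j : Fin (r + 1)) (a : Fin (r + 1) → A) (i : Fin r) (y : A)
    (h : (i : ℕ) < j) :
    Fin.contractNth j (· * ·) (Function.update a i.castSucc y) =
      Function.update (Fin.contractNth j (· * ·) a) i y := by
  funext p
  simp only [Fin.contractNth, Function.update_apply, Fin.ext_iff, Fin.val_castSucc, Fin.val_succ]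
  split_ifs <;> first | rfl | omega

theorem contractNth_update_of_gt (j : Fin (r + 1)) (a : Fin (r + 1) → A) (i : Fin r) (y : A)
    (h : (j : ℕ) < i) :
    Fin.contractNth j (· * ·) (Function.update a i.succ y) =
      Function.update (Fin.contractNth j (· * ·) a) i y := by
  funext p
  simp only [Fin.contractNth, Function.update_apply, Fin.ext_iff, Fin.val_castSucc, Fin.val_succ]
  split_ifs <;> first | rfl | omega

theorem contractNth_update_left (i : Fin r) (a : Fin (r + 1) → A) (y : A) :
    Fin.contractNth i.castSucc (· * ·) (Function.update a i.castSucc y) =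
      Function.update (Fin.contractNth i.castSucc (· * ·) a) i (y * a i.succ) := by
  funext p
  simp only [Fin.contractNth, Function.update_apply, Fin.ext_iff, Fin.val_castSucc, Fin.val_succ]
  split_ifs <;> first | rfl | omega | skip
  all_goals (obtain rfl : p = i := Fin.ext (by omega); rfl)

theorem contractNth_update_right (i : Fin r) (a : Fin (r + 1) → A) (y : A) :
    Fin.contractNth i.castSucc (· * ·) (Function.update a i.succ y) =
      Function.update (Fin.contractNth i.castSucc (· * ·) a) i (a i.castSucc * y) := by
  funext p
  simp only [Fin.contractNth, Function.update_apply, Fin.ext_iff, Fin.val_castSucc, Fin.val_succ]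
  split_ifs <;> first | rfl | omega | skip
  all_goals (obtain rfl : p = i := Fin.ext (by omega); rfl)

theorem contractNth_self (i : Fin r) (a : Fin (r + 1) → A) :
    Fin.contractNth i.castSucc (· * ·) a i = a i.castSucc * a i.succ := by
  simp [Fin.contractNth]
end Contract

theorem contractNth_update_linear (k : Type*) {A : Type*} [CommRing k] [Ring A] [Algebra k A]
    {r : ℕ} (i : Fin r) (s : Fin (r + 1)) (a : Fin (r + 1) → A) :
    ∃ (s' : Fin r) (g : A →ₗ[k] A), ∀ y, Fin.contractNth i.castSucc (· * ·) (Function.update a s y) =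
      Function.update (Fin.contractNth i.castSucc (· * ·) a) s' (g y) := by
  rcases lt_trichotomy (s : ℕ) i with h | h | h
  · refine ⟨⟨s, by omega⟩, LinearMap.id, fun y => ?_⟩
    exact contractNth_update_of_lt i.castSucc a ⟨s, by omega⟩ y h
  · refine ⟨i, LinearMap.mulRight k (a i.succ), fun y => ?_⟩
    obtain rfl : s = i.castSucc := Fin.ext h
    exact contractNth_update_left i a y
  · by_cases h' : (s : ℕ) = i + 1
    · refine ⟨i, LinearMap.mulLeft k (a i.castSucc), fun y => ?_⟩
      obtain rfl : s = i.succ := Fin.ext h'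
      exact contractNth_update_right i a y
    · obtain ⟨s', rfl⟩ := Fin.exists_succ_eq.2 (show s ≠ 0 by rintro rfl; simp at h)
      refine ⟨s', LinearMap.id, fun y => ?_⟩
      simp only [Fin.val_succ] at h h'
      exact contractNth_update_of_gt i.castSucc a s' y (by simp; omega)


theorem contractNth_update_mul_right {A : Type*} [Ring A] {r : ℕ} (j : Fin r) (a : Fin (r + 1) → A)
    (s : Fin (r + 1)) (s' : Fin r) (c : A)
    (h : ((s : ℕ) < j ∧ (s' : ℕ) = s) ∨ ((j : ℕ) < s ∧ (s : ℕ) = s' + 1)) :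
    Fin.contractNth j.castSucc (· * ·) (Function.update a s (a s * c)) =
      Function.update (Fin.contractNth j.castSucc (· * ·) a) s'
        (Fin.contractNth j.castSucc (· * ·) a s' * c) := by
  rcases h with ⟨h, h'⟩ | ⟨h, h'⟩
  · obtain rfl : s = s'.castSucc := Fin.ext h'.symm
    rw [contractNth_update_of_lt _ _ _ _ (by simpa using h),
      Fin.contractNth_apply_of_lt _ _ _ s' (by simpa using h)]
  · obtain rfl : s = s'.succ := Fin.ext h'
    simp only [Fin.val_succ] at h
    by_cases e : s' = j
    · subst e
      rw [contractNth_update_right, contractNth_self, mul_assoc]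
    · have : (j : ℕ) < s' := by
        have := Fin.val_ne_of_ne e
        omega
      rw [contractNth_update_of_gt _ _ _ _ (by simpa using this),
        Fin.contractNth_apply_of_gt _ _ _ s' (by simpa using this)]

theorem contractNth_update_mul_left {A : Type*} [Ring A] {r : ℕ} (j : Fin r) (a : Fin (r + 1) → A)
    (s : Fin (r + 1)) (s' : Fin r) (c : A)
    (h : ((s : ℕ) ≤ j ∧ (s' : ℕ) = s) ∨ ((j : ℕ) + 1 < s ∧ (s : ℕ) = s' + 1)) :
    Fin.contractNth j.castSucc (· * ·) (Function.update a s (c * a s)) =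
      Function.update (Fin.contractNth j.castSucc (· * ·) a) s'
        (c * Fin.contractNth j.castSucc (· * ·) a s') := by
  rcases h with ⟨h, h'⟩ | ⟨h, h'⟩
  · obtain rfl : s = s'.castSucc := Fin.ext h'.symm
    simp only [Fin.val_castSucc] at h
    by_cases e : s' = j
    · subst e
      rw [contractNth_update_left, contractNth_self, mul_assoc]
    · have : (s' : ℕ) < j := by
        have := Fin.val_ne_of_ne e
        omega
      rw [contractNth_update_of_lt _ _ _ _ (by simpa using this),
        Fin.contractNth_apply_of_lt _ _ _ s' (by simpa using this)]
  · obtain rfl : s = s'.succ := Fin.ext h'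
    simp only [Fin.val_succ] at h
    rw [contractNth_update_of_gt _ _ _ _ (by simp; omega),
        Fin.contractNth_apply_of_gt _ _ _ s' (by simp; omega)]

noncomputable section

variable (k : Type*) {K A : Type*} [CommRing k] [Ring K] [Algebra k K] [Ring A] [Algebra k A]

section Pre

variable {M : Type*} [AddCommGroup M] [Module k M]

/-- The element `m ⊗ a_1 ⊗ ⋯ ⊗ a_r` of `M ⊗_k A^{⊗_k r}`. -/
def preWord {r : ℕ} (m : M) (a : Fin r → A) : M ⊗[k] (⨂[k] _ : Fin r, A) :=
  m ⊗ₜ[k] PiTensorProduct.tprod k a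

theorem preWord_add {r : ℕ} (m m' : M) (a : Fin r → A) :
    preWord k (m + m') a = preWord k m a + preWord k m' a := TensorProduct.add_tmul _ _ _

theorem preWord_smul {r : ℕ} (c : k) (m : M) (a : Fin r → A) :
    preWord k (c • m) a = c • preWord k m a := rfl

theorem preWord_update_add {r : ℕ} (m : M) (a : Fin r → A) (i : Fin r) (x y : A) :
    preWord k m (Function.update a i (x + y)) =
      preWord k m (Function.update a i x) + preWord k m (Function.update a i y) := by
  simp [preWord, TensorProduct.tmul_add]

theorem preWord_update_smul {r : ℕ} (m : M) (a : Fin r → A) (i : Fin r) (c : k) (x : A) :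
    preWord k m (Function.update a i (c • x)) = c • preWord k m (Function.update a i x) := by
  simp [preWord, TensorProduct.tmul_smul]

/-- The linear map out of `M ⊗_k A^{⊗_k r}` given by a multilinear function. -/
def preLift {r : ℕ} {N : Type*} [AddCommGroup N] [Module k N] (F : M → (Fin r → A) → N)
    (h1 : ∀ m m' a, F (m + m') a = F m a + F m' a)
    (h2 : ∀ (c : k) m a, F (c • m) a = c • F m a)
    (h3 : ∀ m a i x y, F m (Function.update a i (x + y)) =
      F m (Function.update a i x) + F m (Function.update a i y))
    (h4 : ∀ m a i (c : k) x, F m (Function.update a i (c • x)) =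
      c • F m (Function.update a i x)) :
    M ⊗[k] (⨂[k] _ : Fin r, A) →ₗ[k] N :=
  TensorProduct.lift
    { toFun := fun m => PiTensorProduct.lift (MultilinearMap.mk' (F m) (h3 m) (h4 m))
      map_add' := fun m m' => by
        ext a; simp [h1]
      map_smul' := fun c m => by
        ext a; simp [h2] }

theorem preLift_preWord {r : ℕ} {N : Type*} [AddCommGroup N] [Module k N]
    (F : M → (Fin r → A) → N) (h1 h2 h3 h4) (m : M) (a : Fin r → A) :
    preLift k F h1 h2 h3 h4 (preWord k m a) = F m a := by
  simp [preLift, preWord]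

end Pre

section Hoch

variable {k}
variable (ι : K →ₐ[k] A) (M : Type*) [AddCommGroup M] [Module k M] [Module A M] [Module Aᵐᵒᵖ M]

/-- Right multiplication by `c` of the factor in front of the `j`-th tensor sign of the cyclic word
`m ⊗ a_1 ⊗ ⋯ ⊗ a_r ⊗` (the factor `m` for `j = 0`, the factor `a_j` for `1 ≤ j ≤ r`). -/
def mulRightAt {M : Type*} [AddCommGroup M] [Module Aᵐᵒᵖ M] {r : ℕ} (j : Fin (r + 1)) (c : A)
    (m : M) (a : Fin r → A) : M × (Fin r → A) :=
  Fin.cases (motive := fun _ => M × (Fin r → A)) (op c • m, a)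
    (fun i => (m, Function.update a i (a i * c))) j

/-- Left multiplication by `c` of the factor behind the `j`-th tensor sign of the cyclic word
`m ⊗ a_1 ⊗ ⋯ ⊗ a_r ⊗` (the factor `a_{j+1}` for `j < r`, the factor `m` for `j = r`). -/
def mulLeftAt {M : Type*} [AddCommGroup M] [Module A M] {r : ℕ} (j : Fin (r + 1)) (c : A)
    (m : M) (a : Fin r → A) : M × (Fin r → A) :=
  Fin.lastCases (motive := fun _ => M × (Fin r → A)) (c • m, a)
    (fun i => (m, Function.update a i (c * a i))) j

/-- The relations between the `k`-tensors `m ⊗ a_1 ⊗ ⋯ ⊗ a_r` that hold in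
`M ⊗ Ā^{⊗ r} ⊗`: all tensor signs, the last (cyclic) one included, are balanced over `K`, and a
word with some `a_i` in `K` is zero. -/
def Hoch.relations (r : ℕ) : Set (M ⊗[k] (⨂[k] _ : Fin r, A)) :=
  {t | ∃ (j : Fin (r + 1)) (c : K) (m : M) (a : Fin r → A),
      t = preWord k (mulRightAt j (ι c) m a).1 (mulRightAt j (ι c) m a).2
        - preWord k (mulLeftAt j (ι c) m a).1 (mulLeftAt j (ι c) m a).2} ∪
  {t | ∃ (i : Fin r) (c : K) (m : M) (a : Fin r → A),
      t = preWord k m (Function.update a i (ι c))}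

/-- The module `M ⊗ Ā^{⊗ r} ⊗ = (M ⊗_K Ā^{⊗_K r}) / [M ⊗_K Ā^{⊗_K r}, K]`, where `Ā = A / K`. -/
abbrev Hoch (r : ℕ) : Type _ :=
  (M ⊗[k] (⨂[k] _ : Fin r, A)) ⧸ Submodule.span k (Hoch.relations ι M r)

namespace Hoch
variable {M}

/-- The class `[m ⊗ a_1 ⊗ ⋯ ⊗ a_r]`. -/
def mk {r : ℕ} (m : M) (a : Fin r → A) : Hoch ι M r := Submodule.Quotient.mk (preWord k m a)

theorem mk_add {r : ℕ} (m m' : M) (a : Fin r → A) :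
    mk ι (m + m') a = mk ι m a + mk ι m' a := by
  simp [mk, preWord_add]

theorem mk_smul {r : ℕ} (c : k) (m : M) (a : Fin r → A) :
    mk ι (c • m) a = c • mk ι m a := by
  simp [mk, preWord_smul]

theorem mk_update_add {r : ℕ} (m : M) (a : Fin r → A) (i : Fin r) (x y : A) :
    mk ι m (Function.update a i (x + y)) =
      mk ι m (Function.update a i x) + mk ι m (Function.update a i y) := by
  simp [mk, preWord_update_add]

theorem mk_update_smul {r : ℕ} (m : M) (a : Fin r → A) (i : Fin r) (c : k) (x : A) :
    mk ι m (Function.update a i (c • x)) = c • mk ι m (Function.update a i x) := by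
  simp [mk, preWord_update_smul]

theorem mk_balance {r : ℕ} (j : Fin (r + 1)) (c : K) (m : M) (a : Fin r → A) :
    mk ι (mulRightAt j (ι c) m a).1 (mulRightAt j (ι c) m a).2 =
      mk ι (mulLeftAt j (ι c) m a).1 (mulLeftAt j (ι c) m a).2 := by
  rw [mk, mk, Submodule.Quotient.eq]
  exact Submodule.subset_span (Or.inl ⟨j, c, m, a, rfl⟩)

theorem mk_update_base {r : ℕ} (i : Fin r) (c : K) (m : M) (a : Fin r → A) :
    mk ι m (Function.update a i (ι c)) = 0 := by
  rw [mk, Submodule.Quotient.mk_eq_zero]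
  exact Submodule.subset_span (Or.inr ⟨i, c, m, a, rfl⟩)

theorem mk_single (c : K) (m : M) (a : Fin 0 → A) :
    mk ι (op (ι c) • m) a = mk ι (ι c • m) a := mk_balance ι (0 : Fin 1) c m a

theorem mk_first {r : ℕ} (c : K) (m : M) (a : Fin (r + 1) → A) :
    mk ι (op (ι c) • m) a = mk ι m (Function.update a 0 (ι c * a 0)) := by
  have := mk_balance ι (0 : Fin (r + 2)) c m a
  have h2 : mulLeftAt (0 : Fin (r + 2)) (ι c) m a = (m, Function.update a 0 (ι c * a 0)) :=
    Fin.lastCases_castSucc (i := (0 : Fin (r + 1))) ..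
  rw [h2] at this
  exact this

theorem mk_mid {r : ℕ} (i : Fin r) (c : K) (m : M) (a : Fin (r + 1) → A) :
    mk ι m (Function.update a i.castSucc (a i.castSucc * ι c)) =
      mk ι m (Function.update a i.succ (ι c * a i.succ)) := by
  have := mk_balance ι i.castSucc.succ c m a
  rw [mulRightAt, Fin.cases_succ, Fin.succ_castSucc, mulLeftAt, Fin.lastCases_castSucc] at this
  exact this

theorem mk_last {r : ℕ} (c : K) (m : M) (a : Fin (r + 1) → A) :
    mk ι m (Function.update a (Fin.last r) (a (Fin.last r) * ι c)) = mk ι (ι c • m) a := by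
  have := mk_balance ι (Fin.last (r + 1)) c m a
  rw [mulLeftAt, Fin.lastCases_last, ← Fin.succ_last, mulRightAt, Fin.cases_succ] at this
  exact this

/-- The linear map out of `M ⊗ Ā^{⊗ r} ⊗` given by a multilinear function compatible with the
relations. -/
def lift {r : ℕ} {N : Type*} [AddCommGroup N] [Module k N] (F : M → (Fin r → A) → N)
    (h1 : ∀ m m' a, F (m + m') a = F m a + F m' a)
    (h2 : ∀ (c : k) m a, F (c • m) a = c • F m a)
    (h3 : ∀ m a i x y, F m (Function.update a i (x + y)) =
      F m (Function.update a i x) + F m (Function.update a i y))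
    (h4 : ∀ m a i (c : k) x, F m (Function.update a i (c • x)) =
      c • F m (Function.update a i x))
    (h5 : ∀ (j : Fin (r + 1)) (c : K) m a,
      F (mulRightAt j (ι c) m a).1 (mulRightAt j (ι c) m a).2 =
        F (mulLeftAt j (ι c) m a).1 (mulLeftAt j (ι c) m a).2)
    (h6 : ∀ (i : Fin r) (c : K) m a, F m (Function.update a i (ι c)) = 0) :
    Hoch ι M r →ₗ[k] N :=
  Submodule.liftQ _ (preLift k F h1 h2 h3 h4) (by
    rw [Submodule.span_le]
    rintro t (⟨j, c, m, a, rfl⟩ | ⟨i, c, m, a, rfl⟩)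
    · simp [preLift_preWord, h5]
    · simp [preLift_preWord, h6])

theorem lift_mk {r : ℕ} {N : Type*} [AddCommGroup N] [Module k N] (F : M → (Fin r → A) → N)
    (h1 h2 h3 h4 h5 h6) (m : M) (a : Fin r → A) :
    lift ι F h1 h2 h3 h4 h5 h6 (mk ι m a) = F m a := by
  rw [lift, mk, Submodule.liftQ_apply, preLift_preWord]

theorem hom_ext {r : ℕ} {N : Type*} [AddCommGroup N] [Module k N] {f g : Hoch ι M r →ₗ[k] N}
    (h : ∀ m a, f (mk ι m a) = g (mk ι m a)) : f = g := by
  apply Submodule.linearMap_qext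
  ext m a
  exact h m a

/-- The `j`-th face of `m ⊗ a_1 ⊗ ⋯ ⊗ a_{r+1}`: multiply the factors on the two sides of the `j`-th
tensor sign of the cyclic word. -/
def face {r : ℕ} (j : Fin (r + 2)) (m : M) (a : Fin (r + 1) → A) : Hoch ι M r :=
  if j = 0 then mk ι (op (a 0) • m) (Fin.tail a)
  else if h : (j : ℕ) - 1 < r then mk ι m (Fin.contractNth (Fin.castSucc ⟨j - 1, h⟩) (· * ·) a)
  else mk ι (a (Fin.last r) • m) (Fin.init a)

section Boundary

theorem face_zero {r : ℕ} (m : M) (a : Fin (r + 1) → A) :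
    face ι 0 m a = mk ι (op (a 0) • m) (Fin.tail a) := if_pos rfl

theorem face_mid {r : ℕ} (j : Fin r) (m : M) (a : Fin (r + 1) → A) :
    face ι j.castSucc.succ m a = mk ι m (Fin.contractNth j.castSucc (· * ·) a) := by
  rw [face, if_neg (Fin.succ_ne_zero _), dif_pos (by simp)]
  rfl

theorem face_last {r : ℕ} (m : M) (a : Fin (r + 1) → A) :
    face ι (Fin.last (r + 1)) m a = mk ι (a (Fin.last r) • m) (Fin.init a) := by
  rw [face, if_neg (Fin.last_pos).ne', dif_neg (by simp)]

theorem face_cases {r : ℕ} {P : Fin (r + 2) → Prop} (h0 : P 0) (h1 : ∀ j : Fin r, P j.castSucc.succ)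
    (h2 : P (Fin.last (r + 1))) (j : Fin (r + 2)) : P j := by
  induction j using Fin.cases with
  | zero => exact h0
  | succ i =>
    induction i using Fin.lastCases with
    | last => exact h2
    | cast i => exact h1 i

variable [SMulCommClass A Aᵐᵒᵖ M] [IsScalarTower k A M] [IsScalarTower k Aᵐᵒᵖ M]

theorem face_add {r : ℕ} (j : Fin (r + 2)) (m m' : M) (a : Fin (r + 1) → A) :
    face ι j (m + m') a = face ι j m a + face ι j m' a := by
  induction j using face_cases <;> simp only [face_zero, face_mid, face_last, smul_add, mk_add]

theorem face_smul {r : ℕ} (j : Fin (r + 2)) (c : k) (m : M) (a : Fin (r + 1) → A) :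
    face ι j (c • m) a = c • face ι j m a := by
  have : SMulCommClass k A M := inferInstance
  induction j using face_cases
  · rw [face_zero, face_zero, smul_comm, mk_smul]
  · rw [face_mid, face_mid, mk_smul]
  · rw [face_last, face_last, smul_comm, mk_smul]

theorem face_update_add {r : ℕ} (j : Fin (r + 2)) (m : M) (a : Fin (r + 1) → A) (i : Fin (r + 1))
    (x y : A) : face ι j m (Function.update a i (x + y)) =
      face ι j m (Function.update a i x) + face ι j m (Function.update a i y) := by
  induction j using face_cases with
  | h0 =>
    simp only [face_zero]
    induction i using Fin.cases with
    | zero => simp [Fin.tail_update_zero, add_smul, mk_add]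
    | succ i => simp [Fin.tail_update_succ, mk_update_add, (Fin.succ_ne_zero i).symm]
  | h1 j =>
    simp only [face_mid]
    obtain ⟨s, g, h⟩ := contractNth_update_linear k j i a
    simp only [h, map_add, mk_update_add]
  | h2 =>
    simp only [face_last]
    induction i using Fin.lastCases with
    | last => simp [Fin.init_update_last, add_smul, mk_add]
    | cast i => simp [Fin.init_update_castSucc, mk_update_add, i.castSucc_lt_last.ne']

theorem face_update_smul {r : ℕ} (j : Fin (r + 2)) (m : M) (a : Fin (r + 1) → A) (i : Fin (r + 1))
    (c : k) (x : A) : face ι j m (Function.update a i (c • x)) =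
      c • face ι j m (Function.update a i x) := by
  induction j using face_cases with
  | h0 =>
    simp only [face_zero]
    induction i using Fin.cases with
    | zero => simp [Fin.tail_update_zero, op_smul, smul_assoc, mk_smul]
    | succ i => simp [Fin.tail_update_succ, mk_update_smul, (Fin.succ_ne_zero i).symm]
  | h1 j =>
    simp only [face_mid]
    obtain ⟨s, g, h⟩ := contractNth_update_linear k j i a
    simp only [h, map_smul, mk_update_smul]
  | h2 =>
    simp only [face_last]
    induction i using Fin.lastCases with
    | last => simp [Fin.init_update_last, smul_assoc, mk_smul]
    | cast i => simp [Fin.init_update_castSucc, mk_update_smul, i.castSucc_lt_last.ne']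

theorem face_first {r : ℕ} (j : Fin (r + 2)) (c : K) (m : M) (a : Fin (r + 1) → A) :
    face ι j (op (ι c) • m) a = face ι j m (Function.update a 0 (ι c * a 0)) := by
  induction j using face_cases with
  | h0 => simp [face_zero, Fin.tail_update_zero, mul_smul]
  | h1 j =>
    obtain ⟨r, rfl⟩ : ∃ r', r = r' + 1 := ⟨r - 1, by have := j.2; omega⟩
    rw [face_mid, face_mid, mk_first, contractNth_update_mul_left j a 0 0 _ (by simp)]
  | h2 =>
    simp only [face_last]
    cases r with
    | zero =>
      rw [smul_comm, mk_single]
      simp [mul_smul, Subsingleton.elim (Fin.init (Function.update a 0 (ι c * a 0))) (Fin.init a)]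
    | succ r =>
      have e : Fin.init (Function.update a 0 (ι c * a 0)) =
          Function.update (Fin.init a) 0 (ι c * a 0) :=
        Fin.init_update_castSucc (i := (0 : Fin (r + 1))) ..
      rw [smul_comm, mk_first, e]
      simp [Fin.init, Fin.ext_iff]

theorem face_endpoint {r : ℕ} (j : Fin (r + 2)) (c : K) (m : M) (a : Fin (r + 1) → A) :
    face ι j m (Function.update a (Fin.last r) (a (Fin.last r) * ι c)) = face ι j (ι c • m) a := by
  induction j using face_cases with
  | h0 =>
    simp only [face_zero]
    cases r with
    | zero =>
      have e : Fin.tail (Function.update a (Fin.last 0) (a (Fin.last 0) * ι c)) = Fin.tail a :=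
        Subsingleton.elim _ _
      rw [← smul_comm (ι c), ← mk_single, e]
      simp [mul_smul]
    | succ r =>
      rw [← smul_comm (ι c), ← mk_last, ← Fin.succ_last, Fin.tail_update_succ]
      simp [Fin.tail, Fin.ext_iff]
  | h1 j =>
    obtain ⟨r, rfl⟩ : ∃ r', r = r' + 1 := ⟨r - 1, by have := j.2; omega⟩
    rw [face_mid, face_mid, ← mk_last,
      contractNth_update_mul_right j a (Fin.last (r + 1)) (Fin.last r) _ (Or.inr ⟨j.2, rfl⟩)]
  | h2 => simp [face_last, Fin.init_update_last, mul_smul]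

theorem face_middle {r : ℕ} (j : Fin (r + 2)) (i : Fin r) (c : K) (m : M) (a : Fin (r + 1) → A) :
    face ι j m (Function.update a i.castSucc (a i.castSucc * ι c)) =
      face ι j m (Function.update a i.succ (ι c * a i.succ)) := by
  induction j using face_cases with
  | h0 =>
    obtain ⟨r, rfl⟩ : ∃ r', r = r' + 1 := ⟨r - 1, by have := i.2; omega⟩
    simp only [face_zero, Fin.tail_update_succ]
    induction i using Fin.cases with
    | zero =>
      rw [Fin.castSucc_zero, Fin.tail_update_zero, Function.update_self,
        Function.update_of_ne (by simp), op_mul, mul_smul, mk_first]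
      rfl
    | succ i =>
      rw [← Fin.succ_castSucc, Fin.tail_update_succ, Function.update_of_ne (by simp [Fin.ext_iff]),
        Function.update_of_ne (by simp [Fin.ext_iff])]
      exact mk_mid ι i c _ _
  | h1 j =>
    rw [face_mid, face_mid]
    by_cases e : i = j
    · subst e
      rw [contractNth_update_left, contractNth_update_right, mul_assoc]
    · have e := Fin.val_ne_of_ne e
      obtain ⟨r, rfl⟩ : ∃ r', r = r' + 1 := ⟨r - 1, by have := i.2; omega⟩
      by_cases h : (i : ℕ) < j
      · rw [contractNth_update_mul_right j a i.castSucc i _ (by simp; omega),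
          contractNth_update_mul_left j a i.succ ⟨i + 1, by omega⟩ _ (by simp; omega)]
        exact mk_mid ι ⟨i, by omega⟩ c _ _
      · obtain ⟨i, rfl⟩ := Fin.exists_succ_eq.2 (show i ≠ 0 by rintro rfl; simp at h e; omega)
        simp only [Fin.val_succ] at h e
        rw [contractNth_update_mul_right j a i.succ.castSucc i.castSucc _ (by simp; omega),
          contractNth_update_mul_left j a i.succ.succ i.succ _ (by simp; omega)]
        exact mk_mid ι i c _ _
  | h2 =>
    obtain ⟨r, rfl⟩ : ∃ r', r = r' + 1 := ⟨r - 1, by have := i.2; omega⟩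
    simp only [face_last, Fin.init_update_castSucc]
    induction i using Fin.lastCases with
    | last =>
      rw [Fin.succ_last, Fin.init_update_last, Function.update_self,
        Function.update_of_ne (by simp [Fin.ext_iff]), mul_smul, ← mk_last]
      rfl
    | cast i =>
      rw [Fin.succ_castSucc, Fin.init_update_castSucc,
        Function.update_of_ne (by simp [Fin.ext_iff]; omega),
        Function.update_of_ne (by simp [Fin.ext_iff]; omega)]
      exact mk_mid ι i c _ _

theorem face_base_ne {r : ℕ} (j : Fin (r + 2)) (i : Fin (r + 1)) (c : K) (m : M)
    (a : Fin (r + 1) → A) (h : j ≠ i.castSucc) (h' : j ≠ i.succ) :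
    face ι j m (Function.update a i (ι c)) = 0 := by
  induction j using face_cases with
  | h0 =>
    obtain ⟨i, rfl⟩ := Fin.exists_succ_eq.2 (show i ≠ 0 by rintro rfl; exact h rfl)
    rw [face_zero, Fin.tail_update_succ, mk_update_base]
  | h1 j =>
    simp only [ne_eq, Fin.ext_iff, Fin.val_succ, Fin.val_castSucc] at h h'
    rw [face_mid]
    by_cases e : (i : ℕ) < j
    · obtain ⟨i, rfl⟩ : ∃ i' : Fin r, i = i'.castSucc := ⟨⟨i, by omega⟩, rfl⟩
      rw [contractNth_update_of_lt _ _ _ _ (by simpa using e), mk_update_base]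
    · obtain ⟨i, rfl⟩ := Fin.exists_succ_eq.2 (show i ≠ 0 by rintro rfl; simp at h' e; omega)
      simp only [Fin.val_succ] at h h' e
      rw [contractNth_update_of_gt _ _ _ _ (by simp; omega), mk_update_base]
  | h2 =>
    induction i using Fin.lastCases with
    | last => exact absurd rfl h'
    | cast i => rw [face_last, Fin.init_update_castSucc, mk_update_base]

theorem face_base_eq {r : ℕ} (i : Fin (r + 1)) (c : K) (m : M) (a : Fin (r + 1) → A) :
    face ι i.castSucc m (Function.update a i (ι c)) =
      face ι i.succ m (Function.update a i (ι c)) := by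
  induction i using Fin.cases with
  | zero =>
    rw [Fin.castSucc_zero, face_zero, Function.update_self, Fin.tail_update_zero]
    cases r with
    | zero =>
      rw [mk_single]
      exact ((face_last ι m _).trans (by
        congr 1; exact Subsingleton.elim _ _)).symm
    | succ r =>
      rw [show Fin.succ 0 = (0 : Fin (r + 1)).castSucc.succ from rfl, face_mid, mk_first]
      have := contractNth_update_left (0 : Fin (r + 1)) a (ι c)
      rw [Fin.castSucc_zero] at this ⊢
      rw [this]
      congr 1
      funext p
      induction p using Fin.cases with
      | zero => simp [Fin.tail]
      | succ p => simp [Fin.tail, Fin.contractNth]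
  | succ i =>
    rw [← Fin.succ_castSucc, face_mid, contractNth_update_right]
    obtain ⟨r, rfl⟩ : ∃ r', r = r' + 1 := ⟨r - 1, by have := i.2; omega⟩
    induction i using Fin.lastCases with
    | last =>
      rw [show (Fin.last r).succ.succ = Fin.last (r + 2) from rfl, face_last,
        show (Fin.last r).succ = Fin.last (r + 1) from rfl, Function.update_self,
        Fin.init_update_last, ← mk_last]
      congr 1
      funext p
      induction p using Fin.lastCases with
      | last => simp [Fin.init]
      | cast p => simp [Fin.init, Fin.contractNth, p.castSucc_lt_last.ne]
    | cast i =>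
      rw [show i.castSucc.succ.succ = i.succ.castSucc.succ from rfl, face_mid,
        show i.castSucc.succ = i.succ.castSucc from rfl, contractNth_update_left]
      have := mk_mid ι i c m (Function.update
        (Function.update (Fin.contractNth i.castSucc.castSucc (· * ·) a) i.castSucc
          (a i.castSucc.castSucc)) i.succ (a i.succ.succ))
      convert! this using 2
      · funext p
        simp only [Fin.contractNth, Function.update_apply, Fin.ext_iff, Fin.val_castSucc,
          Fin.val_succ]
        split_ifs <;> first | rfl | omega | skip
        all_goals (congr 1; simp [Fin.ext_iff]; omega)
      · funext p
        simp only [Fin.contractNth, Function.update_apply, Fin.ext_iff, Fin.val_castSucc,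
          Fin.val_succ]
        split_ifs <;> first | rfl | omega | skip
        all_goals (congr 1; simp [Fin.ext_iff]; omega)


variable (M) in
/-- The Hochschild boundary `b : M ⊗ Ā^{⊗ (r + 1)} ⊗ → M ⊗ Ā^{⊗ r} ⊗`. -/
def b (r : ℕ) : Hoch ι M (r + 1) →ₗ[k] Hoch ι M r :=
  lift ι (fun m a => ∑ j : Fin (r + 2), (-1 : k) ^ (j : ℕ) • face ι j m a)
    (fun m m' a => by simp only [face_add, smul_add, Finset.sum_add_distrib])
    (fun c m a => by simp only [face_smul, Finset.smul_sum, smul_comm c])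
    (fun m a i x y => by simp only [face_update_add, smul_add, Finset.sum_add_distrib])
    (fun m a i c x => by simp only [face_update_smul, Finset.smul_sum, smul_comm c])
    (fun j c m a => by
      refine Finset.sum_congr rfl fun p _ => ?_
      congr 1
      induction j using face_cases with
      | h0 =>
        have h2 : mulLeftAt (0 : Fin (r + 2)) (ι c) m a = (m, Function.update a 0 (ι c * a 0)) :=
          Fin.lastCases_castSucc (i := (0 : Fin (r + 1))) ..
        rw [h2]
        exact face_first ι p c m a
      | h1 i =>
        rw [mulRightAt, Fin.cases_succ, Fin.succ_castSucc, mulLeftAt, Fin.lastCases_castSucc]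
        exact face_middle ι p i c m a
      | h2 =>
        rw [mulLeftAt, Fin.lastCases_last, ← Fin.succ_last, mulRightAt, Fin.cases_succ]
        exact face_endpoint ι p c m a)
    (fun i c m a => by
      rw [Fintype.sum_eq_add i.castSucc i.succ (by simp [Fin.ext_iff])
        (fun p hp => by rw [face_base_ne ι p i c m a hp.1 hp.2, smul_zero]), face_base_eq,
        Fin.val_castSucc, Fin.val_succ, pow_succ, ← add_smul]
      simp)

/-- `b [m ⊗ a_1 ⊗ ⋯ ⊗ a_{r+1}]` is `[m a_1 ⊗ a_2 ⊗ ⋯]` plus the sum of the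
`(-1) ^ j [m ⊗ ⋯ ⊗ a_j a_{j+1} ⊗ ⋯]` plus `(-1) ^ (r + 1) [a_{r+1} m ⊗ a_1 ⊗ ⋯ ⊗ a_r]`. -/
theorem b_mk {r : ℕ} (m : M) (a : Fin (r + 1) → A) :
    b ι M r (mk ι m a) = mk ι (op (a 0) • m) (Fin.tail a)
      + (∑ j : Fin r, (-1 : k) ^ ((j : ℕ) + 1) • mk ι m (Fin.contractNth j.castSucc (· * ·) a))
      + (-1 : k) ^ (r + 1) • mk ι (a (Fin.last r) • m) (Fin.init a) := by
  rw [b, lift_mk, Fin.sum_univ_succ, Fin.sum_univ_castSucc, Fin.succ_last, face_zero, face_last,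
    ← add_assoc]
  simp [face_mid]

end Boundary
end Hoch
end Hoch

section Functoriality

variable {k} (ι : K →ₐ[k] A)
variable {M N : Type*} [AddCommGroup M] [Module k M] [Module A M] [Module Aᵐᵒᵖ M]
  [AddCommGroup N] [Module k N] [Module A N] [Module Aᵐᵒᵖ N]

/-- The map `M ⊗ Ā^{⊗ r} ⊗ → N ⊗ Ā^{⊗ r} ⊗` induced by a morphism of `A`-bimodules `M → N`. -/
def Hoch.map (f : M →ₗ[k] N) (hl : ∀ (a : A) m, f (a • m) = a • f m)
    (hr : ∀ (a : A) m, f (op a • m) = op a • f m) (r : ℕ) : Hoch ι M r →ₗ[k] Hoch ι N r :=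
  Hoch.lift ι (fun m a => Hoch.mk ι (f m) a)
    (fun m m' a => by rw [map_add, Hoch.mk_add])
    (fun c m a => by rw [map_smul, Hoch.mk_smul])
    (fun m a i x y => Hoch.mk_update_add ι _ a i x y)
    (fun m a i c x => Hoch.mk_update_smul ι _ a i c x)
    (fun j c m a => by
      have e1 : (f (mulRightAt j (ι c) m a).1, (mulRightAt j (ι c) m a).2) =
          mulRightAt j (ι c) (f m) a := by
        induction j using Fin.cases with
        | zero => simp [mulRightAt, hr]
        | succ i => simp [mulRightAt]
      have e2 : (f (mulLeftAt j (ι c) m a).1, (mulLeftAt j (ι c) m a).2) =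
          mulLeftAt j (ι c) (f m) a := by
        induction j using Fin.lastCases with
        | last => simp [mulLeftAt, hl]
        | cast i => simp [mulLeftAt]
      have := Hoch.mk_balance ι j c (f m) a
      rw [← e1, ← e2] at this
      exact this)
    (fun i c m a => Hoch.mk_update_base ι i c _ a)

theorem Hoch.map_mk (f : M →ₗ[k] N) (hl hr) {r : ℕ} (m : M) (a : Fin r → A) :
    Hoch.map ι f hl hr r (Hoch.mk ι m a) = Hoch.mk ι (f m) a := by
  rw [Hoch.map, Hoch.lift_mk]

end Functoriality

variable (A) in
/-- The `k`-module `A ⊗_k A` with the inner `A`-bimodule structure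
`c (u ⊗ v) d = u d ⊗ c v`. -/
def InnerSq : Type _ := A ⊗[k] A

instance : AddCommGroup (InnerSq k A) := inferInstanceAs (AddCommGroup (A ⊗[k] A))
instance : Module k (InnerSq k A) := inferInstanceAs (Module k (A ⊗[k] A))

/-- The element `u ⊗ v`. -/
def InnerSq.tmul (u v : A) : InnerSq k A := u ⊗ₜ[k] v

instance : Module A (InnerSq k A) where
  smul c t := (LinearMap.mulLeft k c).lTensor A t
  one_smul t := by
    change (LinearMap.mulLeft k (1 : A)).lTensor A t = t
    rw [LinearMap.mulLeft_one, LinearMap.lTensor_id]; rfl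
  mul_smul c d t := by
    change (LinearMap.mulLeft k (c * d)).lTensor A t =
      (LinearMap.mulLeft k c).lTensor A ((LinearMap.mulLeft k d).lTensor A t)
    rw [LinearMap.mulLeft_mul, LinearMap.lTensor_comp]; rfl
  smul_zero c := map_zero _
  smul_add c s t := map_add _ s t
  add_smul c d t := by
    change (LinearMap.mul k A (c + d)).lTensor A t =
      (LinearMap.mul k A c).lTensor A t + (LinearMap.mul k A d).lTensor A t
    rw [map_add, LinearMap.lTensor_add]; rfl
  zero_smul t := by
    change (LinearMap.mul k A 0).lTensor A t = 0
    rw [map_zero, LinearMap.lTensor_zero]; rfl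

instance : Module Aᵐᵒᵖ (InnerSq k A) where
  smul c t := (LinearMap.mulRight k c.unop).rTensor A t
  one_smul t := by
    change (LinearMap.mulRight k (1 : A)).rTensor A t = t
    rw [LinearMap.mulRight_one, LinearMap.rTensor_id]; rfl
  mul_smul c d t := by
    change (LinearMap.mulRight k (d.unop * c.unop)).rTensor A t =
      (LinearMap.mulRight k c.unop).rTensor A ((LinearMap.mulRight k d.unop).rTensor A t)
    rw [LinearMap.mulRight_mul, LinearMap.rTensor_comp]; rfl
  smul_zero c := map_zero _
  smul_add c s t := map_add _ s t
  add_smul c d t := by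
    change ((LinearMap.mul k A).flip (c.unop + d.unop)).rTensor A t =
      ((LinearMap.mul k A).flip c.unop).rTensor A t + ((LinearMap.mul k A).flip d.unop).rTensor A t
    rw [map_add, LinearMap.rTensor_add]; rfl
  zero_smul t := by
    change ((LinearMap.mul k A).flip 0).rTensor A t = 0
    rw [map_zero, LinearMap.rTensor_zero]; rfl

namespace InnerSq

theorem smul_tmul (c u v : A) : c • tmul k u v = tmul k u (c * v) := rfl
theorem op_smul_tmul (c u v : A) : op c • tmul k u v = tmul k (u * c) v := rfl

variable {k} in
/-- The linear map given by a bilinear map. -/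
def lift {N : Type*} [AddCommGroup N] [Module k N] (g : A →ₗ[k] A →ₗ[k] N) :
    InnerSq k A →ₗ[k] N := TensorProduct.lift g

variable {k} in
theorem lift_tmul {N : Type*} [AddCommGroup N] [Module k N] (g : A →ₗ[k] A →ₗ[k] N) (u v : A) :
    lift g (tmul k u v) = g u v := rfl

variable {k} in
theorem induction {P : InnerSq k A → Prop} (h0 : P 0) (h1 : ∀ u v, P (tmul k u v))
    (h2 : ∀ s t, P s → P t → P (s + t)) (t : InnerSq k A) : P t :=
  TensorProduct.induction_on (motive := P) t h0 h1 h2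

instance : SMulCommClass A Aᵐᵒᵖ (InnerSq k A) where
  smul_comm c d t := by
    induction t using induction with
    | h0 => simp
    | h1 u v => rfl
    | h2 s t hs ht => simp only [smul_add, hs, ht]

instance : IsScalarTower k A (InnerSq k A) where
  smul_assoc c d t := by
    change (LinearMap.mul k A (c • d)).lTensor A t = c • (LinearMap.mul k A d).lTensor A t
    rw [map_smul, LinearMap.lTensor_smul]; rfl

instance : IsScalarTower k Aᵐᵒᵖ (InnerSq k A) where
  smul_assoc c d t := by
    change ((LinearMap.mul k A).flip (c • d.unop)).rTensor A t =
      c • ((LinearMap.mul k A).flip d.unop).rTensor A t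
    rw [map_smul, LinearMap.rTensor_smul]; rfl

end InnerSq

section BarSection

variable {k} (ι : K →ₐ[k] A)

/-- The module `A ⊗_K Ā^{⊗_K r} ⊗_K A`. It is obtained by tensoring `A ⊗_k A` (inner bimodule
structure) cyclically with `Ā^{⊗ r}`: in the notation `u ⊗ a_1 ⊗ ⋯ ⊗ a_r ⊗ v` of `Bar.mk` the relations
become `u c ⊗ a_1 = u ⊗ c a_1`, `a_i c ⊗ a_{i+1} = a_i ⊗ c a_{i+1}`, `a_r c ⊗ v = a_r ⊗ c v` for `c` in
`K`, together with `⋯ ⊗ c ⊗ ⋯ = 0` for `c` in `K` at an inner place. -/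
abbrev Bar (r : ℕ) : Type _ := Hoch ι (InnerSq k A) r

namespace Bar

/-- The element `u ⊗ a_1 ⊗ ⋯ ⊗ a_r ⊗ v`. -/
def mk {r : ℕ} (u : A) (a : Fin r → A) (v : A) : Bar ι r := Hoch.mk ι (InnerSq.tmul k u v) a

/-- The boundary of the canonical (normalized) Hochschild resolution; see the formula below. -/
abbrev b' (r : ℕ) : Bar ι (r + 1) →ₗ[k] Bar ι r := Hoch.b ι (InnerSq k A) r

theorem b'_mk {r : ℕ} (u : A) (a : Fin (r + 1) → A) (v : A) :
    b' ι r (mk ι u a v) = mk ι (u * a 0) (Fin.tail a) v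
      + (∑ j : Fin r, (-1 : k) ^ ((j : ℕ) + 1) • mk ι u (Fin.contractNth j.castSucc (· * ·) a) v)
      + (-1 : k) ^ (r + 1) • mk ι u (Fin.init a) (a (Fin.last r) * v) :=
  Hoch.b_mk ι _ a

/-- The left action of `A` on `A ⊗ Ā^{⊗ r} ⊗ A`. -/
def lmul (c : A) (r : ℕ) : Bar ι r →ₗ[k] Bar ι r :=
  Hoch.map ι (InnerSq.lift ((TensorProduct.mk k A A).comp (LinearMap.mulLeft k c)) :
      InnerSq k A →ₗ[k] InnerSq k A)
    (fun d t => by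
      induction t using InnerSq.induction with
      | h0 => simp
      | h1 u v => rfl
      | h2 s t hs ht => simp only [smul_add, map_add, hs, ht])
    (fun d t => by
      induction t using InnerSq.induction with
      | h0 => simp
      | h1 u v => 
        change InnerSq.tmul k (c * (u * d)) v = InnerSq.tmul k (c * u * d) v
        rw [mul_assoc]
      | h2 s t hs ht => simp only [smul_add, map_add, hs, ht]) r

theorem lmul_mk {r : ℕ} (c u : A) (a : Fin r → A) (v : A) :
    lmul ι c r (mk ι u a v) = mk ι (c * u) a v := Hoch.map_mk ..

/-- The right action of `A` on `A ⊗ Ā^{⊗ r} ⊗ A`. -/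
def rmul (c : A) (r : ℕ) : Bar ι r →ₗ[k] Bar ι r :=
  Hoch.map ι (InnerSq.lift ((TensorProduct.mk k A A).compl₂ (LinearMap.mulRight k c)) :
      InnerSq k A →ₗ[k] InnerSq k A)
    (fun d t => by
      induction t using InnerSq.induction with
      | h0 => simp
      | h1 u v => 
        change InnerSq.tmul k u (d * v * c) = InnerSq.tmul k u (d * (v * c))
        rw [mul_assoc]
      | h2 s t hs ht => simp only [smul_add, map_add, hs, ht])
    (fun d t => by
      induction t using InnerSq.induction with
      | h0 => simp
      | h1 u v => rfl
      | h2 s t hs ht => simp only [smul_add, map_add, hs, ht]) r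

theorem rmul_mk {r : ℕ} (c u : A) (a : Fin r → A) (v : A) :
    rmul ι c r (mk ι u a v) = mk ι u a (v * c) := Hoch.map_mk ..

/-- The bilinear map `(u, v) ↦ u ⊗ a_1 ⊗ ⋯ ⊗ a_r ⊗ v ⊗ 1`. -/
def snocAux {r : ℕ} (a : Fin r → A) : A →ₗ[k] A →ₗ[k] Bar ι (r + 1) :=
  LinearMap.mk₂ k (fun u v => mk ι u (Fin.snoc (α := fun _ => A) a v) 1)
    (fun u u' v => by
      rw [mk, mk, mk, ← Hoch.mk_add]
      congr 1
      exact TensorProduct.add_tmul _ _ _)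
    (fun c u v => by
      rw [mk, mk, ← Hoch.mk_smul]
      rfl)
    (fun u v v' => by
      have := Hoch.mk_update_add ι (InnerSq.tmul k u (1 : A))
        (Fin.snoc (α := fun _ => A) a 0) (Fin.last r) v v'
      simp only [Fin.update_snoc_last] at this
      exact this)
    (fun c u v => by
      have := Hoch.mk_update_smul ι (InnerSq.tmul k u (1 : A))
        (Fin.snoc (α := fun _ => A) a 0) (Fin.last r) c v
      simp only [Fin.update_snoc_last] at this
      exact this)

theorem lift_snocAux {r : ℕ} (a : Fin r → A) (u v : A) :
    InnerSq.lift (snocAux ι a) (InnerSq.tmul k u v) =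
      mk ι u (Fin.snoc (α := fun _ => A) a v) 1 := rfl

theorem snoc_balance {r : ℕ} (j : Fin (r + 1)) (c : K) (t : InnerSq k A) (a : Fin r → A) :
    InnerSq.lift (snocAux ι (mulRightAt j (ι c) t a).2) (mulRightAt j (ι c) t a).1 =
      InnerSq.lift (snocAux ι (mulLeftAt j (ι c) t a).2) (mulLeftAt j (ι c) t a).1 := by
  cases r with
  | zero =>
    obtain rfl : j = 0 := Fin.ext (by simp)
    change InnerSq.lift (snocAux ι a) (op (ι c) • t) = InnerSq.lift (snocAux ι a) (ι c • t)
    induction t using InnerSq.induction with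
    | h0 => simp
    | h1 u v =>
      rw [InnerSq.op_smul_tmul, InnerSq.smul_tmul, lift_snocAux, lift_snocAux]
      refine (Hoch.mk_first ι c (InnerSq.tmul k u 1) (Fin.snoc (α := fun _ => A) a v)).trans ?_
      refine congrArg (Hoch.mk ι (InnerSq.tmul k u (1 : A))) (funext fun p => ?_)
      obtain rfl : p = Fin.last 0 := Fin.ext (by simp)
      have e : (0 : Fin 1) = Fin.last 0 := rfl
      rw [e, Function.update_self, Fin.snoc_last, Fin.snoc_last]
    | h2 s t hs ht => simp only [smul_add, map_add, hs, ht]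
  | succ r =>
    induction j using Hoch.face_cases with
    | h0 =>
      have h2 : mulLeftAt (0 : Fin (r + 2)) (ι c) t a = (t, Function.update a 0 (ι c * a 0)) :=
        Fin.lastCases_castSucc (i := (0 : Fin (r + 1))) ..
      rw [h2]
      change InnerSq.lift (snocAux ι a) (op (ι c) • t) =
        InnerSq.lift (snocAux ι (Function.update a 0 (ι c * a 0))) t
      induction t using InnerSq.induction with
      | h0 => simp
      | h1 u v =>
        rw [InnerSq.op_smul_tmul, lift_snocAux, lift_snocAux, Fin.snoc_update]
        refine (Hoch.mk_first ι c (InnerSq.tmul k u 1) (Fin.snoc (α := fun _ => A) a v)).trans ?_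
        have e : Fin.snoc (α := fun _ => A) a v 0 = a 0 :=
          Fin.snoc_castSucc (α := fun _ => A) v a 0
        rw [e]
        rfl
      | h2 s t hs ht =>
        simp only [smul_add, map_add]
        rw [hs (Fin.lastCases_castSucc (i := (0 : Fin (r + 1))) ..),
          ht (Fin.lastCases_castSucc (i := (0 : Fin (r + 1))) ..)]
    | h1 i =>
      rw [mulRightAt, Fin.cases_succ, Fin.succ_castSucc, mulLeftAt, Fin.lastCases_castSucc]
      induction t using InnerSq.induction with
      | h0 => simp
      | h1 u v =>
        dsimp only
        rw [lift_snocAux, lift_snocAux, Fin.snoc_update, Fin.snoc_update]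
        have := Hoch.mk_mid ι i.castSucc c (InnerSq.tmul k u 1) (Fin.snoc (α := fun _ => A) a v)
        rw [Fin.succ_castSucc, Fin.snoc_castSucc, Fin.snoc_castSucc] at this
        exact this
      | h2 s t hs ht =>
        dsimp only at hs ht ⊢
        rw [map_add, map_add, hs, ht]
    | h2 =>
      rw [mulLeftAt, Fin.lastCases_last, ← Fin.succ_last, mulRightAt, Fin.cases_succ]
      induction t using InnerSq.induction with
      | h0 => simp
      | h1 u v =>
        dsimp only
        rw [InnerSq.smul_tmul, lift_snocAux, lift_snocAux, Fin.snoc_update]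
        have := Hoch.mk_mid ι (Fin.last r) c (InnerSq.tmul k u 1)
          (Fin.snoc (α := fun _ => A) a v)
        rw [Fin.succ_last, Fin.snoc_castSucc, Fin.snoc_last, Fin.update_snoc_last] at this
        exact this
      | h2 s t hs ht =>
        dsimp only at hs ht ⊢
        rw [smul_add, map_add, map_add, hs, ht]

/-- The map `y ↦ y ⊗ 1` from `A ⊗ Ā^{⊗ r} ⊗ A` to `A ⊗ Ā^{⊗ (r + 1)} ⊗ A`. -/
def appendOne (r : ℕ) : Bar ι r →ₗ[k] Bar ι (r + 1) :=
  Hoch.lift ι (fun t a => InnerSq.lift (snocAux ι a) t)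
    (fun t t' a => map_add _ _ _)
    (fun c t a => map_smul _ _ _)
    (fun t a i x y => by
      induction t using InnerSq.induction with
      | h0 => simp
      | h1 u v =>
        simp only [lift_snocAux, Fin.snoc_update]
        exact Hoch.mk_update_add ..
      | h2 s t hs ht => simp only [map_add, hs, ht]; abel)
    (fun t a i c x => by
      induction t using InnerSq.induction with
      | h0 => simp
      | h1 u v =>
        simp only [lift_snocAux, Fin.snoc_update]
        exact Hoch.mk_update_smul ..
      | h2 s t hs ht => simp only [map_add, hs, ht, smul_add])
    (fun j c t a => snoc_balance ι j c t a)
    (fun i c t a => by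
      induction t using InnerSq.induction with
      | h0 => simp
      | h1 u v =>
        simp only [lift_snocAux, Fin.snoc_update]
        exact Hoch.mk_update_base ..
      | h2 s t hs ht => simp only [map_add, hs, ht, add_zero])

theorem appendOne_mk {r : ℕ} (u : A) (a : Fin r → A) (v : A) :
    appendOne ι r (mk ι u a v) = mk ι u (Fin.snoc (α := fun _ => A) a v) 1 := by
  rw [appendOne, mk, Hoch.lift_mk, lift_snocAux]

end Bar
end BarSection

section Envelope

variable {k} (ι : K →ₐ[k] A)
variable (M : Type*) [AddCommGroup M] [Module k M] [Module A M] [Module Aᵐᵒᵖ M]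

/-- The relations `c m d ⊗ y = m ⊗ d y c`. -/
def EnvTensor.relations (r : ℕ) : Set (M ⊗[k] Bar ι r) :=
  {t | ∃ (c d : A) (m : M) (y : Bar ι r),
    t = (c • op d • m) ⊗ₜ[k] y - m ⊗ₜ[k] Bar.lmul ι d r (Bar.rmul ι c r y)}

/-- `M ⊗_{A^e} (A ⊗ Ā^{⊗ r} ⊗ A)` -/
abbrev EnvTensor (r : ℕ) : Type _ :=
  (M ⊗[k] Bar ι r) ⧸ Submodule.span k (EnvTensor.relations ι M r)

namespace EnvTensor
variable {M}

/-- The element `m ⊗_{A^e} y`. -/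
def tmul {r : ℕ} (m : M) (y : Bar ι r) : EnvTensor ι M r := Submodule.Quotient.mk (m ⊗ₜ[k] y)

variable [SMulCommClass A Aᵐᵒᵖ M] [IsScalarTower k A M] [IsScalarTower k Aᵐᵒᵖ M]

/-- The map `u ⊗ v ↦ v m u`. -/
def sandwich (m : M) : InnerSq k A →ₗ[k] M :=
  InnerSq.lift (LinearMap.mk₂ k (fun u v => v • op u • m)
    (fun u u' v => by rw [op_add, add_smul, smul_add])
    (fun c u v => by rw [op_smul, smul_assoc, smul_comm])
    (fun u v v' => by rw [add_smul])
    (fun c u v => by rw [smul_assoc]))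

theorem sandwich_tmul (m : M) (u v : A) : sandwich m (InnerSq.tmul k u v) = v • op u • m := rfl

theorem sandwich_smul (m : M) (c : A) (t : InnerSq k A) :
    sandwich m (c • t) = c • sandwich m t := by
  induction t using InnerSq.induction with
  | h0 => simp
  | h1 u v => rw [InnerSq.smul_tmul, sandwich_tmul, sandwich_tmul, mul_smul]
  | h2 s t hs ht => simp only [smul_add, map_add, hs, ht]

theorem sandwich_op_smul (m : M) (c : A) (t : InnerSq k A) :
    sandwich m (op c • t) = op c • sandwich m t := by
  induction t using InnerSq.induction with
  | h0 => simp
  | h1 u v => rw [InnerSq.op_smul_tmul, sandwich_tmul, sandwich_tmul, op_mul, mul_smul, smul_comm]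
  | h2 s t hs ht => simp only [smul_add, map_add, hs, ht]

theorem map_sandwich_mk {r : ℕ} (m : M) (u : A) (a : Fin r → A) (v : A) :
    Hoch.map ι (sandwich m) (sandwich_smul m) (sandwich_op_smul m) r (Bar.mk ι u a v) =
      Hoch.mk ι (v • op u • m) a := Hoch.map_mk ..

theorem bar_hom_ext {r : ℕ} {N : Type*} [AddCommGroup N] [Module k N] {f g : Bar ι r →ₗ[k] N}
    (h : ∀ u a v, f (Bar.mk ι u a v) = g (Bar.mk ι u a v)) : f = g := by
  refine Hoch.hom_ext ι fun t a => ?_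
  induction t using InnerSq.induction with
  | h0 =>
    have : Hoch.mk ι (0 : InnerSq k A) a = 0 := by
      have := Hoch.mk_smul ι (0 : k) (0 : InnerSq k A) a
      rwa [smul_zero, zero_smul] at this
    rw [this, map_zero, map_zero]
  | h1 u v => exact h u a v
  | h2 s t hs ht => rw [Hoch.mk_add, map_add, map_add, hs, ht]

/-- The map `β` with `β (m ⊗ (u ⊗ a_1 ⊗ ⋯ ⊗ a_r ⊗ v)) = [v m u ⊗ a_1 ⊗ ⋯ ⊗ a_r]`. -/
def beta (r : ℕ) : EnvTensor ι M r →ₗ[k] Hoch ι M r :=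
  Submodule.liftQ _
    (TensorProduct.lift
      { toFun := fun m => Hoch.map ι (sandwich m) (sandwich_smul m) (sandwich_op_smul m) r
        map_add' := fun m m' => bar_hom_ext ι fun u a v => by
          rw [LinearMap.add_apply]
          simp only [map_sandwich_mk, smul_add, Hoch.mk_add]
        map_smul' := fun c m => bar_hom_ext ι fun u a v => by
          rw [LinearMap.smul_apply]
          simp only [map_sandwich_mk, RingHom.id_apply]
          rw [smul_comm (op u) c m, smul_comm v c, Hoch.mk_smul] })
    (by
      rw [Submodule.span_le]
      rintro t ⟨c, d, m, y, rfl⟩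
      rw [SetLike.mem_coe, LinearMap.mem_ker, map_sub, sub_eq_zero, TensorProduct.lift.tmul,
        TensorProduct.lift.tmul]
      refine LinearMap.congr_fun (f := Hoch.map ι (sandwich (c • op d • m)) (sandwich_smul _)
        (sandwich_op_smul _) r) (g := (Hoch.map ι (sandwich m) (sandwich_smul m)
        (sandwich_op_smul m) r).comp ((Bar.lmul ι d r).comp (Bar.rmul ι c r))) ?_ y
      refine bar_hom_ext ι fun u a v => ?_
      rw [LinearMap.comp_apply, LinearMap.comp_apply, Bar.rmul_mk, Bar.lmul_mk, map_sandwich_mk,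
        map_sandwich_mk, op_mul, mul_smul, mul_smul, ← smul_comm c (op u)])

theorem beta_tmul_mk {r : ℕ} (m : M) (u : A) (a : Fin r → A) (v : A) :
    beta ι r (tmul ι m (Bar.mk ι u a v)) = Hoch.mk ι (v • op u • m) a := by
  rw [beta, tmul, Submodule.liftQ_apply, TensorProduct.lift.tmul]
  exact map_sandwich_mk ι m u a v

end EnvTensor
end Envelope

section HomologySection
variable {k} {X : ℕ → Type*} [∀ r, AddCommGroup (X r)] [∀ r, Module k (X r)]

/-- The submodules of cycles of a sequence of maps `⋯ → X 2 → X 1 → X 0` (every element of degree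
`0` is a cycle). -/
def complexCycles (d : ∀ r, X (r + 1) →ₗ[k] X r) : ∀ r, Submodule k (X r)
  | 0 => ⊤
  | r + 1 => LinearMap.ker (d r)

/-- The homology modules, cycles modulo boundaries, of `⋯ → X 2 → X 1 → X 0`. -/
abbrev complexHomology (d : ∀ r, X (r + 1) →ₗ[k] X r) (r : ℕ) : Type _ :=
  complexCycles d r ⧸ (LinearMap.range (d r)).submoduleOf (complexCycles d r)

end HomologySection

section Ore

variable {k} (α : K →ₐ[k] K)

/-- The action of the powers of `x` on the coefficients: `x ^ i` acts by `α ^ i`. -/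
@[reducible]
def oreAction : MulSemiringAction (Multiplicative ℕ) K where
  smul g c := (α ^ g.toAdd) c
  one_smul c := rfl
  mul_smul g h c := by
    change (α ^ (g.toAdd + h.toAdd)) c = (α ^ g.toAdd) ((α ^ h.toAdd) c)
    rw [pow_add]; rfl
  smul_zero g := map_zero (α ^ g.toAdd)
  smul_add g := map_add (α ^ g.toAdd)
  smul_one g := map_one (α ^ g.toAdd)
  smul_mul g := map_mul (α ^ g.toAdd)

/-- The Ore extension `B = K[x, α]`: Mathlib's skew polynomials, `x` acting on `K` by `α`. -/
def OreExtension (_ : K →ₐ[k] K) : Type _ := SkewPolynomial K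

namespace OreExtension

instance : Ring (OreExtension α) :=
  letI := oreAction α
  inferInstanceAs (Ring (SkewPolynomial K))

instance : Module k (OreExtension α) :=
  inferInstanceAs (Module k (SkewMonoidAlgebra K (Multiplicative ℕ)))

/-- The monomial `c x ^ i`. -/
def monomial (i : ℕ) (c : K) : OreExtension α := SkewPolynomial.monomial i c

/-- The coefficient (on the left) of `x ^ i`. -/
def coeff (p : OreExtension α) (i : ℕ) : K := SkewPolynomial.coeff p i

theorem monomial_mul_monomial (i j : ℕ) (c d : K) :
    monomial α i c * monomial α j d = monomial α (i + j) (c * (α ^ i) d) := by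
  let _ := oreAction α
  exact SkewMonoidAlgebra.single_mul_single

theorem monomial_add (i : ℕ) (c d : K) :
    monomial α i (c + d) = monomial α i c + monomial α i d :=
  SkewPolynomial.monomial_add i c d

theorem smul_monomial (t : k) (i : ℕ) (c : K) :
    t • monomial α i c = monomial α i (t • c) :=
  SkewMonoidAlgebra.smul_single ..

theorem induction {P : OreExtension α → Prop} (h0 : P 0) (h1 : ∀ i c, P (monomial α i c))
    (h2 : ∀ p q, P p → P q → P (p + q)) (p : OreExtension α) : P p :=
  SkewMonoidAlgebra.induction_on (p := P) p h0 (fun g a => h1 g.toAdd a) (fun {f g} => h2 f g)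

instance : Algebra k (OreExtension α) :=
  Algebra.ofModule
    (fun c p q => by
      induction p using induction with
      | h0 => simp
      | h1 i u =>
        induction q using induction with
        | h0 => simp
        | h1 j v => simp only [smul_monomial, monomial_mul_monomial, smul_mul_assoc]
        | h2 q q' h h' => simp only [mul_add, smul_add, h, h']
      | h2 p p' h h' => simp only [add_mul, smul_add, h, h'])
    (fun c p q => by
      induction p using induction with
      | h0 => simp
      | h1 i u =>
        induction q using induction with
        | h0 => simp
        | h1 j v => simp only [smul_monomial, monomial_mul_monomial, map_smul, mul_smul_comm]
        | h2 q q' h h' => simp only [mul_add, smul_add, h, h']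
      | h2 p p' h h' => simp only [add_mul, smul_add, h, h'])

/-- The inclusion `K → B`. -/
def C : K →ₐ[k] OreExtension α :=
  AlgHom.ofLinearMap
    { toFun := monomial α 0
      map_add' := monomial_add α 0
      map_smul' := fun t c => (smul_monomial α t 0 c).symm }
    rfl
    (fun c d => by
      change monomial α 0 (c * d) = monomial α 0 c * monomial α 0 d
      rw [monomial_mul_monomial]
      simp)

/-- The variable `x` of `B`. -/
def X : OreExtension α := monomial α 1 1

theorem X_mul_C (c : K) : X α * C α c = C α (α c) * X α := by
  change monomial α 1 1 * monomial α 0 c = monomial α 0 (α c) * monomial α 1 1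
  simp [monomial_mul_monomial]

variable (n : ℕ) (lam : ℕ → K)

/-- The polynomial `f = ∑ i ∈ {0, …, n}, λ_i x ^ (n - i)`. -/
def f : OreExtension α := ∑ i ∈ Finset.range (n + 1), C α (lam i) * X α ^ (n - i)

open Classical in
/-- The quotient `P̄` in the division `P = P̄ f + R` with `R = 0` or `deg R < n` (for monic `f`
such a division exists and is unique). -/
def quot (P : OreExtension α) : OreExtension α :=
  if h : ∃ Q R : OreExtension α, P = Q * f α n lam + R ∧ ∀ i, n ≤ i → coeff α R i = 0
  then h.choose else 0

end OreExtension

variable (n : ℕ) (lam : ℕ → K)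

/-- The monogenic extension `A = K[x, α] / ⟨f⟩`, `⟨f⟩` the two-sided ideal generated by `f`. -/
def MonogenicExt : Type _ := (TwoSidedIdeal.span {OreExtension.f α n lam}).ringCon.Quotient

namespace MonogenicExt

instance : Ring (MonogenicExt α n lam) :=
  inferInstanceAs (Ring (TwoSidedIdeal.span {OreExtension.f α n lam}).ringCon.Quotient)

instance : Algebra k (MonogenicExt α n lam) :=
  inferInstanceAs (Algebra k (TwoSidedIdeal.span {OreExtension.f α n lam}).ringCon.Quotient)

/-- The canonical projection `B → A`. -/
def proj : OreExtension α →ₐ[k] MonogenicExt α n lam :=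
  RingCon.mkₐ (α := k) (TwoSidedIdeal.span {OreExtension.f α n lam}).ringCon

/-- The structure map `K → A`. -/
def incl : K →ₐ[k] MonogenicExt α n lam := (proj α n lam).comp (OreExtension.C α)

/-- The class of `x` in `A`. -/
def x : MonogenicExt α n lam := proj α n lam (OreExtension.X α)

/-- The class in `A` of the quotient of the division of `x ^ i` by `f`. -/
def xbar (i : ℕ) : MonogenicExt α n lam :=
  proj α n lam (OreExtension.quot α n lam (OreExtension.X α ^ i))

end MonogenicExt
end Ore

section Small

variable {k} (α : K →ₐ[k] K) (n : ℕ) (lam : ℕ → K)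
variable (M : Type*) [AddCommGroup M] [Module k M] [Module (MonogenicExt α n lam) M]
  [Module (MonogenicExt α n lam)ᵐᵒᵖ M]

/-- The `k`-submodule `[M, K]_{α^j}`, generated by the `m α^j(c) - c m`. -/
def twistedCommutators (j : ℕ) : Submodule k M :=
  Submodule.span k {t | ∃ (m : M) (c : K),
    t = op (MonogenicExt.incl α n lam ((α ^ j) c)) • m - MonogenicExt.incl α n lam c • m}

/-- The exponent of the twist in degree `r`: it is `m n` for `r = 2 m` and `m n + 1` for
`r = 2 m + 1`. -/
def twist (n r : ℕ) : ℕ := r / 2 * n + r % 2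

/-- The module `M / [M, K]_{α^{twist r}}` of degree `r` of the small complex `C^S(A, M)`. -/
abbrev CS (r : ℕ) : Type _ := M ⧸ twistedCommutators α n lam M (twist n r)

/-- The class `[m]` of `m` in degree `r` of the small complex. -/
def CS.mk {M : Type*} [AddCommGroup M] [Module k M] [Module (MonogenicExt α n lam) M]
    [Module (MonogenicExt α n lam)ᵐᵒᵖ M] (r : ℕ) (m : M) : CS α n lam M r :=
  Submodule.Quotient.mk m

/-- The module `A_{α^j} ⊗_K A`, `j = twist r`: the quotient of `A ⊗_k A` by the elements
`u α^j(c) ⊗ v - u ⊗ c v`. -/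
abbrev ASq (r : ℕ) : Type _ := CS α n lam (InnerSq k (MonogenicExt α n lam)) r

/-- The element `u ⊗ v` of `A_{α^j} ⊗_K A`. -/
def ASq.mk (r : ℕ) (u v : MonogenicExt α n lam) : ASq α n lam r :=
  CS.mk α n lam r (InnerSq.tmul k u v)

namespace MonogenicExt

/-- The set `𝕀_m` of the `(i_1, …, i_m)` with `1 ≤ i_j ≤ n`. -/
def indexI (n m : ℕ) : Finset (Fin m → ℕ) := Fintype.piFinset fun _ => Finset.Icc 1 n

/-- The set `𝕁_i` of the `(ℓ_1, …, ℓ_m)` with `1 ≤ ℓ_j < i_j`. -/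
def indexJ {m : ℕ} (i : Fin m → ℕ) : Finset (Fin m → ℕ) :=
  Fintype.piFinset fun j => Finset.Ico 1 (i j)

/-- The product `λ_{n - i_1} ⋯ λ_{n - i_m}` in `A`. -/
def lamProd {m : ℕ} (i : Fin m → ℕ) : MonogenicExt α n lam :=
  (List.ofFn fun j => incl α n lam (lam (n - i j))).prod

/-- The exponent `|i - ℓ| - m`, where `|i - ℓ|` is the sum of the `i_j - ℓ_j`. -/
def expo {m : ℕ} (i l : Fin m → ℕ) : ℕ := (∑ j, (i j - l j)) - m

/-- The letters of the word `x ⊗ x^{ℓ_m} ⊗ x ⊗ x^{ℓ_{m-1}} ⊗ ⋯ ⊗ x ⊗ x^{ℓ_1} ⊗ x`, numbered from `0`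
(the first `2 m` letters form the word written with a tilde). -/
def tildeWord {m : ℕ} (l : Fin m → ℕ) (p : ℕ) : MonogenicExt α n lam :=
  if p % 2 = 0 then x α n lam
  else if h : p / 2 < m then x α n lam ^ l (Fin.rev ⟨p / 2, h⟩) else 1

/-- The product of the quotients of `x^{i_1+i_2}`, …, `x^{i_{2m-1}+i_{2m}}` by `f`, in `A`
(`i_{p+1}` is written `i p`). -/
def xbarProd (m : ℕ) (i : ℕ → ℕ) : MonogenicExt α n lam :=
  ((List.range m).map fun j => xbar α n lam (i (2 * j) + i (2 * j + 1))).prod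

end MonogenicExt

open MonogenicExt

variable {M}

/-- The formulas for the boundaries of the small complex; `d r` is the boundary `d_{r+1}`. -/
def IsSmallBoundary (d : ∀ r, CS α n lam M (r + 1) →ₗ[k] CS α n lam M r) : Prop :=
  (∀ (m : ℕ) (y : M), d (2 * m) (CS.mk α n lam (2 * m + 1) y) =
    CS.mk α n lam (2 * m) (op (x α n lam) • y - x α n lam • y)) ∧
  (∀ (m : ℕ) (y : M), d (2 * m + 1) (CS.mk α n lam (2 * m + 2) y) =
    ∑ i ∈ Finset.Icc 1 n, ∑ l ∈ Finset.range i, CS.mk α n lam (2 * m + 1)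
      ((incl α n lam (lam (n - i)) * x α n lam ^ (i - l - 1)) • op (x α n lam ^ l) • y))

/-- The formulas for `φ`. -/
def IsPhi (φ : ∀ r, CS α n lam M r →ₗ[k] Hoch (incl α n lam) M r) : Prop :=
  (∀ (m : ℕ) (y : M), φ (2 * m) (CS.mk α n lam (2 * m) y) =
    ∑ i ∈ indexI n m, ∑ l ∈ indexJ i, Hoch.mk (incl α n lam)
      (lamProd α n lam i • op (x α n lam ^ expo i l) • y)
      (fun p : Fin (2 * m) => tildeWord α n lam l p)) ∧
  (∀ (m : ℕ) (y : M), φ (2 * m + 1) (CS.mk α n lam (2 * m + 1) y) =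
    ∑ i ∈ indexI n m, ∑ l ∈ indexJ i, Hoch.mk (incl α n lam)
      (lamProd α n lam i • op (x α n lam ^ expo i l) • y)
      (fun p : Fin (2 * m + 1) => tildeWord α n lam l p))

/-- The formulas for `ψ`, on the generators `[y ⊗ x^{i_1} ⊗ ⋯ ⊗ x^{i_r}]` with `1 ≤ i_p < n`
(`i_{p+1}` is written `i p`). -/
def IsPsi (ψ : ∀ r, Hoch (incl α n lam) M r →ₗ[k] CS α n lam M r) : Prop :=
  (∀ (m : ℕ) (y : M) (i : ℕ → ℕ), (∀ p < 2 * m, 1 ≤ i p ∧ i p < n) →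
    ψ (2 * m) (Hoch.mk (incl α n lam) y (fun p : Fin (2 * m) => x α n lam ^ i p)) =
      CS.mk α n lam (2 * m) (op (xbarProd α n lam m i) • y)) ∧
  (∀ (m : ℕ) (y : M) (i : ℕ → ℕ), (∀ p < 2 * m + 1, 1 ≤ i p ∧ i p < n) →
    ψ (2 * m + 1) (Hoch.mk (incl α n lam) y (fun p : Fin (2 * m + 1) => x α n lam ^ i p)) =
      ∑ l ∈ Finset.range (i (2 * m)), CS.mk α n lam (2 * m + 1)
        (x α n lam ^ (i (2 * m) - l - 1) • op (xbarProd α n lam m i * x α n lam ^ l) • y))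

/-- The formulas for the comparison map `φ'` from the small resolution to the canonical one. -/
def IsPhi' (φ' : ∀ r, ASq α n lam r →ₗ[k] Bar (incl α n lam) r) : Prop :=
  (∀ (m : ℕ) (u v : MonogenicExt α n lam), φ' (2 * m) (ASq.mk α n lam (2 * m) u v) =
    ∑ i ∈ indexI n m, ∑ l ∈ indexJ i, Bar.mk (incl α n lam)
      (u * lamProd α n lam i * x α n lam ^ expo i l)
      (fun p : Fin (2 * m) => tildeWord α n lam l p) v) ∧
  (∀ (m : ℕ) (u v : MonogenicExt α n lam), φ' (2 * m + 1) (ASq.mk α n lam (2 * m + 1) u v) =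
    ∑ i ∈ indexI n m, ∑ l ∈ indexJ i, Bar.mk (incl α n lam)
      (u * lamProd α n lam i * x α n lam ^ expo i l)
      (fun p : Fin (2 * m + 1) => tildeWord α n lam l p) v)

/-- The formulas for the comparison map `ψ'` from the canonical resolution to the small one. -/
def IsPsi' (ψ' : ∀ r, Bar (incl α n lam) r →ₗ[k] ASq α n lam r) : Prop :=
  (∀ (m : ℕ) (u v : MonogenicExt α n lam) (i : ℕ → ℕ), (∀ p < 2 * m, 1 ≤ i p ∧ i p < n) →
    ψ' (2 * m) (Bar.mk (incl α n lam) u (fun p : Fin (2 * m) => x α n lam ^ i p) v) =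
      ASq.mk α n lam (2 * m) (u * xbarProd α n lam m i) v) ∧
  (∀ (m : ℕ) (u v : MonogenicExt α n lam) (i : ℕ → ℕ), (∀ p < 2 * m + 1, 1 ≤ i p ∧ i p < n) →
    ψ' (2 * m + 1) (Bar.mk (incl α n lam) u (fun p : Fin (2 * m + 1) => x α n lam ^ i p) v) =
      ∑ l ∈ Finset.range (i (2 * m)), ASq.mk α n lam (2 * m + 1)
        (u * xbarProd α n lam m i * x α n lam ^ l) (x α n lam ^ (i (2 * m) - l - 1) * v))

/-- The recursion for the homotopy `ω'` on the canonical resolution; `ω' r` is the map `ω'_{r+1}`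
from degree `r` to degree `r + 1`. All the `ω'_{r+1}` are `A`-bimodule maps, `ω'_1 = 0`, and
`ω'_{s+1}(y) = (-1)^{s+1} (φ'_s ψ'_s - id - ω'_s b'_s)(y) ⊗ 1` for `s ≥ 1` and `y` of the form
`u ⊗ a_1 ⊗ ⋯ ⊗ a_s ⊗ 1`. -/
def IsOmega' (φ' : ∀ r, ASq α n lam r →ₗ[k] Bar (incl α n lam) r)
    (ψ' : ∀ r, Bar (incl α n lam) r →ₗ[k] ASq α n lam r)
    (ω' : ∀ r, Bar (incl α n lam) r →ₗ[k] Bar (incl α n lam) (r + 1)) : Prop :=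
  (∀ r c y, ω' r (Bar.lmul (incl α n lam) c r y) = Bar.lmul (incl α n lam) c (r + 1) (ω' r y)) ∧
  (∀ r c y, ω' r (Bar.rmul (incl α n lam) c r y) = Bar.rmul (incl α n lam) c (r + 1) (ω' r y)) ∧
  ω' 0 = 0 ∧
  ∀ (r : ℕ) (u : MonogenicExt α n lam) (a : Fin (r + 1) → MonogenicExt α n lam)
    (y : Bar (incl α n lam) (r + 1)), y = Bar.mk (incl α n lam) u a 1 →
    ω' (r + 1) y = (-1 : k) ^ (r + 2) • Bar.appendOne (incl α n lam) (r + 1)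
      (φ' (r + 1) (ψ' (r + 1) y) - y - ω' r (Bar.b' (incl α n lam) r y))

variable (M)

/-- The homology `H^K_r(A, M)` of `A` relative to `K` with coefficients in `M`: the homology of the
normalized complex `(M ⊗ Ā^{⊗ *} ⊗, b)`. -/
abbrev RelHochschildHomology [SMulCommClass (MonogenicExt α n lam) (MonogenicExt α n lam)ᵐᵒᵖ M]
    [IsScalarTower k (MonogenicExt α n lam) M] [IsScalarTower k (MonogenicExt α n lam)ᵐᵒᵖ M]
    (r : ℕ) : Type _ :=
  complexHomology (fun r => Hoch.b (incl α n lam) M r) r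

end Small

end

/-!
The small complex and the normalized relative Hochschild complex come from two resolutions of `A` by
`A`-bimodules: `CS.d_pair` and `Hoch.b_pair` say that they are obtained by applying `M ⊗_{A^e} -` to
the small resolution, with terms `A_{α^j} ⊗ A`, and to the canonical one, with terms `A ⊗ Ā^{⊗ r} ⊗ A`. All
that has to be done is therefore to compare these two resolutions by maps of bimodules.

As `f` is normal and monic, division by `f` makes `A` a free left `K`-module on `1, x, …, x^{n-1}`
(`sum_coord`, `coord_x_pow_of_lt`). Hence the small resolution has, like the canonical one, a
contraction that is left `A`-linear and right `K`-linear: on the canonical one `y ↦ ± y ⊗ 1` (`Bar.b'_appendOne`), on the small one the map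
`ASq.contr`, which in even degrees sends `1 ⊗ x^i` to the value `∑ x^l ⊗ x^{i-1-l}` of the universal
derivation, and in odd degrees reads off the coordinate of `x^{n-1}` (`ASq.d_contr`).

A contraction determines a comparison map degree by degree from its values on bimodule generators. The
generators are `1 ⊗ 1` for the small resolution and the `y ⊗ 1` for the canonical one; this gives `φ'`
and `ψ'` (`b'_phi'`, `d_psi'`). For `ψ'` to be defined on the normalized words, `ASq.contr` has to
vanish on the `ψ'(u ⊗ ⋯ ⊗ 1)`, which holds since it squares to zero (`ASq.contr_contr`). As it also
carries the boundary of `1 ⊗ 1` to `± 1 ⊗ 1` (`ASq.contr_bdOne`), `ψ' φ' = id` holds on the nose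
(`psi'_phi'`). The homotopy `ω'` from `φ' ψ'` to the identity is built in the same way with the
contraction of the canonical resolution, because `φ' ψ' - id - ω' b'` has values in cycles
(`phi'_psi'_sub`).

The closed formulas unwind the recursions. For `φ'`, two steps of the recursion put a letter `x` and a
letter `x^ℓ` at the end of the word and a factor `λ_{n-i} x^{i-ℓ-1}` in front (`phiOne_even_odd`). For
`ψ'`, two steps replace two letters `x^i`, `x^j` by the quotient of `x^{i+j}` by `f`, since that
quotient is `∑ x^l c_l`, where `c_l` is the leading coefficient of the remainder of `x^{i-l-1+j}`
(`sum_pow_mul_coord`, `psi'_even`).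
-/

noncomputable section

/-! ### Division by a normal monic skew polynomial -/

/-- The hypotheses on the coefficients of `f = ∑ λ_i x ^ (n - i)`, with `n ≥ 2`. They make `f` monic
of degree `n` and normal: `x f = f x`, and `f c = α^n(c) f` for `c` in `K`. -/
structure IsNormalMonic {k K : Type*} [CommRing k] [Ring K] [Algebra k K] (α : K →ₐ[k] K) (n : ℕ)
    (lam : ℕ → K) : Prop where
  two_le : 2 ≤ n
  lam_zero : lam 0 = 1
  map_lam' : ∀ i, 1 ≤ i → i ≤ n → α (lam i) = lam i
  lam_mul' : ∀ i, 1 ≤ i → i ≤ n → ∀ c : K, lam i * c = (α ^ i) c * lam i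

variable {k K : Type*} [CommRing k] [Ring K] [Algebra k K] {α : K →ₐ[k] K} {n : ℕ} {lam : ℕ → K}

namespace IsNormalMonic

theorem map_lam (H : IsNormalMonic α n lam) {i : ℕ} (hi : i ≤ n) : α (lam i) = lam i := by
  rcases Nat.eq_zero_or_pos i with rfl | h
  · rw [H.lam_zero, map_one]
  · exact H.map_lam' i h hi

theorem pow_map_lam (H : IsNormalMonic α n lam) {i : ℕ} (hi : i ≤ n) (j : ℕ) :
    (α ^ j) (lam i) = lam i := by
  induction j with
  | zero => rfl
  | succ j ih => rw [pow_succ, AlgHom.mul_apply, H.map_lam hi, ih]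

theorem lam_mul (H : IsNormalMonic α n lam) {i : ℕ} (hi : i ≤ n) (c : K) :
    lam i * c = (α ^ i) c * lam i := by
  rcases Nat.eq_zero_or_pos i with rfl | h
  · rw [H.lam_zero, one_mul, mul_one]; rfl
  · exact H.lam_mul' i h hi c

end IsNormalMonic

namespace OreExtension

variable (α)

/-- The linear map out of `K[x, α]` with given values on the monomials. -/
def lift {N : Type*} [AddCommGroup N] [Module k N] (g : ℕ → K →ₗ[k] N) :
    OreExtension α →ₗ[k] N :=
  (Finsupp.lsum k fun i : Multiplicative ℕ => g i.toAdd) ∘ₗ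
    (SkewMonoidAlgebra.coeffLinearEquiv (S := k) (k := K) (G := Multiplicative ℕ)).toLinearMap

theorem lift_monomial {N : Type*} [AddCommGroup N] [Module k N] (g : ℕ → K →ₗ[k] N) (i : ℕ)
    (c : K) : lift α g (monomial α i c) = g i c := by
  change Finsupp.lsum k (fun i : Multiplicative ℕ => g i.toAdd)
    (Finsupp.single (Multiplicative.ofAdd i) c) = _
  simp

theorem X_pow (i : ℕ) : X α ^ i = monomial α i 1 := by
  induction i with
  | zero => rfl
  | succ i ih => rw [pow_succ, ih, X, monomial_mul_monomial, map_one, mul_one]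

theorem C_mul_monomial (c d : K) (i : ℕ) : C α c * monomial α i d = monomial α i (c * d) := by
  change monomial α 0 c * monomial α i d = _
  rw [monomial_mul_monomial, zero_add]; rfl

theorem X_mul_monomial (c : K) (i : ℕ) : X α * monomial α i c = monomial α (i + 1) (α c) := by
  rw [X, monomial_mul_monomial, one_mul, pow_one, add_comm]

theorem C_mul_X_pow (c : K) (i : ℕ) : C α c * X α ^ i = monomial α i c := by
  rw [X_pow, C_mul_monomial, mul_one]

theorem coeff_add (p q : OreExtension α) (i : ℕ) :
    coeff α (p + q) i = coeff α p i + coeff α q i :=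
  DFunLike.congr_fun (SkewMonoidAlgebra.coeff_add p q) (Multiplicative.ofAdd i)

theorem coeff_sub (p q : OreExtension α) (i : ℕ) :
    coeff α (p - q) i = coeff α p i - coeff α q i :=
  eq_sub_of_add_eq (by rw [← coeff_add, sub_add_cancel])

theorem coeff_zero (i : ℕ) : coeff α 0 i = 0 := rfl

theorem coeff_monomial (i j : ℕ) (c : K) : coeff α (monomial α i c) j = if i = j then c else 0 :=
  SkewPolynomial.coeff_monomial

theorem coeff_sum {ι : Type*} (s : Finset ι) (p : ι → OreExtension α) (i : ℕ) :
    coeff α (∑ j ∈ s, p j) i = ∑ j ∈ s, coeff α (p j) i :=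
  map_sum (⟨⟨fun p => coeff α p i, coeff_zero α i⟩, fun p q => coeff_add α p q i⟩ :
    OreExtension α →+ K) p s

theorem eq_zero_of_coeff {p : OreExtension α} (h : ∀ i, coeff α p i = 0) : p = 0 :=
  SkewMonoidAlgebra.ext fun i => h i.toAdd

theorem exists_coeff_eq_zero (p : OreExtension α) : ∃ D, ∀ i, D ≤ i → coeff α p i = 0 := by
  induction p using induction with
  | h0 => exact ⟨0, fun i _ => rfl⟩
  | h1 j c => exact ⟨j + 1, fun i hi => by rw [coeff_monomial, if_neg (by omega)]⟩
  | h2 p q hp hq =>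
    obtain ⟨D, hD⟩ := hp
    obtain ⟨E, hE⟩ := hq
    exact ⟨max D E, fun i hi => by
      rw [coeff_add, hD i (by omega), hE i (by omega), add_zero]⟩

theorem coeff_mul_monomial (p : OreExtension α) (j m : ℕ) (c : K) :
    coeff α (p * monomial α j c) (m + j) = coeff α p m * (α ^ m) c := by
  induction p using induction with
  | h0 => simp [coeff_zero]
  | h1 i u =>
    rw [monomial_mul_monomial, coeff_monomial, coeff_monomial]
    by_cases h : i = m
    · subst h; simp
    · rw [if_neg (by omega), if_neg h, zero_mul]
  | h2 p q hp hq => rw [add_mul, coeff_add, coeff_add, add_mul, hp, hq]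

variable (n lam)

theorem f_eq_sum : f α n lam = ∑ i ∈ Finset.range (n + 1), monomial α i (lam (n - i)) := by
  rw [f, ← Finset.sum_range_reflect]
  refine Finset.sum_congr rfl fun i hi => ?_
  have := Finset.mem_range.1 hi
  rw [C_mul_X_pow, show n + 1 - 1 - i = n - i by omega, show n - (n - i) = i by omega]

variable {α n lam}

theorem f_eq (H : IsNormalMonic α n lam) : f α n lam =
    (∑ i ∈ Finset.range n, monomial α i (lam (n - i))) + monomial α n 1 := by
  rw [f_eq_sum, Finset.sum_range_succ, Nat.sub_self, H.lam_zero]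

theorem X_mul_f (H : IsNormalMonic α n lam) : X α * f α n lam = f α n lam * X α := by
  rw [f_eq_sum, Finset.mul_sum, Finset.sum_mul]
  refine Finset.sum_congr rfl fun i _ => ?_
  rw [X_mul_monomial, H.map_lam (Nat.sub_le n i), X, monomial_mul_monomial, map_one, mul_one]

theorem f_mul_C (H : IsNormalMonic α n lam) (c : K) :
    f α n lam * C α c = C α ((α ^ n) c) * f α n lam := by
  rw [f_eq_sum, Finset.mul_sum, Finset.sum_mul]
  refine Finset.sum_congr rfl fun i hi => ?_
  have := Finset.mem_range.1 hi
  change monomial α i _ * monomial α 0 c = _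
  rw [C_mul_monomial, monomial_mul_monomial, H.lam_mul (Nat.sub_le n i), ← AlgHom.mul_apply,
    ← pow_add, Nat.sub_add_cancel (by omega), add_zero]

theorem f_mul_monomial (H : IsNormalMonic α n lam) (j : ℕ) (c : K) :
    f α n lam * monomial α j c = monomial α j ((α ^ n) c) * f α n lam := by
  have hX : ∀ j, f α n lam * X α ^ j = X α ^ j * f α n lam := fun j =>
    ((show Commute (X α) (f α n lam) from X_mul_f H).pow_left j).symm
  rw [← C_mul_X_pow, ← mul_assoc, f_mul_C H, mul_assoc, hX, ← mul_assoc, C_mul_X_pow]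

theorem eq_zero_of_mul_f (H : IsNormalMonic α n lam) {p : OreExtension α}
    (hp : ∀ i, n ≤ i → coeff α (p * f α n lam) i = 0) : p = 0 := by
  obtain ⟨D, hD⟩ := exists_coeff_eq_zero α p
  induction D with
  | zero => exact eq_zero_of_coeff α fun i => hD i (Nat.zero_le i)
  | succ D ih =>
    refine ih fun i hi => ?_
    rcases hi.lt_or_eq with h | rfl
    · exact hD i h
    -- the top coefficient of `p` is that of `p f`, as `f` is monic
    have h := hp (D + n) (Nat.le_add_left n D)
    rw [f_eq H, mul_add, coeff_add, coeff_mul_monomial, map_one, mul_one, Finset.mul_sum,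
      coeff_sum, Finset.sum_eq_zero, zero_add] at h
    · exact h
    · intro j hj
      have := Finset.mem_range.1 hj
      obtain ⟨m, hm⟩ : ∃ m, D + n = m + j := ⟨D + n - j, by omega⟩
      rw [hm, coeff_mul_monomial, hD m (by omega), zero_mul]

theorem quot_eq (H : IsNormalMonic α n lam) {P Q R : OreExtension α} (h : P = Q * f α n lam + R)
    (hR : ∀ i, n ≤ i → coeff α R i = 0) : quot α n lam P = Q := by
  have hex : ∃ Q R : OreExtension α, P = Q * f α n lam + R ∧ ∀ i, n ≤ i → coeff α R i = 0 :=
    ⟨Q, R, h, hR⟩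
  rw [quot, dif_pos hex]
  obtain ⟨R', h', hR'⟩ := hex.choose_spec
  refine sub_eq_zero.1 (eq_zero_of_mul_f H fun i hi => ?_)
  have : (hex.choose - Q) * f α n lam = R - R' := by
    rw [sub_mul, sub_eq_sub_iff_add_eq_add, ← h', add_comm R, ← h]
  rw [this, coeff_sub, hR i hi, hR' i hi, sub_zero]

variable (n lam)

/-- The coefficient of `x ^ i` in the remainder of the division of `x ^ N` by `f`, for `i < n` (the
values for `i ≥ n` have no meaning). -/
def powRem : ℕ → ℕ → K
  | 0, i => if i = 0 then 1 else 0
  | N + 1, i => (if i = 0 then 0 else powRem N (i - 1)) - powRem N (n - 1) * lam (n - i)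

/-- The quotient of the division of `x ^ N` by `f`. -/
def powQuot (α : K →ₐ[k] K) : ℕ → OreExtension α
  | 0 => 0
  | N + 1 => X α * powQuot α N + C α (powRem n lam N (n - 1))

variable {n lam}

theorem map_powRem (H : IsNormalMonic α n lam) (N i : ℕ) :
    α (powRem n lam N i) = powRem n lam N i := by
  induction N generalizing i with
  | zero => rw [powRem]; split_ifs <;> simp
  | succ N ih =>
    rw [powRem, map_sub, map_mul, ih, H.map_lam (Nat.sub_le n i)]
    split_ifs <;> simp [ih]

theorem powRem_of_lt {N i : ℕ} (hN : N < n) (hi : i < n) :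
    powRem n lam N i = if i = N then 1 else 0 := by
  induction N generalizing i with
  | zero => rw [powRem]
  | succ N ih =>
    rw [powRem, ih (by omega) (by omega : n - 1 < n), if_neg (by omega : n - 1 ≠ N), zero_mul,
      sub_zero]
    by_cases h : i = 0
    · rw [if_pos h, if_neg (by omega)]
    · rw [if_neg h, ih (by omega) (by omega)]
      congr 1
      apply propext
      omega

theorem X_pow_eq (H : IsNormalMonic α n lam) (N : ℕ) : X α ^ N =
    powQuot n lam α N * f α n lam + ∑ i ∈ Finset.range n, monomial α i (powRem n lam N i) := by
  have hn := H.two_le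
  have mz : ∀ i, monomial α i 0 = 0 := fun i => by
    have := smul_monomial α (0 : k) i 0
    rwa [zero_smul, zero_smul, eq_comm] at this
  induction N with
  | zero =>
    rw [powQuot, zero_mul, zero_add, Finset.sum_eq_single 0]
    · rfl
    · intro i _ hi
      rw [powRem, if_neg hi, mz]
    · intro h; simp at h; omega
  | succ N ih =>
    have hstep : X α * ∑ i ∈ Finset.range n, monomial α i (powRem n lam N i) =
        C α (powRem n lam N (n - 1)) * f α n lam +
          ∑ i ∈ Finset.range n, monomial α i (powRem n lam (N + 1) i) := by
      rw [f_eq H, Finset.mul_sum, mul_add, C_mul_monomial, mul_one, Finset.mul_sum,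
        add_right_comm, ← Finset.sum_add_distrib]
      simp only [X_mul_monomial, map_powRem H, C_mul_monomial, ← monomial_add]
      obtain ⟨m, rfl⟩ : ∃ m, n = m + 1 := ⟨n - 1, by omega⟩
      rw [Finset.sum_range_succ, Finset.sum_range_succ' (fun i => monomial α i _)]
      simp [powRem, mz]
    rw [pow_succ', ih, mul_add, hstep, powQuot, add_mul, mul_assoc, add_assoc]

theorem quot_X_pow (H : IsNormalMonic α n lam) (N : ℕ) :
    quot α n lam (X α ^ N) = powQuot n lam α N := by
  refine quot_eq H (X_pow_eq H N) fun i hi => ?_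
  rw [coeff_sum, Finset.sum_eq_zero]
  intro j hj
  have := Finset.mem_range.1 hj
  rw [coeff_monomial, if_neg (by omega)]

variable (α n lam) in
/-- The coefficient of `x ^ i` in the remainder of the division by `f`, for `i < n` (and `0` for
`i ≥ n`). -/
def rem (i : ℕ) : OreExtension α →ₗ[k] K :=
  if i < n then lift α fun N => LinearMap.mulRight k (powRem n lam N i) else 0

theorem rem_of_le {i : ℕ} (hi : n ≤ i) : rem α n lam i = 0 := if_neg (by omega)

theorem rem_monomial {i : ℕ} (hi : i < n) (N : ℕ) (c : K) :
    rem α n lam i (monomial α N c) = c * powRem n lam N i := by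
  rw [rem, if_pos hi, lift_monomial, LinearMap.mulRight_apply]

theorem rem_C_mul (i : ℕ) (c : K) (p : OreExtension α) :
    rem α n lam i (C α c * p) = c * rem α n lam i p := by
  rcases Nat.lt_or_ge i n with hi | hi
  · induction p using induction with
    | h0 => simp
    | h1 j u => rw [C_mul_monomial, rem_monomial hi, rem_monomial hi, mul_assoc]
    | h2 p q hp hq => rw [mul_add, map_add, map_add, mul_add, hp, hq]
  · simp [rem_of_le hi]

theorem rem_X_mul (H : IsNormalMonic α n lam) {i : ℕ} (hi : i < n) (p : OreExtension α) :
    rem α n lam i (X α * p) = (if i = 0 then 0 else α (rem α n lam (i - 1) p)) -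
      α (rem α n lam (n - 1) p) * lam (n - i) := by
  induction p using induction with
  | h0 => simp
  | h1 j u =>
    rw [X_mul_monomial, rem_monomial hi, rem_monomial (by omega), rem_monomial (by omega),
      map_mul, map_mul, map_powRem H, map_powRem H, powRem, mul_sub, mul_assoc]
    split_ifs <;> simp
  | h2 p q hp hq =>
    rw [mul_add, map_add, hp, hq, map_add, map_add, map_add, map_add, add_mul]
    split_ifs <;> abel

theorem rem_mul_eq_zero (H : IsNormalMonic α n lam) {q : OreExtension α}
    (hq : ∀ i, rem α n lam i q = 0) (p : OreExtension α) (i : ℕ) : rem α n lam i (p * q) = 0 := by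
  have hX : ∀ N i, rem α n lam i (X α ^ N * q) = 0 := fun N => by
    induction N with
    | zero => simpa using hq
    | succ N ih =>
      intro i
      rcases Nat.lt_or_ge i n with hi | hi
      · rw [pow_succ', mul_assoc, rem_X_mul H hi, ih, ih]; simp
      · simp [rem_of_le hi]
  induction p using induction with
  | h0 => simp
  | h1 N c => rw [← C_mul_X_pow, mul_assoc, rem_C_mul, hX, mul_zero]
  | h2 p p' h h' => rw [add_mul, map_add, h, h', add_zero]

theorem rem_f (H : IsNormalMonic α n lam) (i : ℕ) : rem α n lam i (f α n lam) = 0 := by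
  have hn := H.two_le
  rcases Nat.lt_or_ge i n with hi | hi
  · rw [f_eq H, map_add, map_sum, rem_monomial hi, one_mul, Finset.sum_eq_single i]
    · obtain ⟨m, rfl⟩ : ∃ m, n = m + 1 := ⟨n - 1, by omega⟩
      rw [rem_monomial hi, powRem_of_lt hi hi, powRem, powRem_of_lt (by omega) (by omega),
        powRem_of_lt (by omega) (by omega)]
      rw [if_neg (by omega : i - 1 ≠ m)]
      simp
    · intro j hj hji
      rw [rem_monomial hi, powRem_of_lt (Finset.mem_range.1 hj) hi, if_neg (Ne.symm hji), mul_zero]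
    · intro h; exact absurd (Finset.mem_range.2 hi) h
  · simp [rem_of_le hi]

/-- As `f` is normal, the remainder vanishes on the two-sided ideal generated by `f`, not only on
the left ideal. -/
theorem rem_eq_zero_of_mem (H : IsNormalMonic α n lam) {p : OreExtension α}
    (hp : p ∈ TwoSidedIdeal.span {f α n lam}) (i : ℕ) : rem α n lam i p = 0 := by
  let J : TwoSidedIdeal (OreExtension α) := TwoSidedIdeal.mk'
    {p | ∀ q i, rem α n lam i (p * q) = 0} (by simp)
    (fun {p p'} h h' q i => by rw [add_mul, map_add, h, h', add_zero])
    (fun {p} h q i => by rw [neg_mul, map_neg, h, neg_zero])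
    (fun {p p'} h q i => by rw [mul_assoc]; exact rem_mul_eq_zero H (h q) p i)
    (fun {p p'} h q i => by rw [mul_assoc]; exact h _ i)
  have hJ : ∀ p, p ∈ J ↔ ∀ q i, rem α n lam i (p * q) = 0 := fun p => TwoSidedIdeal.mem_mk' ..
  have hle : TwoSidedIdeal.span {f α n lam} ≤ J := by
    rw [TwoSidedIdeal.span_le, Set.singleton_subset_iff, SetLike.mem_coe, hJ]
    intro q i
    induction q using induction with
    | h0 => simp
    | h1 j c => rw [f_mul_monomial H]; exact rem_mul_eq_zero H (rem_f H) _ i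
    | h2 q q' h h' => rw [mul_add, map_add, h, h', add_zero]
  have := (hJ p).1 (hle hp) 1 i
  rwa [mul_one] at this

end OreExtension

/-! ### The monogenic extension as a free module over `K` -/

namespace MonogenicExt

open OreExtension

theorem proj_surjective : Function.Surjective (proj α n lam) := Quotient.mk''_surjective

theorem proj_eq_zero {p : OreExtension α} :
    proj α n lam p = 0 ↔ p ∈ TwoSidedIdeal.span {f α n lam} := by
  rw [TwoSidedIdeal.mem_iff, ← RingCon.eq]
  rfl

theorem x_mul_incl (c : K) : x α n lam * incl α n lam c = incl α n lam (α c) * x α n lam := by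
  change proj α n lam (X α) * proj α n lam (C α c) = proj α n lam (C α (α c)) * proj α n lam (X α)
  rw [← map_mul, X_mul_C, map_mul]

theorem x_pow_mul_incl (i : ℕ) (c : K) :
    x α n lam ^ i * incl α n lam c = incl α n lam ((α ^ i) c) * x α n lam ^ i := by
  induction i generalizing c with
  | zero => rw [pow_zero, one_mul, mul_one]; rfl
  | succ i ih =>
    rw [pow_succ, mul_assoc, x_mul_incl, ← mul_assoc, ih, mul_assoc, pow_succ α]
    rfl

theorem incl_lam_mul_incl (H : IsNormalMonic α n lam) {i : ℕ} (hi : i ≤ n) (c : K) :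
    incl α n lam (lam i) * incl α n lam c =
      incl α n lam ((α ^ i) c) * incl α n lam (lam i) := by
  rw [← map_mul, H.lam_mul hi, map_mul]

theorem x_commute_lam (H : IsNormalMonic α n lam) {i : ℕ} (hi : i ≤ n) :
    Commute (x α n lam) (incl α n lam (lam i)) := by
  rw [commute_iff_eq, x_mul_incl, H.map_lam hi]

theorem proj_monomial (i : ℕ) (c : K) :
    proj α n lam (monomial α i c) = incl α n lam c * x α n lam ^ i := by
  rw [← C_mul_X_pow, map_mul, map_pow]; rfl

/-- The relation `f = 0` in `A`. -/
theorem sum_lam_mul_pow :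
    ∑ i ∈ Finset.Icc 1 n, incl α n lam (lam (n - i)) * x α n lam ^ i = -incl α n lam (lam n) := by
  have h : proj α n lam (f α n lam) = 0 :=
    proj_eq_zero.2 (TwoSidedIdeal.subset_span (Set.mem_singleton _))
  rw [f_eq_sum, map_sum, Finset.range_eq_Ico, Finset.sum_eq_sum_Ico_succ_bot (by omega)] at h
  simp only [proj_monomial] at h
  rw [Nat.sub_zero, pow_zero, mul_one] at h
  exact (neg_eq_of_add_eq_zero_right h).symm

/-- The coordinate of `x ^ i` in the basis `1, x, …, x ^ (n - 1)` of the left `K`-module `A` (and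
`0` for `i ≥ n`). -/
def coord (H : IsNormalMonic α n lam) (i : ℕ) : MonogenicExt α n lam →ₗ[k] K :=
  (Submodule.liftQ (LinearMap.ker (proj α n lam).toLinearMap) (rem α n lam i)
    (fun _ hp => rem_eq_zero_of_mem H (proj_eq_zero.1 hp) i)) ∘ₗ
  ((proj α n lam).toLinearMap.quotKerEquivOfSurjective proj_surjective).symm.toLinearMap

theorem coord_proj (H : IsNormalMonic α n lam) (i : ℕ) (p : OreExtension α) :
    coord H i (proj α n lam p) = rem α n lam i p := by
  have : ((proj α n lam).toLinearMap.quotKerEquivOfSurjective proj_surjective).symm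
      (proj α n lam p) = Submodule.Quotient.mk p := by
    rw [LinearEquiv.symm_apply_eq]
    rfl
  rw [coord, LinearMap.comp_apply, LinearEquiv.coe_coe, this]
  rfl

theorem coord_incl_mul (H : IsNormalMonic α n lam) (i : ℕ) (c : K) (a : MonogenicExt α n lam) :
    coord H i (incl α n lam c * a) = c * coord H i a := by
  obtain ⟨p, rfl⟩ := proj_surjective a
  have : incl α n lam c * proj α n lam p = proj α n lam (C α c * p) :=
    (map_mul (proj α n lam) (C α c) p).symm
  rw [this, coord_proj, coord_proj, rem_C_mul]

theorem coord_x_pow (H : IsNormalMonic α n lam) {i : ℕ} (hi : i < n) (N : ℕ) :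
    coord H i (x α n lam ^ N) = powRem n lam N i := by
  have : x α n lam ^ N = proj α n lam (X α ^ N) := (map_pow ..).symm
  rw [this, coord_proj, X_pow, rem_monomial hi, one_mul]

theorem coord_x_pow_of_lt (H : IsNormalMonic α n lam) {i j : ℕ} (hi : i < n) (hj : j < n) :
    coord H i (x α n lam ^ j) = if i = j then 1 else 0 := by
  rw [coord_x_pow H hi, powRem_of_lt hj hi]

theorem sum_coord (H : IsNormalMonic α n lam) (a : MonogenicExt α n lam) :
    ∑ i ∈ Finset.range n, incl α n lam (coord H i a) * x α n lam ^ i = a := by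
  obtain ⟨p, rfl⟩ := proj_surjective a
  induction p using OreExtension.induction with
  | h0 => simp
  | h1 N c =>
    have h : x α n lam ^ N =
        ∑ i ∈ Finset.range n, incl α n lam (powRem n lam N i) * x α n lam ^ i := by
      have h := congrArg (proj α n lam) (X_pow_eq H N)
      rw [map_add, map_mul, proj_eq_zero.2 (TwoSidedIdeal.subset_span (Set.mem_singleton _)),
        mul_zero, zero_add, map_sum, map_pow] at h
      simp only [proj_monomial] at h
      exact h
    rw [proj_monomial]
    conv_rhs => rw [h, Finset.mul_sum]
    refine Finset.sum_congr rfl fun i hi => ?_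
    rw [coord_incl_mul, coord_x_pow H (Finset.mem_range.1 hi), map_mul, mul_assoc]
  | h2 p q hp hq =>
    conv_rhs => rw [map_add, ← hp, ← hq, ← Finset.sum_add_distrib]
    simp only [map_add, add_mul]

theorem xbar_succ (H : IsNormalMonic α n lam) (N : ℕ) : xbar α n lam (N + 1) =
    x α n lam * xbar α n lam N + incl α n lam (coord H (n - 1) (x α n lam ^ N)) := by
  have := H.two_le
  rw [xbar, quot_X_pow H, powQuot, map_add, map_mul, xbar, quot_X_pow H,
    coord_x_pow H (by omega)]
  rfl

theorem xbar_of_lt (H : IsNormalMonic α n lam) {j : ℕ} (hj : j < n) : xbar α n lam j = 0 := by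
  induction j with
  | zero => rw [xbar, quot_X_pow H, powQuot, map_zero]
  | succ j ih =>
    rw [xbar_succ H, ih (by omega), coord_x_pow_of_lt H (by omega) (by omega), if_neg (by omega)]
    simp

theorem pow_map_coord_x_pow (H : IsNormalMonic α n lam) (N j : ℕ) :
    (α ^ j) (coord H (n - 1) (x α n lam ^ N)) = coord H (n - 1) (x α n lam ^ N) := by
  have := H.two_le
  rw [coord_x_pow H (by omega)]
  induction j with
  | zero => rfl
  | succ j ih => rw [pow_succ, AlgHom.mul_apply, map_powRem H, ih]

/-- The quotient of `x ^ (i + j)` by `f`, in terms of leading coefficients of remainders. -/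
theorem sum_pow_mul_coord (H : IsNormalMonic α n lam) (i : ℕ) {j : ℕ} (hj : j < n) :
    ∑ l ∈ Finset.range i,
      x α n lam ^ l * incl α n lam (coord H (n - 1) (x α n lam ^ (i - l - 1 + j))) =
      xbar α n lam (i + j) := by
  induction i with
  | zero => rw [Finset.sum_range_zero, zero_add, xbar_of_lt H hj]
  | succ i ih =>
    rw [Nat.add_right_comm, xbar_succ H, ← ih, Finset.sum_range_succ', Finset.mul_sum]
    congr 1
    · refine Finset.sum_congr rfl fun l _ => ?_
      rw [pow_succ', mul_assoc, Nat.add_sub_add_right]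
    · rw [pow_zero, one_mul, Nat.sub_zero, Nat.add_sub_cancel]

end MonogenicExt

end

noncomputable section

/-! ### The canonical resolution: bimodule structure and contraction -/

section Canonical

variable {k K A : Type*} [CommRing k] [Ring K] [Algebra k K] [Ring A] [Algebra k A]
variable (ι : K →ₐ[k] A)

namespace Hoch

variable {M N : Type*} [AddCommGroup M] [Module k M] [Module A M] [Module Aᵐᵒᵖ M]
  [AddCommGroup N] [Module k N] [Module A N] [Module Aᵐᵒᵖ N]

theorem b_map [SMulCommClass A Aᵐᵒᵖ M] [IsScalarTower k A M] [IsScalarTower k Aᵐᵒᵖ M]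
    [SMulCommClass A Aᵐᵒᵖ N] [IsScalarTower k A N] [IsScalarTower k Aᵐᵒᵖ N] (f : M →ₗ[k] N)
    (hl : ∀ (a : A) m, f (a • m) = a • f m)
    (hr : ∀ (a : A) m, f (op a • m) = op a • f m) (r : ℕ) (z : Hoch ι M (r + 1)) :
    b ι N r (map ι f hl hr (r + 1) z) = map ι f hl hr r (b ι M r z) := by
  refine LinearMap.congr_fun (f := b ι N r ∘ₗ map ι f hl hr (r + 1))
    (g := map ι f hl hr r ∘ₗ b ι M r) (hom_ext ι fun m a => ?_) z
  simp only [LinearMap.comp_apply, map_mk, b_mk, map_add, map_sum, map_smul, hl, hr]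

/-- An element `c` of `K` that commutes with all the letters may be moved around the word. -/
theorem mk_op_smul_of_commute {r : ℕ} (c : K) (m : M) (a : Fin r → A)
    (h : ∀ i, Commute (ι c) (a i)) : mk ι (op (ι c) • m) a = mk ι (ι c • m) a := by
  have key : ∀ j : Fin (r + 1), mk ι (op (ι c) • m) a =
      mk ι (mulLeftAt j (ι c) m a).1 (mulLeftAt j (ι c) m a).2 := by
    intro j
    induction j using Fin.induction with
    | zero => exact mk_balance ι 0 c m a
    | succ i ih =>
      rw [ih, ← mk_balance ι i.succ c m a, mulLeftAt, Fin.lastCases_castSucc, mulRightAt,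
        Fin.cases_succ, (h i).eq]
  have := key (Fin.last r)
  rwa [mulLeftAt, Fin.lastCases_last] at this

end Hoch

namespace Bar

variable {r : ℕ}

theorem hom_ext_mk {N : Type*} [AddCommGroup N] [Module k N] {f g : Bar ι r →ₗ[k] N}
    (h : ∀ u a v, f (mk ι u a v) = g (mk ι u a v)) (w : Bar ι r) : f w = g w :=
  LinearMap.congr_fun (EnvTensor.bar_hom_ext ι h) w

theorem mk_add_left (u u' : A) (a : Fin r → A) (v : A) :
    mk ι (u + u') a v = mk ι u a v + mk ι u' a v :=
  (congrArg (fun t : InnerSq k A => Hoch.mk ι t a) (TensorProduct.add_tmul u u' v)).trans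
    (Hoch.mk_add ι _ _ a)

theorem mk_smul_left (t : k) (u : A) (a : Fin r → A) (v : A) :
    mk ι (t • u) a v = t • mk ι u a v := Hoch.mk_smul ι t (InnerSq.tmul k u v) a

theorem mk_add_right (u : A) (a : Fin r → A) (v v' : A) :
    mk ι u a (v + v') = mk ι u a v + mk ι u a v' :=
  (congrArg (fun t : InnerSq k A => Hoch.mk ι t a) (TensorProduct.tmul_add u v v')).trans
    (Hoch.mk_add ι _ _ a)

theorem mk_smul_right (t : k) (u : A) (a : Fin r → A) (v : A) :
    mk ι u a (t • v) = t • mk ι u a v :=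
  (congrArg (fun t : InnerSq k A => Hoch.mk ι t a) (TensorProduct.tmul_smul t u v)).trans
    (Hoch.mk_smul ι t _ a)

/-- The right action of `A`, as a bilinear map. -/
def rmulHom (r : ℕ) : A →ₗ[k] Bar ι r →ₗ[k] Bar ι r where
  toFun c := rmul ι c r
  map_add' c d := EnvTensor.bar_hom_ext ι fun u a v => by
    rw [LinearMap.add_apply, rmul_mk, rmul_mk, rmul_mk, mul_add, mk_add_right]
  map_smul' t c := EnvTensor.bar_hom_ext ι fun u a v => by
    rw [RingHom.id_apply, LinearMap.smul_apply, rmul_mk, rmul_mk, mul_smul_comm, mk_smul_right]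

theorem rmulHom_apply (c : A) (w : Bar ι r) : rmulHom ι r c w = rmul ι c r w := rfl

theorem lmul_mul (c d : A) (w : Bar ι r) : lmul ι (c * d) r w = lmul ι c r (lmul ι d r w) :=
  hom_ext_mk ι (g := lmul ι c r ∘ₗ lmul ι d r) (fun u a v => by
    rw [LinearMap.comp_apply, lmul_mk, lmul_mk, lmul_mk, mul_assoc]) w

theorem rmul_mul (c d : A) (w : Bar ι r) : rmul ι (c * d) r w = rmul ι d r (rmul ι c r w) :=
  hom_ext_mk ι (g := rmul ι d r ∘ₗ rmul ι c r) (fun u a v => by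
    rw [LinearMap.comp_apply, rmul_mk, rmul_mk, rmul_mk, mul_assoc]) w

theorem rmulHom_mul (c d : A) (w : Bar ι r) :
    rmulHom ι r (c * d) w = rmulHom ι r d (rmulHom ι r c w) := rmul_mul ι c d w

theorem lmul_one (w : Bar ι r) : lmul ι 1 r w = w :=
  hom_ext_mk ι (g := LinearMap.id) (fun u a v => by
    rw [LinearMap.id_apply, lmul_mk, one_mul]) w

theorem rmul_one (w : Bar ι r) : rmul ι 1 r w = w :=
  hom_ext_mk ι (g := LinearMap.id) (fun u a v => by
    rw [LinearMap.id_apply, rmul_mk, mul_one]) w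

theorem lmul_rmul (c d : A) (w : Bar ι r) :
    lmul ι c r (rmul ι d r w) = rmul ι d r (lmul ι c r w) :=
  hom_ext_mk ι (f := lmul ι c r ∘ₗ rmul ι d r) (g := rmul ι d r ∘ₗ lmul ι c r) (fun u a v => by
    rw [LinearMap.comp_apply, LinearMap.comp_apply, rmul_mk, lmul_mk, lmul_mk, rmul_mk]) w

theorem b'_lmul (c : A) (w : Bar ι (r + 1)) :
    b' ι r (lmul ι c (r + 1) w) = lmul ι c r (b' ι r w) := Hoch.b_map ..

theorem b'_rmul (c : A) (w : Bar ι (r + 1)) :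
    b' ι r (rmul ι c (r + 1) w) = rmul ι c r (b' ι r w) := Hoch.b_map ..

theorem mk_balance_zero (u : A) (c : K) (a : Fin 0 → A) (v : A) :
    mk ι (u * ι c) a v = mk ι u a (ι c * v) := Hoch.mk_single ι c (InnerSq.tmul k u v) a

theorem mk_balance_last (u : A) (c : K) (a : Fin (r + 1) → A) (v : A) :
    mk ι u (Function.update a (Fin.last r) (a (Fin.last r) * ι c)) v = mk ι u a (ι c * v) :=
  Hoch.mk_last ι c (InnerSq.tmul k u v) a

theorem appendOne_lmul (c : A) (w : Bar ι r) :
    appendOne ι r (lmul ι c r w) = lmul ι c (r + 1) (appendOne ι r w) :=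
  hom_ext_mk ι (f := appendOne ι r ∘ₗ lmul ι c r) (g := lmul ι c (r + 1) ∘ₗ appendOne ι r)
    (fun u a v => by
      rw [LinearMap.comp_apply, LinearMap.comp_apply, lmul_mk, appendOne_mk, appendOne_mk,
        lmul_mk]) w

theorem appendOne_rmul (c : K) (w : Bar ι r) :
    appendOne ι r (rmul ι (ι c) r w) = rmul ι (ι c) (r + 1) (appendOne ι r w) :=
  hom_ext_mk ι (f := appendOne ι r ∘ₗ rmul ι (ι c) r)
    (g := rmul ι (ι c) (r + 1) ∘ₗ appendOne ι r) (fun u a v => by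
      rw [LinearMap.comp_apply, LinearMap.comp_apply, rmul_mk, appendOne_mk, appendOne_mk, rmul_mk]
      have := mk_balance_last ι u c (Fin.snoc (α := fun _ => A) a v) 1
      rw [Fin.snoc_last, Fin.update_snoc_last, mul_one] at this
      rw [this, one_mul]) w

theorem appendOne_mk_one (u : A) (a : Fin r → A) : appendOne ι r (mk ι u a 1) = 0 := by
  rw [appendOne_mk, ← map_one ι]
  have := Hoch.mk_update_base ι (Fin.last r) (1 : K) (InnerSq.tmul k u (ι 1))
    (Fin.snoc (α := fun _ => A) a (ι 1))
  rwa [Fin.update_snoc_last] at this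

theorem rmul_appendOne_mk (u : A) (a : Fin (r + 1) → A) (v : A) :
    rmul ι v (r + 1) (appendOne ι r (mk ι u (Fin.init a) (a (Fin.last r)))) = mk ι u a v := by
  rw [appendOne_mk, rmul_mk, one_mul, Fin.snoc_init_self]

theorem b'_appendOne_zero (u : A) (a : Fin 0 → A) (v : A) :
    b' ι 0 (appendOne ι 0 (mk ι u a v)) = mk ι (u * v) a 1 - mk ι u a v := by
  rw [appendOne_mk, b'_mk]
  simp [sub_eq_add_neg, Subsingleton.elim _ a, Fin.snoc]

theorem b'_appendOne (w : Bar ι (r + 1)) : b' ι (r + 1) (appendOne ι (r + 1) w) =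
    appendOne ι r (b' ι r w) + (-1 : k) ^ r • w := by
  refine hom_ext_mk ι (f := b' ι (r + 1) ∘ₗ appendOne ι (r + 1))
    (g := appendOne ι r ∘ₗ b' ι r + (-1 : k) ^ r • LinearMap.id) (fun u a v => ?_) w
  have h1 : Fin.tail (Fin.snoc (α := fun _ => A) a v) =
      Fin.snoc (α := fun _ => A) (Fin.tail a) v := by
    funext p
    induction p using Fin.lastCases with
    | last => rw [Fin.tail, Fin.succ_last, Fin.snoc_last, Fin.snoc_last]
    | cast p => rw [Fin.tail, Fin.succ_castSucc, Fin.snoc_castSucc, Fin.snoc_castSucc, Fin.tail]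
  have h2 : ∀ j : Fin r, Fin.contractNth j.castSucc.castSucc (· * ·)
      (Fin.snoc (α := fun _ => A) a v) =
      Fin.snoc (α := fun _ => A) (Fin.contractNth j.castSucc (· * ·) a) v := fun j => by
    funext p
    induction p using Fin.lastCases with
    | last =>
      rw [Fin.snoc_last, Fin.contractNth_apply_of_gt _ _ _ _ (by simp), Fin.succ_last,
        Fin.snoc_last]
    | cast p =>
      rw [Fin.snoc_castSucc]
      simp only [Fin.contractNth, Fin.val_castSucc, Fin.succ_castSucc, Fin.snoc_castSucc]
  have h3 : Fin.contractNth (Fin.last r).castSucc (· * ·) (Fin.snoc (α := fun _ => A) a v) =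
      Fin.snoc (α := fun _ => A) (Fin.init a) (a (Fin.last r) * v) := by
    funext p
    induction p using Fin.lastCases with
    | last =>
      rw [Fin.snoc_last, contractNth_self, Fin.snoc_castSucc, Fin.succ_last, Fin.snoc_last]
    | cast p =>
      rw [Fin.snoc_castSucc, Fin.contractNth_apply_of_lt _ _ _ _ (by simp), Fin.snoc_castSucc]
      rfl
  have h4 : Fin.snoc (α := fun _ => A) a v 0 = a 0 := Fin.snoc_castSucc (α := fun _ => A) v a 0
  simp only [LinearMap.comp_apply, LinearMap.add_apply, LinearMap.smul_apply, LinearMap.id_apply]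
  rw [appendOne_mk, b'_mk, b'_mk, Fin.sum_univ_castSucc]
  simp only [map_add, map_sum, map_smul, appendOne_mk, h1, h2, h3, h4, Fin.snoc_last,
    Fin.init_snoc, mul_one, Fin.val_castSucc, Fin.val_last]
  rw [pow_add (-1 : k) r 2, neg_one_sq, mul_one]
  abel

/-- The contraction `y ↦ y ⊗ 1` generates, as `A ⊗ Ā^{⊗ (r + 1)} ⊗ A` is spanned by the
`(y ⊗ 1) v`; so a right `A`-linear identity in degree `r + 1` may be checked on the `y ⊗ 1`. -/
theorem ext_appendOne {N : Type*} [AddCommGroup N] [Module k N] {f g : Bar ι (r + 1) →ₗ[k] N}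
    (R : A → N → N) (hf : ∀ v w, f (rmul ι v (r + 1) w) = R v (f w))
    (hg : ∀ v w, g (rmul ι v (r + 1) w) = R v (g w))
    (h : ∀ w, f (appendOne ι r w) = g (appendOne ι r w)) : f = g :=
  EnvTensor.bar_hom_ext ι fun u a v => by
    rw [← rmul_appendOne_mk, hf, hg, h]

theorem b'_b' (r : ℕ) (w : Bar ι (r + 2)) : b' ι r (b' ι (r + 1) w) = 0 := by
  refine LinearMap.congr_fun (f := b' ι r ∘ₗ b' ι (r + 1)) (g := 0) ?_ w
  clear w
  induction r with
  | zero =>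
    refine ext_appendOne ι (fun v => rmul ι v 0)
      (fun v w => by simp only [LinearMap.comp_apply, b'_rmul]) (fun v w => by simp) fun w => ?_
    rw [LinearMap.zero_apply, LinearMap.comp_apply, b'_appendOne, map_add, pow_zero, one_smul]
    refine hom_ext_mk ι (f := b' ι 0 ∘ₗ appendOne ι 0 ∘ₗ b' ι 0 + b' ι 0) (g := 0)
      (fun u a v => ?_) w
    simp only [LinearMap.add_apply, LinearMap.comp_apply, LinearMap.zero_apply]
    rw [b'_mk]
    simp only [Finset.univ_eq_empty, Finset.sum_empty, map_add, map_neg, add_zero,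
      b'_appendOne_zero, zero_add, pow_one, neg_smul, one_smul]
    rw [Subsingleton.elim (Fin.init a) (Fin.tail a), mul_assoc]
    have key : ∀ X Y Z : Bar ι 0, X - Y + -(X - Z) + (Y + -Z) = 0 := fun X Y Z => by abel
    exact key _ _ _
  | succ r ih =>
    refine ext_appendOne ι (fun v => rmul ι v (r + 1))
      (fun v w => by simp only [LinearMap.comp_apply, b'_rmul]) (fun v w => by simp) fun w => ?_
    have := LinearMap.congr_fun ih w
    rw [LinearMap.zero_apply, LinearMap.comp_apply] at this ⊢
    rw [b'_appendOne, map_add, b'_appendOne, this, map_zero, map_smul, zero_add, pow_succ]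
    simp

/-- The right `A`-linear map with values `G u a` on the `u ⊗ a_1 ⊗ ⋯ ⊗ a_r ⊗ 1`, where `A` acts on
the target on the right by `R`. -/
def liftRight {N : Type*} [AddCommGroup N] [Module k N] (R : A →ₗ[k] N →ₗ[k] N)
    (hR : ∀ a b z, R (a * b) z = R b (R a z)) (G : A → (Fin r → A) → N)
    (h1 : ∀ u u' a, G (u + u') a = G u a + G u' a)
    (h2 : ∀ (c : k) u a, G (c • u) a = c • G u a)
    (h3 : ∀ u a i x y, G u (Function.update a i (x + y)) =
      G u (Function.update a i x) + G u (Function.update a i y))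
    (h4 : ∀ u a i (c : k) x, G u (Function.update a i (c • x)) =
      c • G u (Function.update a i x))
    (h5 : ∀ (j : Fin (r + 1)) (c : K) u a,
      Fin.cases (motive := fun _ => N) (G (u * ι c) a)
        (fun i => G u (Function.update a i (a i * ι c))) j =
      Fin.lastCases (motive := fun _ => N) (R (ι c) (G u a))
        (fun i => G u (Function.update a i (ι c * a i))) j)
    (h6 : ∀ (i : Fin r) (c : K) u a, G u (Function.update a i (ι c)) = 0) : Bar ι r →ₗ[k] N :=
  let B : (Fin r → A) → A →ₗ[k] A →ₗ[k] N := fun a => LinearMap.mk₂ k (fun u v => R v (G u a))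
    (fun u u' v => by rw [h1, map_add]) (fun c u v => by rw [h2, map_smul])
    (fun u v v' => by rw [map_add, LinearMap.add_apply])
    (fun c u v => by rw [map_smul, LinearMap.smul_apply])
  have hB : ∀ a u v, InnerSq.lift (B a) (InnerSq.tmul k u v) = R v (G u a) := fun _ _ _ => rfl
  Hoch.lift ι (fun t a => InnerSq.lift (B a) t) (fun t t' a => map_add _ _ _)
    (fun c t a => map_smul _ _ _)
    (fun t a i x y => by
      induction t using InnerSq.induction with
      | h0 => simp
      | h1 u v => rw [hB, hB, hB, h3, map_add]
      | h2 s t hs ht => simp only [map_add, hs, ht]; abel)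
    (fun t a i c x => by
      induction t using InnerSq.induction with
      | h0 => simp
      | h1 u v => rw [hB, hB, h4, map_smul]
      | h2 s t hs ht => simp only [map_add, hs, ht, smul_add])
    (fun j c t a => by
      have addR : ∀ s t, InnerSq.lift (B (mulRightAt j (ι c) (s + t) a).2)
          (mulRightAt j (ι c) (s + t) a).1 =
          InnerSq.lift (B (mulRightAt j (ι c) s a).2) (mulRightAt j (ι c) s a).1 +
          InnerSq.lift (B (mulRightAt j (ι c) t a).2) (mulRightAt j (ι c) t a).1 := by
        intro s t
        induction j using Fin.cases with
        | zero => simp only [mulRightAt, Fin.cases_zero, smul_add, map_add]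
        | succ i => simp only [mulRightAt, Fin.cases_succ, map_add]
      have addL : ∀ s t, InnerSq.lift (B (mulLeftAt j (ι c) (s + t) a).2)
          (mulLeftAt j (ι c) (s + t) a).1 =
          InnerSq.lift (B (mulLeftAt j (ι c) s a).2) (mulLeftAt j (ι c) s a).1 +
          InnerSq.lift (B (mulLeftAt j (ι c) t a).2) (mulLeftAt j (ι c) t a).1 := by
        intro s t
        induction j using Fin.lastCases with
        | last => simp only [mulLeftAt, Fin.lastCases_last, smul_add, map_add]
        | cast i => simp only [mulLeftAt, Fin.lastCases_castSucc, map_add]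
      induction t using InnerSq.induction with
      | h0 =>
        have hr := addR 0 0
        have hl := addL 0 0
        rw [add_zero, left_eq_add] at hr hl
        rw [hr, hl]
      | h1 u v =>
        have key := congrArg (R v) (h5 j c u a)
        refine Eq.trans ?_ (key.trans ?_)
        · induction j using Fin.cases with
          | zero => rfl
          | succ i => rfl
        · induction j using Fin.lastCases with
          | last =>
            simp only [mulLeftAt, Fin.lastCases_last]
            rw [InnerSq.smul_tmul, hB, hR]
          | cast i =>
            simp only [mulLeftAt, Fin.lastCases_castSucc]
            rw [hB]
      | h2 s t hs ht => rw [addR, addL, hs, ht])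
    (fun i c t a => by
      induction t using InnerSq.induction with
      | h0 => simp
      | h1 u v => rw [hB, h6, map_zero]
      | h2 s t hs ht => simp only [map_add, hs, ht, add_zero])

theorem liftRight_mk {N : Type*} [AddCommGroup N] [Module k N] (R : A →ₗ[k] N →ₗ[k] N)
    (hR : ∀ a b z, R (a * b) z = R b (R a z)) (G : A → (Fin r → A) → N) (h1 h2 h3 h4 h5 h6)
    (u : A) (a : Fin r → A) (v : A) :
    liftRight ι R hR G h1 h2 h3 h4 h5 h6 (mk ι u a v) = R v (G u a) := by
  rw [liftRight, mk, Hoch.lift_mk]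
  rfl

theorem liftRight_rmul {N : Type*} [AddCommGroup N] [Module k N] (R : A →ₗ[k] N →ₗ[k] N)
    (hR : ∀ a b z, R (a * b) z = R b (R a z)) (G : A → (Fin r → A) → N) (h1 h2 h3 h4 h5 h6)
    (c : A) (w : Bar ι r) : liftRight ι R hR G h1 h2 h3 h4 h5 h6 (rmul ι c r w) =
      R c (liftRight ι R hR G h1 h2 h3 h4 h5 h6 w) :=
  hom_ext_mk ι (f := liftRight ι R hR G h1 h2 h3 h4 h5 h6 ∘ₗ rmul ι c r)
    (g := R c ∘ₗ liftRight ι R hR G h1 h2 h3 h4 h5 h6) (fun u a v => by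
      rw [LinearMap.comp_apply, LinearMap.comp_apply, rmul_mk, liftRight_mk, liftRight_mk, hR]) w

theorem liftRight_lmul {N : Type*} [AddCommGroup N] [Module k N] (R : A →ₗ[k] N →ₗ[k] N)
    (hR : ∀ a b z, R (a * b) z = R b (R a z)) (G : A → (Fin r → A) → N) (h1 h2 h3 h4 h5 h6)
    (c : A) (L : N →ₗ[k] N) (hL : ∀ d z, L (R d z) = R d (L z))
    (hG : ∀ u a, G (c * u) a = L (G u a)) (w : Bar ι r) :
    liftRight ι R hR G h1 h2 h3 h4 h5 h6 (lmul ι c r w) =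
      L (liftRight ι R hR G h1 h2 h3 h4 h5 h6 w) :=
  hom_ext_mk ι (f := liftRight ι R hR G h1 h2 h3 h4 h5 h6 ∘ₗ lmul ι c r)
    (g := L ∘ₗ liftRight ι R hR G h1 h2 h3 h4 h5 h6) (fun u a v => by
      rw [LinearMap.comp_apply, LinearMap.comp_apply, lmul_mk, liftRight_mk, liftRight_mk, hL,
        hG]) w

/-- The right `A`-linear map that agrees with a right `K`-linear map `g` on the
`u ⊗ a_1 ⊗ ⋯ ⊗ a_r ⊗ 1`. -/
def extendRight {N : Type*} [AddCommGroup N] [Module k N] (R : A →ₗ[k] N →ₗ[k] N)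
    (hR : ∀ a b z, R (a * b) z = R b (R a z)) (g : Bar ι r →ₗ[k] N)
    (hg : ∀ (c : K) w, g (rmul ι (ι c) r w) = R (ι c) (g w)) : Bar ι r →ₗ[k] N :=
  liftRight ι R hR (fun u a => g (mk ι u a 1))
    (fun u u' a => by rw [mk_add_left, map_add])
    (fun c u a => by rw [mk_smul_left, map_smul])
    (fun u a i x y => by rw [mk, Hoch.mk_update_add, map_add]; rfl)
    (fun u a i c x => by rw [mk, Hoch.mk_update_smul, map_smul]; rfl)
    (fun j c u a => by
      refine Eq.trans ?_ ((congrArg g (Hoch.mk_balance ι j c (InnerSq.tmul k u 1) a)).trans ?_)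
      · induction j using Fin.cases with
        | zero => rfl
        | succ i => rfl
      · induction j using Fin.lastCases with
        | last =>
          simp only [mulLeftAt, Fin.lastCases_last]
          rw [← hg, rmul_mk, InnerSq.smul_tmul, one_mul, mul_one]
          rfl
        | cast i =>
          simp only [mulLeftAt, Fin.lastCases_castSucc]
          rfl)
    (fun i c u a => by rw [mk, Hoch.mk_update_base, map_zero])

theorem extendRight_mk {N : Type*} [AddCommGroup N] [Module k N] (R : A →ₗ[k] N →ₗ[k] N)
    (hR : ∀ a b z, R (a * b) z = R b (R a z)) (g : Bar ι r →ₗ[k] N) (hg) (u : A) (a : Fin r → A)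
    (v : A) : extendRight ι R hR g hg (mk ι u a v) = R v (g (mk ι u a 1)) := liftRight_mk ..

/-- The right `A`-linear map on `A ⊗ Ā^{⊗ (r + 1)} ⊗ A` with values `g y` on the `y ⊗ 1`, for a right
`K`-linear map `g` that vanishes on the words with last letter `1`. -/
def extendAppendOne {N : Type*} [AddCommGroup N] [Module k N] (R : A →ₗ[k] N →ₗ[k] N)
    (hR : ∀ a b z, R (a * b) z = R b (R a z)) (g : Bar ι r →ₗ[k] N)
    (hg : ∀ (c : K) w, g (rmul ι (ι c) r w) = R (ι c) (g w)) (hg1 : ∀ u a, g (mk ι u a 1) = 0) :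
    Bar ι (r + 1) →ₗ[k] N :=
  liftRight ι R hR (fun u a => g (mk ι u (Fin.init a) (a (Fin.last r))))
    (fun u u' a => by rw [mk_add_left, map_add])
    (fun c u a => by rw [mk_smul_left, map_smul])
    (fun u a i x y => by
      induction i using Fin.lastCases with
      | last => simp only [Fin.init_update_last, Function.update_self, mk_add_right, map_add]
      | cast i =>
        simp only [Fin.init_update_castSucc, Function.update_of_ne (Fin.castSucc_lt_last i).ne']
        rw [mk, Hoch.mk_update_add, map_add]; rfl)
    (fun u a i c x => by
      induction i using Fin.lastCases with
      | last => simp only [Fin.init_update_last, Function.update_self, mk_smul_right, map_smul]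
      | cast i =>
        simp only [Fin.init_update_castSucc, Function.update_of_ne (Fin.castSucc_lt_last i).ne']
        rw [mk, Hoch.mk_update_smul, map_smul]; rfl)
    (fun j c u a => by
      induction j using Fin.lastCases with
      | last =>
        rw [← Fin.succ_last, Fin.cases_succ, Fin.succ_last, Fin.lastCases_last,
          Fin.init_update_last, Function.update_self, ← hg, rmul_mk]
      | cast j =>
        rw [Fin.lastCases_castSucc]
        refine Eq.trans ?_ ((congrArg g (Hoch.mk_balance ι j c
          (InnerSq.tmul k u (a (Fin.last r))) (Fin.init a))).trans ?_)
        · induction j using Fin.cases with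
          | zero => rfl
          | succ i =>
            rw [← Fin.succ_castSucc, Fin.cases_succ, Fin.init_update_castSucc,
              Function.update_of_ne (Fin.castSucc_lt_last i).ne']
            rfl
        · induction j using Fin.lastCases with
          | last =>
            rw [Fin.init_update_last, Function.update_self, mulLeftAt, Fin.lastCases_last]
            rfl
          | cast i =>
            rw [Fin.init_update_castSucc, Function.update_of_ne (Fin.castSucc_lt_last _).ne',
              mulLeftAt, Fin.lastCases_castSucc]
            rfl)
    (fun i c u a => by
      induction i using Fin.lastCases with
      | last =>
        rw [Function.update_self, Fin.init_update_last, ← one_mul (ι c), ← rmul_mk, hg, hg1,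
          map_zero]
      | cast i =>
        rw [Fin.init_update_castSucc, mk, Hoch.mk_update_base, map_zero])

theorem extendAppendOne_mk {N : Type*} [AddCommGroup N] [Module k N] (R : A →ₗ[k] N →ₗ[k] N)
    (hR : ∀ a b z, R (a * b) z = R b (R a z)) (g : Bar ι r →ₗ[k] N) (hg hg1) (u : A)
    (a : Fin (r + 1) → A) (v : A) : extendAppendOne ι R hR g hg hg1 (mk ι u a v) =
      R v (g (mk ι u (Fin.init a) (a (Fin.last r)))) := liftRight_mk ..

end Bar

/-! ### Coefficients in a bimodule -/

namespace Hoch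

variable {M : Type*} [AddCommGroup M] [Module k M] [Module A M] [Module Aᵐᵒᵖ M]
  [SMulCommClass A Aᵐᵒᵖ M] [IsScalarTower k A M] [IsScalarTower k Aᵐᵒᵖ M] {r : ℕ}

variable (M) in
/-- The pairing `(y, u ⊗ a_1 ⊗ ⋯ ⊗ a_r ⊗ v) ↦ [v y u ⊗ a_1 ⊗ ⋯ ⊗ a_r]`, that is, the isomorphism of
`M ⊗_{A^e} (A ⊗ Ā^{⊗ r} ⊗ A)` with `M ⊗ Ā^{⊗ r} ⊗`. -/
def pair (r : ℕ) : M →ₗ[k] Bar ι r →ₗ[k] Hoch ι M r :=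
  (TensorProduct.mk k M (Bar ι r)).compr₂ (EnvTensor.beta ι r ∘ₗ Submodule.mkQ _)

theorem pair_apply (y : M) (w : Bar ι r) :
    pair ι M r y w = EnvTensor.beta ι r (EnvTensor.tmul ι y w) := rfl

theorem pair_mk (y : M) (u : A) (a : Fin r → A) (v : A) :
    pair ι M r y (Bar.mk ι u a v) = mk ι (v • op u • y) a := EnvTensor.beta_tmul_mk ..

theorem pair_mk_one (y : M) (a : Fin r → A) : pair ι M r y (Bar.mk ι 1 a 1) = mk ι y a := by
  rw [pair_mk, op_one, one_smul, one_smul]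

theorem pair_smul (c d : A) (y : M) (w : Bar ι r) :
    pair ι M r (c • op d • y) w = pair ι M r y (Bar.lmul ι d r (Bar.rmul ι c r w)) :=
  Bar.hom_ext_mk ι (g := pair ι M r y ∘ₗ Bar.lmul ι d r ∘ₗ Bar.rmul ι c r) (fun u a v => by
    rw [LinearMap.comp_apply, LinearMap.comp_apply, Bar.rmul_mk, Bar.lmul_mk, pair_mk, pair_mk,
      op_mul, mul_smul, mul_smul, ← smul_comm c (op u)]) w

theorem pair_tmul (u v : A) (w : Bar ι r) :
    pair ι (InnerSq k A) r (InnerSq.tmul k u v) w = Bar.lmul ι u r (Bar.rmul ι v r w) :=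
  Bar.hom_ext_mk ι (g := Bar.lmul ι u r ∘ₗ Bar.rmul ι v r) (fun u' a v' => by
    rw [LinearMap.comp_apply, Bar.rmul_mk, Bar.lmul_mk, pair_mk]; rfl) w

theorem b_pair (y : M) (w : Bar ι (r + 1)) :
    b ι M r (pair ι M (r + 1) y w) = pair ι M r y (Bar.b' ι r w) := by
  have h : ∀ (r : ℕ) (w : Bar ι r), pair ι M r y w =
      map ι (EnvTensor.sandwich y) (EnvTensor.sandwich_smul y) (EnvTensor.sandwich_op_smul y) r w :=
    fun r w => Bar.hom_ext_mk ι (fun u a v => by rw [pair_mk, EnvTensor.map_sandwich_mk]) w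
  rw [h, h, b_map]

theorem hom_ext_pair {N : Type*} [AddCommGroup N] [Module k N] {f g : Hoch ι M r →ₗ[k] N}
    (h : ∀ y w, f (pair ι M r y w) = g (pair ι M r y w)) : f = g :=
  hom_ext ι fun m a => by rw [← pair_mk_one, h]

/-- The map out of `M ⊗ Ā^{⊗ r} ⊗ = M ⊗_{A^e} (A ⊗ Ā^{⊗ r} ⊗ A)` given by an `A^e`-balanced
bilinear map. -/
def liftPair {N : Type*} [AddCommGroup N] [Module k N] (G : M →ₗ[k] Bar ι r →ₗ[k] N)
    (hG : ∀ c d y w, G (c • op d • y) w = G y (Bar.lmul ι d r (Bar.rmul ι c r w))) :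
    Hoch ι M r →ₗ[k] N :=
  lift ι (fun y a => G y (Bar.mk ι 1 a 1))
    (fun y y' a => by rw [map_add, LinearMap.add_apply])
    (fun c y a => by rw [map_smul, LinearMap.smul_apply])
    (fun y a i x z => by rw [Bar.mk, mk_update_add, map_add]; rfl)
    (fun y a i c x => by rw [Bar.mk, mk_update_smul, map_smul]; rfl)
    (fun j c y a => by
      refine Eq.trans ?_ ((congrArg (G y) (mk_balance ι j c (InnerSq.tmul k 1 1) a)).trans ?_)
      · induction j using Fin.cases with
        | zero =>
          have := hG 1 (ι c) y (Bar.mk ι 1 a 1)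
          rw [one_smul, Bar.rmul_mk, Bar.lmul_mk, mul_one, mul_one] at this
          simp only [mulRightAt, Fin.cases_zero]
          rw [this, InnerSq.op_smul_tmul, one_mul]
          rfl
        | succ i => rfl
      · induction j using Fin.lastCases with
        | last =>
          have := hG (ι c) 1 y (Bar.mk ι 1 a 1)
          rw [op_one, one_smul, Bar.rmul_mk, Bar.lmul_mk, mul_one, one_mul] at this
          simp only [mulLeftAt, Fin.lastCases_last]
          rw [this, InnerSq.smul_tmul, mul_one]
          rfl
        | cast i =>
          simp only [mulLeftAt, Fin.lastCases_castSucc]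
          rfl)
    (fun i c y a => by rw [Bar.mk, mk_update_base, map_zero])

theorem liftPair_pair {N : Type*} [AddCommGroup N] [Module k N] (G : M →ₗ[k] Bar ι r →ₗ[k] N)
    (hG) (y : M) (w : Bar ι r) : liftPair ι G hG (pair ι M r y w) = G y w :=
  Bar.hom_ext_mk ι (f := liftPair ι G hG ∘ₗ pair ι M r y) (fun u a v => by
    rw [LinearMap.comp_apply, pair_mk, liftPair, lift_mk, hG, Bar.rmul_mk, Bar.lmul_mk, mul_one,
      one_mul]) w

end Hoch

end Canonical

end

noncomputable section

/-! ### The small resolution -/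

variable {k K : Type*} [CommRing k] [Ring K] [Algebra k K] {α : K →ₐ[k] K} {n : ℕ} {lam : ℕ → K}

theorem twist_succ_of_even {r : ℕ} (hr : r % 2 = 0) : twist n (r + 1) = twist n r + 1 := by
  rw [twist, twist, show (r + 1) / 2 = r / 2 by omega, show (r + 1) % 2 = 1 by omega, hr]

theorem twist_succ_of_odd {r : ℕ} (hr : r % 2 = 1) : twist n (r + 1) + 1 = twist n r + n := by
  rw [twist, twist, show (r + 1) / 2 = r / 2 + 1 by omega, show (r + 1) % 2 = 0 by omega, hr,
    add_mul]
  omega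

open MonogenicExt

namespace CS

variable (M : Type*) [AddCommGroup M] [Module k M] [Module (MonogenicExt α n lam) M]
  [Module (MonogenicExt α n lam)ᵐᵒᵖ M]

variable {M} in
theorem mk_balance (r : ℕ) (c : K) (m : M) :
    mk α n lam r (op (incl α n lam ((α ^ twist n r) c)) • m) =
      mk α n lam r (incl α n lam c • m) :=
  (Submodule.Quotient.eq _).2 (Submodule.subset_span ⟨m, c, rfl⟩)

variable {M} in
theorem hom_ext_mk {r : ℕ} {N : Type*} [AddCommGroup N] [Module k N]
    {f g : CS α n lam M r →ₗ[k] N} (h : ∀ y, f (mk α n lam r y) = g (mk α n lam r y)) : f = g :=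
  Submodule.linearMap_qext _ (LinearMap.ext h)

variable {M} in
theorem lam_smul_mk (H : IsNormalMonic α n lam) {r i : ℕ} (hi : i ≤ n) (y : M) :
    mk α n lam r (incl α n lam (lam i) • y) = mk α n lam r (op (incl α n lam (lam i)) • y) := by
  rw [← mk_balance, H.pow_map_lam hi]

variable [SMulCommClass (MonogenicExt α n lam) (MonogenicExt α n lam)ᵐᵒᵖ M]
  [IsScalarTower k (MonogenicExt α n lam) M] [IsScalarTower k (MonogenicExt α n lam)ᵐᵒᵖ M]

/-- The pairing `(y, u ⊗ v) ↦ [v y u]`, that is, the isomorphism of `M ⊗_{A^e} (A_{α^j} ⊗ A)` with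
`M / [M, K]_{α^j}`. -/
def pair (r : ℕ) : M →ₗ[k] ASq α n lam r →ₗ[k] CS α n lam M r where
  toFun y := Submodule.mapQ _ _ (EnvTensor.sandwich y) (by
    rw [twistedCommutators, Submodule.span_le]
    rintro _ ⟨m, c, rfl⟩
    rw [SetLike.mem_coe, Submodule.mem_comap, map_sub, EnvTensor.sandwich_smul,
      EnvTensor.sandwich_op_smul]
    exact Submodule.subset_span ⟨_, c, rfl⟩)
  map_add' y y' := by
    refine Submodule.linearMap_qext _ (TensorProduct.ext' fun u v => ?_)
    refine (congrArg (mk α n lam r) ?_ : mk α n lam r (v • op u • (y + y')) =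
      mk α n lam r (v • op u • y + v • op u • y'))
    rw [smul_add, smul_add]
  map_smul' c y := by
    refine Submodule.linearMap_qext _ (TensorProduct.ext' fun u v => ?_)
    refine (congrArg (mk α n lam r) ?_ : mk α n lam r (v • op u • c • y) =
      mk α n lam r (c • v • op u • y))
    rw [smul_comm (op u) c y, smul_comm v c]

variable {M} in
theorem pair_mk (r : ℕ) (y : M) (u v : MonogenicExt α n lam) :
    pair M r y (ASq.mk α n lam r u v) = mk α n lam r (v • op u • y) := rfl

end CS

namespace ASq

variable {r : ℕ}

theorem hom_ext_mk {N : Type*} [AddCommGroup N] [Module k N] {f g : ASq α n lam r →ₗ[k] N}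
    (h : ∀ u v, f (mk α n lam r u v) = g (mk α n lam r u v)) (z : ASq α n lam r) : f z = g z := by
  have : f = g := Submodule.linearMap_qext _ (TensorProduct.ext' h)
  rw [this]

variable (α n lam) in
/-- The bilinear map `(u, v) ↦ u ⊗ v`. -/
def mkHom (r : ℕ) : MonogenicExt α n lam →ₗ[k] MonogenicExt α n lam →ₗ[k] ASq α n lam r :=
  (TensorProduct.mk k _ _).compr₂ (Submodule.mkQ _ : InnerSq k _ →ₗ[k] ASq α n lam r)

theorem mkHom_apply (u v : MonogenicExt α n lam) : mkHom α n lam r u v = mk α n lam r u v := rfl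

theorem mk_balance (u : MonogenicExt α n lam) (c : K) (v : MonogenicExt α n lam) :
    mk α n lam r (u * incl α n lam ((α ^ twist n r) c)) v =
      mk α n lam r u (incl α n lam c * v) :=
  CS.mk_balance r c (InnerSq.tmul k u v)

/-- The linear map given by a bilinear map that satisfies the relations. -/
def lift {N : Type*} [AddCommGroup N] [Module k N]
    (g : MonogenicExt α n lam →ₗ[k] MonogenicExt α n lam →ₗ[k] N)
    (hg : ∀ u c v, g (u * incl α n lam ((α ^ twist n r) c)) v = g u (incl α n lam c * v)) :
    ASq α n lam r →ₗ[k] N :=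
  Submodule.liftQ _ (InnerSq.lift g) (by
    rw [twistedCommutators, Submodule.span_le]
    rintro _ ⟨t, c, rfl⟩
    rw [SetLike.mem_coe, LinearMap.mem_ker, map_sub, sub_eq_zero]
    induction t using InnerSq.induction with
    | h0 => simp
    | h1 u v => exact hg u c v
    | h2 s t hs ht => rw [smul_add, smul_add, map_add, map_add, hs, ht])

variable (α n lam) in
/-- The left action of `A`. -/
def lmul (r : ℕ) : MonogenicExt α n lam →ₗ[k] ASq α n lam r →ₗ[k] ASq α n lam r :=
  CS.pair (InnerSq k (MonogenicExt α n lam)) r ∘ₗ ((TensorProduct.mk k _ _).flip 1 :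
    MonogenicExt α n lam →ₗ[k] InnerSq k (MonogenicExt α n lam))

variable (α n lam) in
/-- The right action of `A`. -/
def rmul (r : ℕ) : MonogenicExt α n lam →ₗ[k] ASq α n lam r →ₗ[k] ASq α n lam r :=
  CS.pair (InnerSq k (MonogenicExt α n lam)) r ∘ₗ ((TensorProduct.mk k _ _) 1 :
    MonogenicExt α n lam →ₗ[k] InnerSq k (MonogenicExt α n lam))

theorem lmul_mk (c u v : MonogenicExt α n lam) :
    lmul α n lam r c (mk α n lam r u v) = mk α n lam r (c * u) v := by
  change mk α n lam r (c * u) (v * 1) = _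
  rw [mul_one]

theorem rmul_mk (c u v : MonogenicExt α n lam) :
    rmul α n lam r c (mk α n lam r u v) = mk α n lam r u (v * c) := by
  change mk α n lam r (1 * u) (v * c) = _
  rw [one_mul]

theorem lmul_mul (c d : MonogenicExt α n lam) (z : ASq α n lam r) :
    lmul α n lam r (c * d) z = lmul α n lam r c (lmul α n lam r d z) :=
  hom_ext_mk (g := lmul α n lam r c ∘ₗ lmul α n lam r d) (fun u v => by
    rw [LinearMap.comp_apply, lmul_mk, lmul_mk, lmul_mk, mul_assoc]) z

theorem rmul_mul (c d : MonogenicExt α n lam) (z : ASq α n lam r) :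
    rmul α n lam r (c * d) z = rmul α n lam r d (rmul α n lam r c z) :=
  hom_ext_mk (g := rmul α n lam r d ∘ₗ rmul α n lam r c) (fun u v => by
    rw [LinearMap.comp_apply, rmul_mk, rmul_mk, rmul_mk, mul_assoc]) z

theorem lmul_one (z : ASq α n lam r) : lmul α n lam r 1 z = z :=
  hom_ext_mk (g := LinearMap.id) (fun u v => by rw [lmul_mk, one_mul, LinearMap.id_apply]) z

theorem rmul_one (z : ASq α n lam r) : rmul α n lam r 1 z = z :=
  hom_ext_mk (g := LinearMap.id) (fun u v => by rw [rmul_mk, mul_one, LinearMap.id_apply]) z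

theorem lmul_rmul (c d : MonogenicExt α n lam) (z : ASq α n lam r) :
    lmul α n lam r c (rmul α n lam r d z) = rmul α n lam r d (lmul α n lam r c z) :=
  hom_ext_mk (f := lmul α n lam r c ∘ₗ rmul α n lam r d)
    (g := rmul α n lam r d ∘ₗ lmul α n lam r c) (fun u v => by
    rw [LinearMap.comp_apply, LinearMap.comp_apply, rmul_mk, lmul_mk, lmul_mk, rmul_mk]) z

/-- As `A_{α^j} ⊗ A` is a free left `A`-module on the `1 ⊗ x ^ i` with `i < n`, linear maps that
agree on the `u ⊗ x ^ i` are equal. -/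
theorem hom_ext_pow (H : IsNormalMonic α n lam) {N : Type*} [AddCommGroup N] [Module k N]
    {f g : ASq α n lam r →ₗ[k] N} (h : ∀ u, ∀ i < n,
      f (mk α n lam r u (x α n lam ^ i)) = g (mk α n lam r u (x α n lam ^ i)))
    (z : ASq α n lam r) : f z = g z := by
  refine hom_ext_mk (fun u v => ?_) z
  have : mk α n lam r u v = ∑ i ∈ Finset.range n,
      mk α n lam r (u * incl α n lam ((α ^ twist n r) (coord H i v))) (x α n lam ^ i) := by
    simp only [mk_balance]
    conv_lhs => rw [← sum_coord H v, ← mkHom_apply, map_sum]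
    rfl
  rw [this, map_sum, map_sum]
  exact Finset.sum_congr rfl fun i hi => h _ i (Finset.mem_range.1 hi)

theorem rmul_incl_mk_pow (c : K) (a b : ℕ) :
    rmul α n lam r (incl α n lam c) (mk α n lam r (x α n lam ^ a) (x α n lam ^ b)) =
      lmul α n lam r (incl α n lam ((α ^ (twist n r + (a + b))) c))
        (mk α n lam r (x α n lam ^ a) (x α n lam ^ b)) := by
  rw [rmul_mk, lmul_mk, x_pow_mul_incl, ← mk_balance, x_pow_mul_incl, ← AlgHom.mul_apply,
    ← AlgHom.mul_apply, ← pow_add, ← pow_add]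
  congr 5
  omega

variable (α n lam) in
/-- The element `∑ x ^ l ⊗ x ^ (i - 1 - l)`, the value at `x ^ i` of the universal derivation. -/
def derivPow (r i : ℕ) : ASq α n lam r :=
  ∑ l ∈ Finset.range i, mk α n lam r (x α n lam ^ l) (x α n lam ^ (i - l - 1))

theorem derivPow_zero : derivPow α n lam r 0 = 0 := Finset.sum_range_zero _

theorem derivPow_succ (i : ℕ) : derivPow α n lam r (i + 1) =
    lmul α n lam r (x α n lam) (derivPow α n lam r i) + mk α n lam r 1 (x α n lam ^ i) := by
  rw [derivPow, Finset.sum_range_succ', derivPow, map_sum]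
  congr 1
  refine Finset.sum_congr rfl fun l _ => ?_
  rw [lmul_mk, pow_succ', Nat.add_sub_add_right]

theorem lmul_sub_rmul_derivPow (i : ℕ) : lmul α n lam r (x α n lam) (derivPow α n lam r i) -
    rmul α n lam r (x α n lam) (derivPow α n lam r i) =
      mk α n lam r (x α n lam ^ i) 1 - mk α n lam r 1 (x α n lam ^ i) := by
  have h := Finset.sum_range_sub
    (fun l => mk α n lam r (x α n lam ^ l) (x α n lam ^ (i - l))) i
  rw [Nat.sub_self, Nat.sub_zero, pow_zero] at h
  rw [← h, derivPow, map_sum, map_sum, ← Finset.sum_sub_distrib]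
  refine Finset.sum_congr rfl fun l hl => ?_
  have := Finset.mem_range.1 hl
  rw [lmul_mk, rmul_mk, ← pow_succ', ← pow_succ, show i - l - 1 + 1 = i - l by omega,
    show i - (l + 1) = i - l - 1 by omega]

theorem rmul_incl_derivPow (c : K) {i : ℕ} :
    rmul α n lam r (incl α n lam c) (derivPow α n lam r i) =
      lmul α n lam r (incl α n lam ((α ^ (twist n r + (i - 1))) c)) (derivPow α n lam r i) := by
  rw [derivPow, map_sum, map_sum]
  refine Finset.sum_congr rfl fun l hl => ?_
  have := Finset.mem_range.1 hl
  rw [rmul_incl_mk_pow, show l + (i - l - 1) = i - 1 by omega]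

variable (α n lam) in
/-- The value at `1 ⊗ 1` of the boundary of the small resolution from degree `r + 1` to degree `r`:
it is `x ⊗ 1 - 1 ⊗ x` for even `r`, and the value at `f` of the universal derivation for odd `r`. -/
def bdOne (r : ℕ) : ASq α n lam r :=
  if r % 2 = 0 then mk α n lam r (x α n lam) 1 - mk α n lam r 1 (x α n lam)
  else ∑ i ∈ Finset.Icc 1 n, lmul α n lam r (incl α n lam (lam (n - i))) (derivPow α n lam r i)

theorem bdOne_of_even (hr : r % 2 = 0) :
    bdOne α n lam r = mk α n lam r (x α n lam) 1 - mk α n lam r 1 (x α n lam) := if_pos hr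

theorem bdOne_of_odd (hr : r % 2 = 1) : bdOne α n lam r = ∑ i ∈ Finset.Icc 1 n,
    lmul α n lam r (incl α n lam (lam (n - i))) (derivPow α n lam r i) := if_neg (by omega)

theorem lmul_bdOne (H : IsNormalMonic α n lam) (c : K) :
    lmul α n lam r (incl α n lam ((α ^ twist n (r + 1)) c)) (bdOne α n lam r) =
      rmul α n lam r (incl α n lam c) (bdOne α n lam r) := by
  rcases Nat.mod_two_eq_zero_or_one r with hr | hr
  · have h1 := rmul_incl_mk_pow (α := α) (n := n) (lam := lam) (r := r) c 1 0
    have h2 := rmul_incl_mk_pow (α := α) (n := n) (lam := lam) (r := r) c 0 1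
    rw [pow_one, pow_zero] at h1 h2
    rw [bdOne_of_even hr, map_sub, map_sub, h1, h2, twist_succ_of_even hr]
  · rw [bdOne_of_odd hr, map_sum, map_sum]
    refine Finset.sum_congr rfl fun i hi => ?_
    have := Finset.mem_Icc.1 hi
    rw [← lmul_rmul, rmul_incl_derivPow, ← lmul_mul, ← lmul_mul,
      incl_lam_mul_incl H (Nat.sub_le n i), ← AlgHom.mul_apply, ← pow_add]
    congr 6
    have := twist_succ_of_odd (n := n) hr
    omega

/-- The identity `∑ λ_{n - i} (x ^ i ⊗ 1 - 1 ⊗ x ^ i) = 0`, which comes from `f = 0` in `A`. -/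
theorem sum_lmul_lam (H : IsNormalMonic α n lam) :
    ∑ i ∈ Finset.Icc 1 n, lmul α n lam r (incl α n lam (lam (n - i)))
      (mk α n lam r (x α n lam ^ i) 1 - mk α n lam r 1 (x α n lam ^ i)) = 0 := by
  have h : ∀ i ≤ n, ∀ v, mk α n lam r (incl α n lam (lam i)) v =
      mk α n lam r 1 (incl α n lam (lam i) * v) := fun i hi v => by
    rw [← mk_balance, H.pow_map_lam hi, one_mul]
  simp only [map_sub, lmul_mk, mul_one, h _ (Nat.sub_le n _), Finset.sum_sub_distrib]
  have e1 := congrArg (fun t => mkHom α n lam r t 1) (sum_lam_mul_pow (α := α) (n := n) (lam := lam))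
  have e2 := congrArg (fun t => mkHom α n lam r 1 t) (sum_lam_mul_pow (α := α) (n := n) (lam := lam))
  simp only [map_sum, LinearMap.sum_apply, map_neg, LinearMap.neg_apply, mkHom_apply] at e1 e2
  rw [e1, e2, h n le_rfl, mul_one, sub_self]

theorem lmul_x_bdOne (H : IsNormalMonic α n lam) (hr : r % 2 = 1) :
    lmul α n lam r (x α n lam) (bdOne α n lam r) =
      rmul α n lam r (x α n lam) (bdOne α n lam r) := by
  rw [← sub_eq_zero, ← sum_lmul_lam H, bdOne_of_odd hr, map_sum, map_sum,
    ← Finset.sum_sub_distrib]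
  refine Finset.sum_congr rfl fun i _ => ?_
  rw [← lmul_mul, (x_commute_lam H (Nat.sub_le n i)).eq, lmul_mul, ← lmul_rmul, ← map_sub,
    lmul_sub_rmul_derivPow]

theorem lmul_x_pow_bdOne (H : IsNormalMonic α n lam) (hr : r % 2 = 1) (i : ℕ) :
    lmul α n lam r (x α n lam ^ i) (bdOne α n lam r) =
      rmul α n lam r (x α n lam ^ i) (bdOne α n lam r) := by
  induction i with
  | zero => rw [pow_zero, lmul_one, rmul_one]
  | succ i ih =>
    rw [pow_succ, lmul_mul, lmul_x_bdOne H hr, lmul_rmul, ih, ← rmul_mul]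

end ASq

namespace CS

variable {M : Type*} [AddCommGroup M] [Module k M] [Module (MonogenicExt α n lam) M]
  [Module (MonogenicExt α n lam)ᵐᵒᵖ M]
  [SMulCommClass (MonogenicExt α n lam) (MonogenicExt α n lam)ᵐᵒᵖ M]
  [IsScalarTower k (MonogenicExt α n lam) M] [IsScalarTower k (MonogenicExt α n lam)ᵐᵒᵖ M]
  {r : ℕ}

theorem pair_one (y : M) : pair M r y (ASq.mk α n lam r 1 1) = mk α n lam r y := by
  rw [pair_mk, op_one, one_smul, one_smul]

theorem pair_smul (c d : MonogenicExt α n lam) (y : M) (z : ASq α n lam r) :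
    pair M r (c • op d • y) z = pair M r y (ASq.lmul α n lam r d (ASq.rmul α n lam r c z)) :=
  ASq.hom_ext_mk (g := pair M r y ∘ₗ ASq.lmul α n lam r d ∘ₗ ASq.rmul α n lam r c) (fun u v => by
    rw [LinearMap.comp_apply, LinearMap.comp_apply, ASq.rmul_mk, ASq.lmul_mk, pair_mk, pair_mk,
      op_mul, mul_smul, mul_smul, ← smul_comm c (op u)]) z

theorem pair_tmul (u v : MonogenicExt α n lam) (z : ASq α n lam r) :
    pair (InnerSq k (MonogenicExt α n lam)) r (InnerSq.tmul k u v) z =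
      ASq.lmul α n lam r u (ASq.rmul α n lam r v z) :=
  ASq.hom_ext_mk (g := ASq.lmul α n lam r u ∘ₗ ASq.rmul α n lam r v) (fun u' v' => by
    rw [LinearMap.comp_apply, ASq.rmul_mk, ASq.lmul_mk]; rfl) z

variable (M) in
/-- The boundary of the small complex with coefficients in `M`. -/
def d (H : IsNormalMonic α n lam) (r : ℕ) : CS α n lam M (r + 1) →ₗ[k] CS α n lam M r :=
  Submodule.liftQ _ ((pair M r).flip (ASq.bdOne α n lam r)) (by
    rw [twistedCommutators, Submodule.span_le]
    rintro _ ⟨y, c, rfl⟩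
    have h1 := pair_smul 1 (incl α n lam ((α ^ twist n (r + 1)) c)) y (ASq.bdOne α n lam r)
    have h2 := pair_smul (incl α n lam c) 1 y (ASq.bdOne α n lam r)
    rw [one_smul, ASq.rmul_one] at h1
    rw [op_one, one_smul, ASq.lmul_one] at h2
    rw [SetLike.mem_coe, LinearMap.mem_ker, LinearMap.flip_apply, map_sub, LinearMap.sub_apply, h1,
      h2, ASq.lmul_bdOne H, sub_self])

theorem d_mk (H : IsNormalMonic α n lam) (y : M) :
    d M H r (mk α n lam (r + 1) y) = pair M r y (ASq.bdOne α n lam r) := rfl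

end CS

namespace ASq

variable {r : ℕ}

/-- The boundary of the small resolution. -/
def d (H : IsNormalMonic α n lam) (r : ℕ) : ASq α n lam (r + 1) →ₗ[k] ASq α n lam r :=
  CS.d (InnerSq k (MonogenicExt α n lam)) H r

theorem d_mk (H : IsNormalMonic α n lam) (u v : MonogenicExt α n lam) :
    d H r (mk α n lam (r + 1) u v) = lmul α n lam r u (rmul α n lam r v (bdOne α n lam r)) :=
  (CS.d_mk H (InnerSq.tmul k u v)).trans (CS.pair_tmul u v _)

theorem d_lmul (H : IsNormalMonic α n lam) (c : MonogenicExt α n lam)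
    (z : ASq α n lam (r + 1)) : d H r (lmul α n lam (r + 1) c z) = lmul α n lam r c (d H r z) :=
  hom_ext_mk (f := d H r ∘ₗ lmul α n lam (r + 1) c) (g := lmul α n lam r c ∘ₗ d H r)
    (fun u v => by
      rw [LinearMap.comp_apply, LinearMap.comp_apply, lmul_mk, d_mk, d_mk, lmul_mul]) z

theorem d_rmul (H : IsNormalMonic α n lam) (c : MonogenicExt α n lam)
    (z : ASq α n lam (r + 1)) : d H r (rmul α n lam (r + 1) c z) = rmul α n lam r c (d H r z) :=
  hom_ext_mk (f := d H r ∘ₗ rmul α n lam (r + 1) c) (g := rmul α n lam r c ∘ₗ d H r)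
    (fun u v => by
      rw [LinearMap.comp_apply, LinearMap.comp_apply, rmul_mk, d_mk, d_mk, rmul_mul, lmul_rmul])
    z

theorem d_mk_of_even (H : IsNormalMonic α n lam) (hr : r % 2 = 0) (u v : MonogenicExt α n lam) :
    d H r (mk α n lam (r + 1) u v) =
      mk α n lam r (u * x α n lam) v - mk α n lam r u (x α n lam * v) := by
  rw [d_mk, bdOne_of_even hr, map_sub, map_sub, rmul_mk, rmul_mk, lmul_mk, lmul_mk, one_mul,
    mul_one]

theorem d_derivPow (H : IsNormalMonic α n lam) (hr : r % 2 = 0) (i : ℕ) :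
    d H r (derivPow α n lam (r + 1) i) =
      mk α n lam r (x α n lam ^ i) 1 - mk α n lam r 1 (x α n lam ^ i) := by
  rw [← lmul_sub_rmul_derivPow, derivPow, derivPow, map_sum, map_sum, map_sum,
    ← Finset.sum_sub_distrib]
  refine Finset.sum_congr rfl fun l _ => ?_
  rw [d_mk_of_even H hr, lmul_mk, rmul_mk, ← pow_succ, ← pow_succ, ← pow_succ', ← pow_succ']

theorem d_bdOne (H : IsNormalMonic α n lam) : d H r (bdOne α n lam (r + 1)) = 0 := by
  rcases Nat.mod_two_eq_zero_or_one r with hr | hr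
  · rw [bdOne_of_odd (by omega), map_sum, ← sum_lmul_lam H]
    refine Finset.sum_congr rfl fun i _ => ?_
    rw [d_lmul, d_derivPow H hr]
  · rw [bdOne_of_even (by omega), map_sub, d_mk, d_mk, rmul_one, lmul_one, lmul_x_bdOne H hr,
      sub_self]

variable (α n lam) in
/-- The value of the contraction of the small resolution at `1 ⊗ x ^ i`, `i < n`. -/
def contrPow (r i : ℕ) : ASq α n lam (r + 1) :=
  if r % 2 = 0 then derivPow α n lam (r + 1) i
  else if i = n - 1 then mk α n lam (r + 1) 1 1 else 0

theorem contrPow_of_even (hr : r % 2 = 0) (i : ℕ) :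
    contrPow α n lam r i = derivPow α n lam (r + 1) i := if_pos hr

theorem contrPow_of_odd (hr : r % 2 = 1) (i : ℕ) : contrPow α n lam r i =
    if i = n - 1 then mk α n lam (r + 1) 1 1 else 0 := if_neg (by omega)

theorem rmul_contrPow (H : IsNormalMonic α n lam) (c : K) (i : ℕ) :
    rmul α n lam (r + 1) (incl α n lam c) (contrPow α n lam r i) =
      lmul α n lam (r + 1) (incl α n lam ((α ^ twist n r) ((α ^ i) c))) (contrPow α n lam r i) := by
  have := H.two_le
  rw [← AlgHom.mul_apply, ← pow_add]
  rcases Nat.mod_two_eq_zero_or_one r with hr | hr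
  · have ht := twist_succ_of_even (n := n) hr
    rcases Nat.eq_zero_or_pos i with rfl | hi
    · rw [contrPow_of_even hr, derivPow_zero, map_zero, map_zero]
    · have e : twist n (r + 1) + (i - 1) = twist n r + i := by omega
      simp only [contrPow_of_even hr, rmul_incl_derivPow, e]
  · rw [contrPow_of_odd hr]
    split_ifs with hi
    · have h := rmul_incl_mk_pow (α := α) (n := n) (lam := lam) (r := r + 1) c 0 0
      have ht := twist_succ_of_odd (n := n) hr
      have e : twist n (r + 1) = twist n r + i := by omega
      simp only [pow_zero, add_zero, e] at h
      exact h
    · rw [map_zero, map_zero]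

/-- The contraction of the small resolution: the left `A`-linear map with
`1 ⊗ x ^ i ↦ ∑ x ^ l ⊗ x ^ (i - 1 - l)` in even degrees, and `1 ⊗ x ^ (n - 1) ↦ 1 ⊗ 1`, `1 ⊗ x ^ i ↦ 0`
for `i < n - 1`, in odd degrees. -/
def contr (H : IsNormalMonic α n lam) (r : ℕ) : ASq α n lam r →ₗ[k] ASq α n lam (r + 1) :=
  lift (LinearMap.mk₂ k (fun u v => ∑ i ∈ Finset.range n, lmul α n lam (r + 1)
      (u * incl α n lam ((α ^ twist n r) (coord H i v))) (contrPow α n lam r i))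
    (fun u u' v => by
      simp only [add_mul, map_add, LinearMap.add_apply, Finset.sum_add_distrib])
    (fun c u v => by
      simp only [smul_mul_assoc, map_smul, LinearMap.smul_apply, Finset.smul_sum])
    (fun u v v' => by
      simp only [mul_add, map_add, LinearMap.add_apply, Finset.sum_add_distrib])
    (fun c u v => by
      simp only [mul_smul_comm, map_smul, LinearMap.smul_apply, Finset.smul_sum]))
    (fun u c v => by
      simp only [LinearMap.mk₂_apply, coord_incl_mul, map_mul, mul_assoc])

theorem contr_mk (H : IsNormalMonic α n lam) (u v : MonogenicExt α n lam) :
    contr H r (mk α n lam r u v) = ∑ i ∈ Finset.range n, lmul α n lam (r + 1)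
      (u * incl α n lam ((α ^ twist n r) (coord H i v))) (contrPow α n lam r i) := rfl

theorem contr_mk_pow (H : IsNormalMonic α n lam) (u : MonogenicExt α n lam) {i : ℕ} (hi : i < n) :
    contr H r (mk α n lam r u (x α n lam ^ i)) = lmul α n lam (r + 1) u (contrPow α n lam r i) := by
  rw [contr_mk, Finset.sum_eq_single i]
  · rw [coord_x_pow_of_lt H hi hi, if_pos rfl, map_one, map_one, mul_one]
  · intro j hj hji
    rw [coord_x_pow_of_lt H (Finset.mem_range.1 hj) hi, if_neg hji]
    simp
  · intro h; exact absurd (Finset.mem_range.2 hi) h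

theorem contr_lmul (H : IsNormalMonic α n lam) (c : MonogenicExt α n lam) (z : ASq α n lam r) :
    contr H r (lmul α n lam r c z) = lmul α n lam (r + 1) c (contr H r z) :=
  hom_ext_pow H (f := contr H r ∘ₗ lmul α n lam r c) (g := lmul α n lam (r + 1) c ∘ₗ contr H r)
    (fun u i hi => by
      rw [LinearMap.comp_apply, LinearMap.comp_apply, lmul_mk, contr_mk_pow H _ hi,
        contr_mk_pow H _ hi, lmul_mul]) z

theorem contr_rmul (H : IsNormalMonic α n lam) (c : K) (z : ASq α n lam r) :
    contr H r (rmul α n lam r (incl α n lam c) z) =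
      rmul α n lam (r + 1) (incl α n lam c) (contr H r z) :=
  hom_ext_pow H (f := contr H r ∘ₗ rmul α n lam r (incl α n lam c))
    (g := rmul α n lam (r + 1) (incl α n lam c) ∘ₗ contr H r)
    (fun u i hi => by
      rw [LinearMap.comp_apply, LinearMap.comp_apply, rmul_mk, x_pow_mul_incl, ← mk_balance,
        contr_mk_pow H _ hi, contr_mk_pow H _ hi, ← lmul_rmul, rmul_contrPow H, lmul_mul]) z

theorem contr_mk_one (H : IsNormalMonic α n lam) (u : MonogenicExt α n lam) :
    contr H r (mk α n lam r u 1) = 0 := by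
  have := H.two_le
  rw [← pow_zero (x α n lam), contr_mk_pow H u (by omega)]
  rcases Nat.mod_two_eq_zero_or_one r with hr | hr
  · rw [contrPow_of_even hr, derivPow_zero, map_zero]
  · rw [contrPow_of_odd hr, if_neg (by omega), map_zero]

theorem contr_derivPow (H : IsNormalMonic α n lam) (hr : r % 2 = 1) {i : ℕ} (hi : i ≤ n) :
    contr H r (derivPow α n lam r i) = if i = n then mk α n lam (r + 1) 1 1 else 0 := by
  have := H.two_le
  have key : ∀ l ∈ Finset.range i,
      contr H r (mk α n lam r (x α n lam ^ l) (x α n lam ^ (i - l - 1))) =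
        if l = 0 then (if i = n then mk α n lam (r + 1) 1 1 else 0) else 0 := by
    intro l hl
    have := Finset.mem_range.1 hl
    rw [contr_mk_pow H _ (by omega), contrPow_of_odd hr]
    by_cases h0 : l = 0
    · subst h0
      rw [pow_zero, lmul_one, if_pos rfl]
      congr 1
      apply propext
      omega
    · rw [if_neg (by omega), if_neg h0, map_zero]
  rw [derivPow, map_sum, Finset.sum_congr rfl key, Finset.sum_ite_eq']
  split_ifs with h h'
  · rfl
  · rfl
  · exact absurd (Finset.mem_range.2 (by omega)) h
  · rfl

theorem contr_bdOne (H : IsNormalMonic α n lam) :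
    contr H r (bdOne α n lam r) = (-1 : k) ^ (r + 1) • mk α n lam (r + 1) 1 1 := by
  have := H.two_le
  rcases Nat.mod_two_eq_zero_or_one r with hr | hr
  · have h : contr H r (mk α n lam r 1 (x α n lam)) = mk α n lam (r + 1) 1 1 := by
      have := contr_mk_pow (r := r) H 1 (show 1 < n by omega)
      rw [pow_one] at this
      rw [this, contrPow_of_even hr, lmul_one, derivPow, Finset.sum_range_one]
      rfl
    rw [bdOne_of_even hr, map_sub, contr_mk_one, h, Odd.neg_one_pow (Nat.odd_iff.2 (by omega))]
    simp
  · rw [bdOne_of_odd hr, map_sum, Finset.sum_eq_single n]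
    · rw [contr_lmul, contr_derivPow H hr le_rfl, if_pos rfl, Nat.sub_self, H.lam_zero, map_one,
        lmul_one, Even.neg_one_pow (Nat.even_iff.2 (by omega)), one_smul]
    · intro i hi hin
      rw [contr_lmul, contr_derivPow H hr (Finset.mem_Icc.1 hi).2, if_neg hin, map_zero]
    · intro h; exact absurd (Finset.mem_Icc.2 ⟨by omega, le_rfl⟩) h

theorem contr_contr (H : IsNormalMonic α n lam) (z : ASq α n lam r) :
    contr H (r + 1) (contr H r z) = 0 := by
  refine hom_ext_pow H (f := contr H (r + 1) ∘ₗ contr H r) (g := 0) (fun u i hi => ?_) z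
  rw [LinearMap.comp_apply, LinearMap.zero_apply, contr_mk_pow H u hi, contr_lmul]
  rcases Nat.mod_two_eq_zero_or_one r with hr | hr
  · rw [contrPow_of_even hr, contr_derivPow H (by omega) hi.le, if_neg hi.ne, map_zero]
  · rw [contrPow_of_odd hr]
    split_ifs
    · rw [contr_mk_one, map_zero]
    · rw [map_zero, map_zero]

theorem d_contr_zero (H : IsNormalMonic α n lam) (u v : MonogenicExt α n lam) :
    d H 0 (contr H 0 (mk α n lam 0 u v)) = mk α n lam 0 (u * v) 1 - mk α n lam 0 u v := by
  let μ : ASq α n lam 0 →ₗ[k] MonogenicExt α n lam := lift (LinearMap.mul k _) (fun u c v => by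
    rw [LinearMap.mul_apply', LinearMap.mul_apply', mul_assoc, twist, Nat.zero_div, zero_mul]
    rfl)
  refine hom_ext_pow H (f := d H 0 ∘ₗ contr H 0)
    (g := (mkHom α n lam 0).flip 1 ∘ₗ μ - LinearMap.id) (fun u i hi => ?_) (mk α n lam 0 u v)
  rw [LinearMap.comp_apply, contr_mk_pow H u hi, contrPow_of_even rfl, d_lmul, d_derivPow H rfl,
    map_sub, lmul_mk, lmul_mk, mul_one]
  rfl

/-- The relation `f = 0`, as a formula for the coordinates of `x ^ n`. -/
theorem contr_mk_pow_n (H : IsNormalMonic α n lam) (hr : r % 2 = 0) (u : MonogenicExt α n lam) :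
    contr H r (mk α n lam r u (x α n lam ^ n)) =
      lmul α n lam (r + 1) u (derivPow α n lam (r + 1) n - bdOne α n lam (r + 1)) := by
  have hn := H.two_le
  have h : x α n lam ^ n = -∑ i ∈ Finset.range n,
      incl α n lam (lam (n - i)) * x α n lam ^ i := by
    have h := sum_lam_mul_pow (α := α) (n := n) (lam := lam)
    have h' : ∑ i ∈ Finset.range (n + 1), incl α n lam (lam (n - i)) * x α n lam ^ i = 0 := by
      rw [Finset.range_eq_Ico, Finset.sum_eq_sum_Ico_succ_bot (by omega), Nat.sub_zero, pow_zero,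
        mul_one]
      rw [add_comm]
      exact eq_neg_iff_add_eq_zero.1 h
    rw [Finset.sum_range_succ, Nat.sub_self, H.lam_zero, map_one, one_mul] at h'
    exact (neg_eq_of_add_eq_zero_right h').symm
  have h2 : bdOne α n lam (r + 1) = ∑ i ∈ Finset.range n,
      lmul α n lam (r + 1) (incl α n lam (lam (n - i))) (derivPow α n lam (r + 1) i) +
        derivPow α n lam (r + 1) n := by
    have h0 := Finset.sum_range_succ (fun i => lmul α n lam (r + 1) (incl α n lam (lam (n - i)))
      (derivPow α n lam (r + 1) i)) n
    rw [Nat.sub_self, H.lam_zero, map_one, lmul_one] at h0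
    rw [bdOne_of_odd (by omega), ← h0, Finset.range_eq_Ico,
      Finset.sum_eq_sum_Ico_succ_bot (by omega), derivPow_zero, map_zero, zero_add]
    rfl
  have h3 : mk α n lam r u (x α n lam ^ n) = -∑ i ∈ Finset.range n,
      mk α n lam r (u * incl α n lam (lam (n - i))) (x α n lam ^ i) := by
    rw [h, ← mkHom_apply, map_neg, map_sum]
    congr 1
    refine Finset.sum_congr rfl fun i _ => ?_
    rw [mkHom_apply, ← mk_balance, H.pow_map_lam (Nat.sub_le n i)]
  rw [h3, h2, map_neg, map_sum, sub_add_cancel_right, map_neg, map_sum]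
  congr 1
  refine Finset.sum_congr rfl fun i hi => ?_
  rw [contr_mk_pow H _ (Finset.mem_range.1 hi), contrPow_of_even hr, lmul_mul]

theorem d_contr (H : IsNormalMonic α n lam) (z : ASq α n lam (r + 1)) :
    d H (r + 1) (contr H (r + 1) z) = contr H r (d H r z) + (-1 : k) ^ r • z := by
  refine hom_ext_pow H (f := d H (r + 1) ∘ₗ contr H (r + 1))
    (g := contr H r ∘ₗ d H r + (-1 : k) ^ r • LinearMap.id) (fun u i hi => ?_) z
  simp only [LinearMap.comp_apply, LinearMap.add_apply, LinearMap.smul_apply, LinearMap.id_apply]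
  rw [contr_mk_pow H u hi, d_lmul]
  rcases Nat.mod_two_eq_zero_or_one r with hr | hr
  · rw [Even.neg_one_pow (Nat.even_iff.2 hr), one_smul, d_mk_of_even H hr, ← pow_succ', map_sub,
      contr_mk_pow H _ hi, contrPow_of_even hr, contrPow_of_odd (by omega), lmul_mul]
    have hmk : mk α n lam (r + 1) u (x α n lam ^ i) =
        lmul α n lam (r + 1) u (mk α n lam (r + 1) 1 (x α n lam ^ i)) := by rw [lmul_mk, mul_one]
    rcases (show i + 1 ≤ n from hi).lt_or_eq with h | h
    · rw [if_neg (by omega), map_zero, map_zero, contr_mk_pow H u h, contrPow_of_even hr,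
        derivPow_succ, map_add, hmk]
      abel
    · have hd := derivPow_succ (α := α) (n := n) (lam := lam) (r := r + 1) i
      rw [h] at hd
      rw [if_pos (by omega), d_mk, rmul_one, lmul_one, h, contr_mk_pow_n H hr, map_sub, hmk, hd,
        map_add]
      abel
  · rw [Odd.neg_one_pow (Nat.odd_iff.2 hr), contrPow_of_even (by omega),
      d_derivPow H (by omega), map_sub, lmul_mk, lmul_mk, mul_one, d_mk, contr_lmul,
      ← lmul_x_pow_bdOne H hr, contr_lmul, contr_bdOne H,
      Even.neg_one_pow (Nat.even_iff.2 (by omega)), one_smul, lmul_mk, lmul_mk, mul_one]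
    simp [sub_eq_add_neg]

end ASq

namespace CS

variable {M : Type*} [AddCommGroup M] [Module k M] [Module (MonogenicExt α n lam) M]
  [Module (MonogenicExt α n lam)ᵐᵒᵖ M]
  [SMulCommClass (MonogenicExt α n lam) (MonogenicExt α n lam)ᵐᵒᵖ M]
  [IsScalarTower k (MonogenicExt α n lam) M] [IsScalarTower k (MonogenicExt α n lam)ᵐᵒᵖ M]
  {r : ℕ}

theorem d_pair (H : IsNormalMonic α n lam) (y : M) (z : ASq α n lam (r + 1)) :
    d M H r (pair M (r + 1) y z) = pair M r y (ASq.d H r z) :=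
  ASq.hom_ext_mk (f := d M H r ∘ₗ pair M (r + 1) y) (g := pair M r y ∘ₗ ASq.d H r)
    (fun u v => by
      rw [LinearMap.comp_apply, LinearMap.comp_apply, pair_mk, d_mk, pair_smul, ASq.d_mk]) z

theorem d_comp_d (H : IsNormalMonic α n lam) (r : ℕ) : d M H r ∘ₗ d M H (r + 1) = 0 :=
  hom_ext_mk fun y => by
    rw [LinearMap.comp_apply, d_mk, d_pair, ASq.d_bdOne, map_zero, LinearMap.zero_apply]

theorem isSmallBoundary_d (H : IsNormalMonic α n lam) : IsSmallBoundary α n lam (d M H) := by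
  constructor
  · intro m y
    rw [d_mk, ASq.bdOne_of_even (by omega), map_sub, pair_mk, pair_mk, one_smul, op_one, one_smul]
    exact (Submodule.Quotient.mk_sub _).symm
  · intro m y
    refine (d_mk H y).trans ?_
    rw [ASq.bdOne_of_odd (by omega), map_sum]
    refine Finset.sum_congr rfl fun i _ => ?_
    rw [ASq.derivPow, map_sum, map_sum]
    refine Finset.sum_congr rfl fun l _ => ?_
    have h : Commute (incl α n lam (lam (n - i))) (x α n lam ^ l) :=
      ((x_commute_lam H (Nat.sub_le n i)).pow_left l).symm
    rw [ASq.lmul_mk, pair_mk, mul_smul, h.eq, op_mul, mul_smul,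
      smul_comm _ (op (incl α n lam (lam (n - i)))), ← lam_smul_mk H (Nat.sub_le n i)]

end CS

end

noncomputable section

/-! ### Comparison of the two resolutions -/

variable {k K : Type*} [CommRing k] [Ring K] [Algebra k K] {α : K →ₐ[k] K} {n : ℕ} {lam : ℕ → K}

open MonogenicExt

namespace Comparison

section ToHoch

variable (M : Type*) [AddCommGroup M] [Module k M] [Module (MonogenicExt α n lam) M]
  [Module (MonogenicExt α n lam)ᵐᵒᵖ M]
  [SMulCommClass (MonogenicExt α n lam) (MonogenicExt α n lam)ᵐᵒᵖ M]
  [IsScalarTower k (MonogenicExt α n lam) M] [IsScalarTower k (MonogenicExt α n lam)ᵐᵒᵖ M]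
  {r : ℕ}

/-- The map `[y] ↦ y ⊗_{A^e} e` given by an element `e` of the canonical resolution that satisfies
the relation `α^j(c) e = e c` of the generator `1 ⊗ 1` of `A_{α^j} ⊗ A`. -/
def ofElem (e : Bar (incl α n lam) r) (he : ∀ c : K,
    Bar.lmul (incl α n lam) (incl α n lam ((α ^ twist n r) c)) r e =
      Bar.rmul (incl α n lam) (incl α n lam c) r e) : CS α n lam M r →ₗ[k] Hoch (incl α n lam) M r :=
  Submodule.liftQ _ ((Hoch.pair (incl α n lam) M r).flip e) (by
    rw [twistedCommutators, Submodule.span_le]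
    rintro _ ⟨y, c, rfl⟩
    have h1 := Hoch.pair_smul (incl α n lam) 1 (incl α n lam ((α ^ twist n r) c)) y e
    have h2 := Hoch.pair_smul (incl α n lam) (incl α n lam c) 1 y e
    rw [one_smul, Bar.rmul_one] at h1
    rw [op_one, one_smul, Bar.lmul_one] at h2
    rw [SetLike.mem_coe, LinearMap.mem_ker, LinearMap.flip_apply, map_sub, LinearMap.sub_apply, h1,
      h2, he, sub_self])

variable {M} in
theorem ofElem_mk (e : Bar (incl α n lam) r) (he) (y : M) :
    ofElem M e he (CS.mk α n lam r y) = Hoch.pair (incl α n lam) M r y e := rfl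

/-- The bimodule map with `1 ⊗ 1 ↦ e`. -/
def ofElem' (e : Bar (incl α n lam) r) (he : ∀ c : K,
    Bar.lmul (incl α n lam) (incl α n lam ((α ^ twist n r) c)) r e =
      Bar.rmul (incl α n lam) (incl α n lam c) r e) : ASq α n lam r →ₗ[k] Bar (incl α n lam) r :=
  ofElem (InnerSq k (MonogenicExt α n lam)) e he

theorem ofElem'_mk (e : Bar (incl α n lam) r) (he) (u v : MonogenicExt α n lam) :
    ofElem' e he (ASq.mk α n lam r u v) =
      Bar.lmul (incl α n lam) u r (Bar.rmul (incl α n lam) v r e) :=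
  (ofElem_mk e he (InnerSq.tmul k u v)).trans (Hoch.pair_tmul ..)

theorem ofElem'_lmul (e : Bar (incl α n lam) r) (he) (c : MonogenicExt α n lam)
    (z : ASq α n lam r) : ofElem' e he (ASq.lmul α n lam r c z) =
      Bar.lmul (incl α n lam) c r (ofElem' e he z) :=
  ASq.hom_ext_mk (f := ofElem' e he ∘ₗ ASq.lmul α n lam r c)
    (g := Bar.lmul (incl α n lam) c r ∘ₗ ofElem' e he) (fun u v => by
      rw [LinearMap.comp_apply, LinearMap.comp_apply, ASq.lmul_mk, ofElem'_mk, ofElem'_mk,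
        Bar.lmul_mul]) z

theorem ofElem'_rmul (e : Bar (incl α n lam) r) (he) (c : MonogenicExt α n lam)
    (z : ASq α n lam r) : ofElem' e he (ASq.rmul α n lam r c z) =
      Bar.rmul (incl α n lam) c r (ofElem' e he z) :=
  ASq.hom_ext_mk (f := ofElem' e he ∘ₗ ASq.rmul α n lam r c)
    (g := Bar.rmul (incl α n lam) c r ∘ₗ ofElem' e he) (fun u v => by
      rw [LinearMap.comp_apply, LinearMap.comp_apply, ASq.rmul_mk, ofElem'_mk, ofElem'_mk,
        Bar.rmul_mul, Bar.lmul_rmul]) z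

variable {M} in
theorem ofElem_pair (e : Bar (incl α n lam) r) (he) (y : M) (z : ASq α n lam r) :
    ofElem M e he (CS.pair M r y z) = Hoch.pair (incl α n lam) M r y (ofElem' e he z) :=
  ASq.hom_ext_mk (f := ofElem M e he ∘ₗ CS.pair M r y)
    (g := Hoch.pair (incl α n lam) M r y ∘ₗ ofElem' e he) (fun u v => by
      rw [LinearMap.comp_apply, LinearMap.comp_apply, CS.pair_mk, ofElem_mk, Hoch.pair_smul,
        ofElem'_mk]) z

end ToHoch

/-- The values at `1 ⊗ 1` of the comparison map from the small resolution to the canonical one. It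
is built with the contraction `y ↦ y ⊗ 1` of the canonical resolution. -/
def phiAux (H : IsNormalMonic α n lam) : ∀ r, {e : Bar (incl α n lam) r // ∀ c : K,
    Bar.lmul (incl α n lam) (incl α n lam ((α ^ twist n r) c)) r e =
      Bar.rmul (incl α n lam) (incl α n lam c) r e}
  | 0 => ⟨Bar.mk (incl α n lam) 1 (fun p => p.elim0) 1, fun c => by
      have h := Bar.mk_balance_zero (incl α n lam) 1 c (fun p => p.elim0) 1
      rw [one_mul, mul_one] at h
      rw [Bar.lmul_mk, Bar.rmul_mk, mul_one, one_mul, ← h, twist, Nat.zero_div, zero_mul]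
      rfl⟩
  | r + 1 => ⟨(-1 : k) ^ (r + 1) • Bar.appendOne (incl α n lam) r
      (ofElem' (phiAux H r).1 (phiAux H r).2 (ASq.bdOne α n lam r)), fun c => by
        rw [map_smul, map_smul, ← Bar.appendOne_lmul, ← Bar.appendOne_rmul, ← ofElem'_lmul,
          ← ofElem'_rmul, ASq.lmul_bdOne H]⟩

/-- The element `φ'_r(1 ⊗ 1)`. -/
def phiOne (H : IsNormalMonic α n lam) (r : ℕ) : Bar (incl α n lam) r := (phiAux H r).1

/-- The comparison map `φ'` from the small resolution to the canonical one. -/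
def phi' (H : IsNormalMonic α n lam) (r : ℕ) : ASq α n lam r →ₗ[k] Bar (incl α n lam) r :=
  ofElem' (phiOne H r) (phiAux H r).2

section Phi

variable (H : IsNormalMonic α n lam) {r : ℕ}

theorem phiOne_zero : phiOne H 0 = Bar.mk (incl α n lam) 1 (fun p => p.elim0) 1 := rfl

theorem phiOne_succ : phiOne H (r + 1) = (-1 : k) ^ (r + 1) • Bar.appendOne (incl α n lam) r
      (phi' H r (ASq.bdOne α n lam r)) := rfl

theorem phi'_mk (u v : MonogenicExt α n lam) : phi' H r (ASq.mk α n lam r u v) =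
    Bar.lmul (incl α n lam) u r (Bar.rmul (incl α n lam) v r (phiOne H r)) := ofElem'_mk ..

theorem phi'_lmul (c : MonogenicExt α n lam) (z : ASq α n lam r) :
    phi' H r (ASq.lmul α n lam r c z) = Bar.lmul (incl α n lam) c r (phi' H r z) :=
  ofElem'_lmul ..

theorem phi'_rmul (c : MonogenicExt α n lam) (z : ASq α n lam r) :
    phi' H r (ASq.rmul α n lam r c z) = Bar.rmul (incl α n lam) c r (phi' H r z) :=
  ofElem'_rmul ..

theorem b'_phi'_of_phiOne (h : Bar.b' (incl α n lam) r (phiOne H (r + 1)) =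
    phi' H r (ASq.bdOne α n lam r)) (z : ASq α n lam (r + 1)) :
    Bar.b' (incl α n lam) r (phi' H (r + 1) z) = phi' H r (ASq.d H r z) :=
  ASq.hom_ext_mk (f := Bar.b' (incl α n lam) r ∘ₗ phi' H (r + 1)) (g := phi' H r ∘ₗ ASq.d H r)
    (fun u v => by
      rw [LinearMap.comp_apply, LinearMap.comp_apply, phi'_mk, ASq.d_mk, Bar.b'_lmul, Bar.b'_rmul,
        h, phi'_lmul, phi'_rmul]) z

theorem b'_phiOne (r : ℕ) : Bar.b' (incl α n lam) r (phiOne H (r + 1)) =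
    phi' H r (ASq.bdOne α n lam r) := by
  induction r with
  | zero =>
    rw [phiOne_succ, ASq.bdOne_of_even rfl, map_sub, phi'_mk, phi'_mk, phiOne_zero, Bar.rmul_mk,
      Bar.rmul_mk, Bar.lmul_mk, Bar.lmul_mk, map_sub, map_smul, map_sub, Bar.b'_appendOne_zero,
      Bar.b'_appendOne_zero]
    simp
  | succ r ih =>
    rw [phiOne_succ, map_smul, Bar.b'_appendOne, b'_phi'_of_phiOne H ih, ASq.d_bdOne, map_zero,
      map_zero, zero_add, smul_smul, ← pow_add, Even.neg_one_pow ⟨r + 1, by omega⟩, one_smul]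

theorem b'_phi' (z : ASq α n lam (r + 1)) :
    Bar.b' (incl α n lam) r (phi' H (r + 1) z) = phi' H r (ASq.d H r z) :=
  b'_phi'_of_phiOne H (b'_phiOne H r) z

end Phi

/-- The comparison map from the canonical resolution to the small one, built with the contraction of
the latter: `ψ'_{r+1}(y ⊗ 1)` is the value of the contraction at `ψ'_r(y)`. -/
def psiAux (H : IsNormalMonic α n lam) : ∀ r, {g : Bar (incl α n lam) r →ₗ[k] ASq α n lam r //
    (∀ c w, g (Bar.lmul (incl α n lam) c r w) = ASq.lmul α n lam r c (g w)) ∧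
    (∀ c w, g (Bar.rmul (incl α n lam) c r w) = ASq.rmul α n lam r c (g w)) ∧
    ∀ u a, ASq.contr H r (g (Bar.mk (incl α n lam) u a 1)) = 0}
  | 0 => ⟨Bar.liftRight (incl α n lam) (ASq.rmul α n lam 0) ASq.rmul_mul
      (fun u _ => ASq.mk α n lam 0 u 1)
      (fun u u' _ => by
        rw [← ASq.mkHom_apply, map_add]; rfl)
      (fun c u _ => by rw [← ASq.mkHom_apply, map_smul]; rfl)
      (fun _ _ i => i.elim0) (fun _ _ i => i.elim0)
      (fun j c u _ => by
        obtain rfl : j = 0 := Fin.ext (by omega)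
        change ASq.mk α n lam 0 (u * incl α n lam c) 1 =
          ASq.rmul α n lam 0 (incl α n lam c) (ASq.mk α n lam 0 u 1)
        rw [ASq.rmul_mk, one_mul, ← mul_one (incl α n lam c), ← ASq.mk_balance, mul_one, twist,
          Nat.zero_div, zero_mul]
        rfl)
      (fun i => i.elim0),
      fun c => Bar.liftRight_lmul _ _ _ _ _ _ _ _ _ _ c (ASq.lmul α n lam 0 c)
        (ASq.lmul_rmul c) (fun u _ => (ASq.lmul_mk c u 1).symm),
      Bar.liftRight_rmul _ _ _ _ _ _ _ _ _ _,
      fun u a => by rw [Bar.liftRight_mk, ASq.rmul_one, ASq.contr_mk_one]⟩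
  | r + 1 => ⟨Bar.extendAppendOne (incl α n lam) (ASq.rmul α n lam (r + 1)) ASq.rmul_mul
      (ASq.contr H r ∘ₗ (psiAux H r).1)
      (fun c w => by
        rw [LinearMap.comp_apply, LinearMap.comp_apply, (psiAux H r).2.2.1, ASq.contr_rmul])
      (psiAux H r).2.2.2,
      fun c => Bar.liftRight_lmul _ _ _ _ _ _ _ _ _ _ c (ASq.lmul α n lam (r + 1) c)
        (ASq.lmul_rmul c) (fun u a => by
          rw [← Bar.lmul_mk, LinearMap.comp_apply, LinearMap.comp_apply, (psiAux H r).2.1,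
            ASq.contr_lmul]),
      Bar.liftRight_rmul _ _ _ _ _ _ _ _ _ _,
      fun u a => by
        rw [Bar.extendAppendOne_mk, ASq.rmul_one, LinearMap.comp_apply, ASq.contr_contr]⟩

/-- The comparison map `ψ'` from the canonical resolution to the small one. -/
def psi' (H : IsNormalMonic α n lam) (r : ℕ) : Bar (incl α n lam) r →ₗ[k] ASq α n lam r :=
  (psiAux H r).1

section Psi

variable (H : IsNormalMonic α n lam) {r : ℕ}

theorem psi'_lmul (c : MonogenicExt α n lam) (w : Bar (incl α n lam) r) :
    psi' H r (Bar.lmul (incl α n lam) c r w) = ASq.lmul α n lam r c (psi' H r w) :=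
  (psiAux H r).2.1 c w

theorem psi'_rmul (c : MonogenicExt α n lam) (w : Bar (incl α n lam) r) :
    psi' H r (Bar.rmul (incl α n lam) c r w) = ASq.rmul α n lam r c (psi' H r w) :=
  (psiAux H r).2.2.1 c w

theorem psi'_zero_mk (u : MonogenicExt α n lam) (a : Fin 0 → MonogenicExt α n lam)
    (v : MonogenicExt α n lam) : psi' H 0 (Bar.mk (incl α n lam) u a v) = ASq.mk α n lam 0 u v := by
  rw [psi', psiAux, Bar.liftRight_mk]
  rw [ASq.rmul_mk, one_mul]

theorem psi'_succ_mk (u : MonogenicExt α n lam) (a : Fin (r + 1) → MonogenicExt α n lam)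
    (v : MonogenicExt α n lam) : psi' H (r + 1) (Bar.mk (incl α n lam) u a v) =
      ASq.rmul α n lam (r + 1) v (ASq.contr H r
        (psi' H r (Bar.mk (incl α n lam) u (Fin.init a) (a (Fin.last r))))) := by
  rw [psi', psiAux, Bar.extendAppendOne_mk]
  rfl

theorem psi'_appendOne (w : Bar (incl α n lam) r) :
    psi' H (r + 1) (Bar.appendOne (incl α n lam) r w) = ASq.contr H r (psi' H r w) :=
  Bar.hom_ext_mk (incl α n lam) (f := psi' H (r + 1) ∘ₗ Bar.appendOne (incl α n lam) r)
    (g := ASq.contr H r ∘ₗ psi' H r) (fun u a v => by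
      rw [LinearMap.comp_apply, LinearMap.comp_apply, Bar.appendOne_mk, psi'_succ_mk,
        ASq.rmul_one, Fin.init_snoc, Fin.snoc_last]) w

theorem d_psi' (r : ℕ) (w : Bar (incl α n lam) (r + 1)) :
    ASq.d H r (psi' H (r + 1) w) = psi' H r (Bar.b' (incl α n lam) r w) := by
  refine LinearMap.congr_fun (f := ASq.d H r ∘ₗ psi' H (r + 1))
    (g := psi' H r ∘ₗ Bar.b' (incl α n lam) r) ?_ w
  clear w
  induction r with
  | zero =>
    refine Bar.ext_appendOne _ (fun v => ASq.rmul α n lam 0 v)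
      (fun v w => by simp only [LinearMap.comp_apply, psi'_rmul, ASq.d_rmul])
      (fun v w => by simp only [LinearMap.comp_apply, psi'_rmul, Bar.b'_rmul])
      (fun w => Bar.hom_ext_mk _ (f := (ASq.d H 0 ∘ₗ psi' H 1) ∘ₗ Bar.appendOne (incl α n lam) 0)
        (g := (psi' H 0 ∘ₗ Bar.b' (incl α n lam) 0) ∘ₗ Bar.appendOne (incl α n lam) 0)
        (fun u a v => ?_) w)
    simp only [LinearMap.comp_apply]
    rw [psi'_appendOne, psi'_zero_mk, ASq.d_contr_zero, Bar.b'_appendOne_zero, map_sub,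
      psi'_zero_mk, psi'_zero_mk]
  | succ r ih =>
    refine Bar.ext_appendOne _ (fun v => ASq.rmul α n lam (r + 1) v)
      (fun v w => by simp only [LinearMap.comp_apply, psi'_rmul, ASq.d_rmul])
      (fun v w => by simp only [LinearMap.comp_apply, psi'_rmul, Bar.b'_rmul]) (fun w => ?_)
    have h := LinearMap.congr_fun ih w
    rw [LinearMap.comp_apply, LinearMap.comp_apply] at h ⊢
    rw [psi'_appendOne, ASq.d_contr, h, Bar.b'_appendOne, map_add, psi'_appendOne, map_smul]

theorem psi'_phi' (z : ASq α n lam r) : psi' H r (phi' H r z) = z := by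
  have key : ∀ r, psi' H r (phiOne H r) = ASq.mk α n lam r 1 1 →
      ∀ z, psi' H r (phi' H r z) = z := fun r h z =>
    ASq.hom_ext_mk (f := psi' H r ∘ₗ phi' H r) (g := LinearMap.id) (fun u v => by
      rw [LinearMap.comp_apply, phi'_mk, psi'_lmul, psi'_rmul, h, ASq.rmul_mk, ASq.lmul_mk,
        one_mul, mul_one, LinearMap.id_apply]) z
  refine key r ?_ z
  clear z
  induction r with
  | zero => rw [phiOne_zero, psi'_zero_mk]
  | succ r ih =>
    rw [phiOne_succ, map_smul, psi'_appendOne, key r ih, ASq.contr_bdOne, smul_smul, ← pow_add,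
      Even.neg_one_pow ⟨r + 1, by omega⟩, one_smul]

theorem phi'_psi'_zero (w : Bar (incl α n lam) 0) : phi' H 0 (psi' H 0 w) = w :=
  Bar.hom_ext_mk _ (f := phi' H 0 ∘ₗ psi' H 0) (g := LinearMap.id) (fun u a v => by
    rw [LinearMap.comp_apply, psi'_zero_mk, phi'_mk, phiOne_zero, Bar.rmul_mk, Bar.lmul_mk,
      mul_one, one_mul, Subsingleton.elim a, LinearMap.id_apply]) w

end Psi

/-! ### The homotopy on the canonical resolution -/

/-- The homotopy from `φ' ψ'` to the identity, given by its recursion. -/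
def omegaAux (H : IsNormalMonic α n lam) : ∀ r,
    {g : Bar (incl α n lam) r →ₗ[k] Bar (incl α n lam) (r + 1) //
    (∀ c w, g (Bar.lmul (incl α n lam) c r w) = Bar.lmul (incl α n lam) c (r + 1) (g w)) ∧
    ∀ c w, g (Bar.rmul (incl α n lam) c r w) = Bar.rmul (incl α n lam) c (r + 1) (g w)}
  | 0 => ⟨0, fun c w => by simp, fun c w => by simp⟩
  | r + 1 => ⟨Bar.extendRight (incl α n lam) (Bar.rmulHom (incl α n lam) (r + 2))
      (Bar.rmulHom_mul (incl α n lam)) ((-1 : k) ^ (r + 2) • Bar.appendOne (incl α n lam) (r + 1) ∘ₗ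
        (phi' H (r + 1) ∘ₗ psi' H (r + 1) - LinearMap.id -
          (omegaAux H r).1 ∘ₗ Bar.b' (incl α n lam) r))
      (fun c w => by
        simp only [LinearMap.smul_apply, LinearMap.comp_apply, LinearMap.sub_apply,
          LinearMap.id_apply, psi'_rmul, phi'_rmul, Bar.b'_rmul, (omegaAux H r).2.2, ← map_sub,
          Bar.appendOne_rmul, Bar.rmulHom_apply, map_smul]),
      fun c => Bar.liftRight_lmul _ _ _ _ _ _ _ _ _ _ c (Bar.lmul (incl α n lam) c (r + 2))
        (Bar.lmul_rmul (incl α n lam) c) (fun u a => by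
          rw [← Bar.lmul_mk]
          simp only [LinearMap.smul_apply, LinearMap.comp_apply, LinearMap.sub_apply,
            LinearMap.id_apply, psi'_lmul, phi'_lmul, Bar.b'_lmul, (omegaAux H r).2.1, ← map_sub,
            Bar.appendOne_lmul, map_smul]),
      Bar.liftRight_rmul _ _ _ _ _ _ _ _ _ _⟩

/-- The homotopy `ω'` on the canonical resolution. -/
def omega' (H : IsNormalMonic α n lam) (r : ℕ) :
    Bar (incl α n lam) r →ₗ[k] Bar (incl α n lam) (r + 1) := (omegaAux H r).1

section Omega

variable (H : IsNormalMonic α n lam) {r : ℕ}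

theorem omega'_lmul (c : MonogenicExt α n lam) (w : Bar (incl α n lam) r) :
    omega' H r (Bar.lmul (incl α n lam) c r w) = Bar.lmul (incl α n lam) c (r + 1) (omega' H r w) :=
  (omegaAux H r).2.1 c w

theorem omega'_rmul (c : MonogenicExt α n lam) (w : Bar (incl α n lam) r) :
    omega' H r (Bar.rmul (incl α n lam) c r w) = Bar.rmul (incl α n lam) c (r + 1) (omega' H r w) :=
  (omegaAux H r).2.2 c w

theorem omega'_succ_mk (u : MonogenicExt α n lam) (a : Fin (r + 1) → MonogenicExt α n lam) :
    omega' H (r + 1) (Bar.mk (incl α n lam) u a 1) = (-1 : k) ^ (r + 2) •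
      Bar.appendOne (incl α n lam) (r + 1)
        (phi' H (r + 1) (psi' H (r + 1) (Bar.mk (incl α n lam) u a 1)) -
          Bar.mk (incl α n lam) u a 1 -
          omega' H r (Bar.b' (incl α n lam) r (Bar.mk (incl α n lam) u a 1))) := by
  rw [omega', omegaAux, Bar.extendRight_mk, Bar.rmulHom_apply, Bar.rmul_one]; rfl

theorem phi'_psi'_sub (r : ℕ) (w : Bar (incl α n lam) (r + 1)) :
    phi' H (r + 1) (psi' H (r + 1) w) - w =
      Bar.b' (incl α n lam) (r + 1) (omega' H (r + 1) w) +
        omega' H r (Bar.b' (incl α n lam) r w) := by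
  have hneg : ∀ r : ℕ, (-1 : k) ^ (r + 2) * (-1 : k) ^ r = 1 := fun r => by
    rw [← pow_add, Even.neg_one_pow ⟨r + 1, by omega⟩]
  -- by induction, the map whose composition with `y ↦ y ⊗ 1` defines `ω'` has values in cycles
  have key : ∀ r, (∀ w, Bar.b' (incl α n lam) r (phi' H (r + 1) (psi' H (r + 1) w) - w -
      omega' H r (Bar.b' (incl α n lam) r w)) = 0) → ∀ w, phi' H (r + 1) (psi' H (r + 1) w) - w =
      Bar.b' (incl α n lam) (r + 1) (omega' H (r + 1) w) +
        omega' H r (Bar.b' (incl α n lam) r w) := by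
    intro r h w
    rw [← sub_eq_iff_eq_add]
    let S := phi' H (r + 1) ∘ₗ psi' H (r + 1) - LinearMap.id -
      omega' H r ∘ₗ Bar.b' (incl α n lam) r
    refine LinearMap.congr_fun (f := S)
      (g := Bar.b' (incl α n lam) (r + 1) ∘ₗ omega' H (r + 1)) ?_ w
    refine EnvTensor.bar_hom_ext _ fun u a v => ?_
    have hv : Bar.mk (incl α n lam) u a v =
        Bar.rmul (incl α n lam) v (r + 1) (Bar.mk (incl α n lam) u a 1) := by
      rw [Bar.rmul_mk, one_mul]
    have hS : S (Bar.mk (incl α n lam) u a v) =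
        Bar.rmul (incl α n lam) v (r + 1) (S (Bar.mk (incl α n lam) u a 1)) := by
      rw [hv]
      simp only [S, LinearMap.sub_apply, LinearMap.comp_apply, LinearMap.id_apply, psi'_rmul,
        phi'_rmul, Bar.b'_rmul, omega'_rmul, map_sub]
    rw [hS, LinearMap.comp_apply, hv, omega'_rmul, Bar.b'_rmul, omega'_succ_mk, map_smul,
      Bar.b'_appendOne, h, map_zero, zero_add, smul_smul, hneg, one_smul]
    rfl
  refine key r ?_ w
  clear w
  induction r with
  | zero =>
    intro w
    have h0 : omega' H 0 = 0 := rfl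
    rw [map_sub, map_sub, b'_phi', d_psi', phi'_psi'_zero, h0, LinearMap.zero_apply, map_zero,
      sub_self, sub_self]
  | succ r ih =>
    intro w
    have h := key r ih (Bar.b' (incl α n lam) (r + 1) w)
    rw [Bar.b'_b', map_zero, add_zero] at h
    rw [map_sub, map_sub, b'_phi', d_psi', ← h, sub_self]

theorem isOmega'_omega' : IsOmega' α n lam (phi' H) (psi' H) (omega' H) :=
  ⟨fun _ => omega'_lmul H, fun _ => omega'_rmul H, rfl, fun r u a y hy => by
    rw [hy, omega'_succ_mk]⟩

end Omega

end Comparison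

end

noncomputable section

/-! ### Homology of homotopy equivalent complexes -/

section HomotopyEquivalence

variable {k : Type*} [CommRing k] {X Y : ℕ → Type*} [∀ r, AddCommGroup (X r)]
  [∀ r, Module k (X r)] [∀ r, AddCommGroup (Y r)] [∀ r, Module k (Y r)]
  {d : ∀ r, X (r + 1) →ₗ[k] X r} {e : ∀ r, Y (r + 1) →ₗ[k] Y r}

theorem map_mem_complexCycles {f : ∀ r, X r →ₗ[k] Y r} (hf : ∀ r, e r ∘ₗ f (r + 1) = f r ∘ₗ d r)
    (r : ℕ) {z : X r} (hz : z ∈ complexCycles d r) : f r z ∈ complexCycles e r := by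
  cases r with
  | zero => trivial
  | succ r =>
    have h := LinearMap.congr_fun (hf r) z
    rw [LinearMap.comp_apply, LinearMap.comp_apply, LinearMap.mem_ker.1 hz, map_zero] at h
    exact h

/-- The map induced on homology by a chain map. -/
def complexHomologyMap (f : ∀ r, X r →ₗ[k] Y r) (hf : ∀ r, e r ∘ₗ f (r + 1) = f r ∘ₗ d r)
    (r : ℕ) : complexHomology d r →ₗ[k] complexHomology e r :=
  Submodule.mapQ _ _ ((f r).restrict fun _ => map_mem_complexCycles hf r) (by
    rintro z ⟨w, hw⟩
    exact ⟨f (r + 1) w, (LinearMap.congr_fun (hf r) w).trans (congrArg (f r) hw)⟩)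

/-- A deformation retraction of complexes induces isomorphisms in homology. -/
theorem nonempty_complexHomology_equiv (f : ∀ r, X r →ₗ[k] Y r) (g : ∀ r, Y r →ₗ[k] X r)
    (h : ∀ r, Y r →ₗ[k] Y (r + 1)) (hf : ∀ r, e r ∘ₗ f (r + 1) = f r ∘ₗ d r)
    (hg : ∀ r, d r ∘ₗ g (r + 1) = g r ∘ₗ e r) (hgf : ∀ r, g r ∘ₗ f r = LinearMap.id)
    (h0 : f 0 ∘ₗ g 0 - LinearMap.id = e 0 ∘ₗ h 0)
    (hs : ∀ r, f (r + 1) ∘ₗ g (r + 1) - LinearMap.id = e (r + 1) ∘ₗ h (r + 1) + h r ∘ₗ e r)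
    (r : ℕ) : Nonempty (complexHomology d r ≃ₗ[k] complexHomology e r) := by
  have hfg : ∀ z ∈ complexCycles e r, f r (g r z) - z ∈ LinearMap.range (e r) := by
    intro z hz
    cases r with
    | zero => exact ⟨h 0 z, (LinearMap.congr_fun h0 z).symm⟩
    | succ r =>
      refine ⟨h (r + 1) z, ?_⟩
      have := LinearMap.congr_fun (hs r) z
      rw [LinearMap.add_apply, LinearMap.comp_apply (h r), LinearMap.mem_ker.1 hz, map_zero,
        add_zero] at this
      exact this.symm
  refine ⟨LinearEquiv.ofLinearMap (complexHomologyMap f hf r) (complexHomologyMap g hg r) ?_ ?_⟩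
  · refine Submodule.linearMap_qext _ (LinearMap.ext fun z => ?_)
    exact (Submodule.Quotient.eq _).2 (hfg z z.2)
  · refine Submodule.linearMap_qext _ (LinearMap.ext fun z => ?_)
    exact congrArg Submodule.Quotient.mk (Subtype.ext (LinearMap.congr_fun (hgf r) z.1))

end HomotopyEquivalence

/-! ### Comparison of the complexes with coefficients -/

variable {k K : Type*} [CommRing k] [Ring K] [Algebra k K] {α : K →ₐ[k] K} {n : ℕ} {lam : ℕ → K}

open MonogenicExt

namespace Comparison

section Coefficients

variable (M : Type*) [AddCommGroup M] [Module k M] [Module (MonogenicExt α n lam) M]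
  [Module (MonogenicExt α n lam)ᵐᵒᵖ M]
  [SMulCommClass (MonogenicExt α n lam) (MonogenicExt α n lam)ᵐᵒᵖ M]
  [IsScalarTower k (MonogenicExt α n lam) M] [IsScalarTower k (MonogenicExt α n lam)ᵐᵒᵖ M]
  (H : IsNormalMonic α n lam)

/-- The map `φ = M ⊗_{A^e} φ'`. -/
def phi (r : ℕ) : CS α n lam M r →ₗ[k] Hoch (incl α n lam) M r :=
  ofElem M (phiOne H r) (phiAux H r).2

/-- The map `ψ = M ⊗_{A^e} ψ'`. -/
def psi (r : ℕ) : Hoch (incl α n lam) M r →ₗ[k] CS α n lam M r :=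
  Hoch.liftPair (incl α n lam) ((CS.pair M r).compl₂ (psi' H r)) fun c d y w => by
    rw [LinearMap.compl₂_apply, LinearMap.compl₂_apply, CS.pair_smul, psi'_lmul, psi'_rmul]

/-- The homotopy `ω = M ⊗_{A^e} ω'`. -/
def omega (r : ℕ) : Hoch (incl α n lam) M r →ₗ[k] Hoch (incl α n lam) M (r + 1) :=
  Hoch.liftPair (incl α n lam) ((Hoch.pair (incl α n lam) M (r + 1)).compl₂ (omega' H r))
    fun c d y w => by
      rw [LinearMap.compl₂_apply, LinearMap.compl₂_apply, Hoch.pair_smul, omega'_lmul, omega'_rmul]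

variable {M} {r : ℕ}

theorem phi_mk (y : M) :
    phi M H r (CS.mk α n lam r y) = Hoch.pair (incl α n lam) M r y (phiOne H r) := rfl

theorem phi_pair (y : M) (z : ASq α n lam r) :
    phi M H r (CS.pair M r y z) = Hoch.pair (incl α n lam) M r y (phi' H r z) := ofElem_pair ..

theorem psi_pair (y : M) (w : Bar (incl α n lam) r) :
    psi M H r (Hoch.pair (incl α n lam) M r y w) = CS.pair M r y (psi' H r w) :=
  Hoch.liftPair_pair ..

theorem omega_pair (y : M) (w : Bar (incl α n lam) r) :
    omega M H r (Hoch.pair (incl α n lam) M r y w) =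
      Hoch.pair (incl α n lam) M (r + 1) y (omega' H r w) :=
  Hoch.liftPair_pair ..

variable (M r)

theorem b_comp_b : Hoch.b (incl α n lam) M r ∘ₗ Hoch.b (incl α n lam) M (r + 1) = 0 :=
  Hoch.hom_ext_pair _ fun y w => by
    rw [LinearMap.comp_apply, Hoch.b_pair, Hoch.b_pair, Bar.b'_b', map_zero, LinearMap.zero_apply]

theorem b_comp_phi : Hoch.b (incl α n lam) M r ∘ₗ phi M H (r + 1) = phi M H r ∘ₗ CS.d M H r :=
  CS.hom_ext_mk fun y => by
    rw [LinearMap.comp_apply, LinearMap.comp_apply, ← CS.pair_one, CS.d_pair, phi_pair, phi_pair,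
      Hoch.b_pair, b'_phi']

theorem d_comp_psi : CS.d M H r ∘ₗ psi M H (r + 1) = psi M H r ∘ₗ Hoch.b (incl α n lam) M r :=
  Hoch.hom_ext_pair _ fun y w => by
    rw [LinearMap.comp_apply, LinearMap.comp_apply, Hoch.b_pair, psi_pair, psi_pair, CS.d_pair,
      d_psi']

theorem psi_comp_phi : psi M H r ∘ₗ phi M H r = LinearMap.id :=
  CS.hom_ext_mk fun y => by
    rw [LinearMap.comp_apply, ← CS.pair_one, phi_pair, psi_pair, psi'_phi', LinearMap.id_apply]

theorem phi_comp_psi_zero : phi M H 0 ∘ₗ psi M H 0 - LinearMap.id =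
    Hoch.b (incl α n lam) M 0 ∘ₗ omega M H 0 :=
  Hoch.hom_ext_pair _ fun y w => by
    have h : omega' H 0 = 0 := rfl
    rw [LinearMap.sub_apply, LinearMap.comp_apply, LinearMap.comp_apply, psi_pair, phi_pair,
      phi'_psi'_zero, omega_pair, h, LinearMap.zero_apply, map_zero, map_zero, LinearMap.id_apply,
      sub_self]

theorem phi_comp_psi_succ : phi M H (r + 1) ∘ₗ psi M H (r + 1) - LinearMap.id =
    Hoch.b (incl α n lam) M (r + 1) ∘ₗ omega M H (r + 1) +
      omega M H r ∘ₗ Hoch.b (incl α n lam) M r :=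
  Hoch.hom_ext_pair _ fun y w => by
    rw [LinearMap.sub_apply, LinearMap.add_apply, LinearMap.comp_apply, LinearMap.comp_apply,
      LinearMap.comp_apply, psi_pair, phi_pair, omega_pair, Hoch.b_pair, Hoch.b_pair, omega_pair,
      LinearMap.id_apply, ← map_sub, ← map_add, phi'_psi'_sub]

end Coefficients

end Comparison

end

noncomputable section

/-! ### Closed formulas for the comparison maps -/

variable {k K : Type*} [CommRing k] [Ring K] [Algebra k K] {α : K →ₐ[k] K} {n : ℕ} {lam : ℕ → K}

open MonogenicExt

namespace MonogenicExt

theorem sum_piFinset_cons {N : Type*} [AddCommMonoid N] {m : ℕ} (s : Fin (m + 1) → Finset ℕ)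
    (f : (Fin (m + 1) → ℕ) → N) : ∑ i ∈ Fintype.piFinset s, f i =
      ∑ a ∈ s 0, ∑ i ∈ Fintype.piFinset (Fin.tail s), f (Fin.cons a i) := by
  rw [← Finset.sum_product']
  refine Finset.sum_nbij' (fun i => (i 0, Fin.tail i)) (fun p => Fin.cons p.1 p.2) ?_ ?_ ?_ ?_ ?_
  · intro i hi
    rw [Fintype.mem_piFinset] at hi
    exact Finset.mem_product.2 ⟨hi 0, Fintype.mem_piFinset.2 fun j => hi j.succ⟩
  · rintro ⟨a, i⟩ h
    rw [Finset.mem_product, Fintype.mem_piFinset] at h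
    exact Fintype.mem_piFinset.2 fun j => Fin.cases h.1 h.2 j
  · intro i _
    exact Fin.cons_self_tail i
  · rintro ⟨a, i⟩ _
    rfl
  · intro i _
    exact congrArg f (Fin.cons_self_tail i).symm

theorem sum_indexI_succ {N : Type*} [AddCommMonoid N] {m : ℕ} (f : (Fin (m + 1) → ℕ) → N) :
    ∑ i ∈ indexI n (m + 1), f i = ∑ a ∈ Finset.Icc 1 n, ∑ i ∈ indexI n m, f (Fin.cons a i) :=
  sum_piFinset_cons _ f

theorem sum_indexJ_cons {N : Type*} [AddCommMonoid N] {m : ℕ} (a : ℕ) (i : Fin m → ℕ)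
    (f : (Fin (m + 1) → ℕ) → N) : ∑ l ∈ indexJ (Fin.cons a i : Fin (m + 1) → ℕ), f l =
      ∑ b ∈ Finset.Ico 1 a, ∑ l ∈ indexJ i, f (Fin.cons b l) :=
  sum_piFinset_cons _ f

theorem lamProd_cons {m : ℕ} (a : ℕ) (i : Fin m → ℕ) :
    lamProd α n lam (Fin.cons a i : Fin (m + 1) → ℕ) =
      incl α n lam (lam (n - a)) * lamProd α n lam i := by
  rw [lamProd, List.ofFn_succ, List.prod_cons]
  rfl

theorem lamProd_eq_incl {m : ℕ} (i : Fin m → ℕ) : lamProd α n lam i =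
    incl α n lam (List.ofFn fun j => lam (n - i j)).prod := by
  rw [lamProd, map_list_prod, List.map_ofFn]
  rfl

theorem x_commute_lamProd (H : IsNormalMonic α n lam) {m : ℕ} (i : Fin m → ℕ) :
    Commute (x α n lam) (lamProd α n lam i) := by
  refine Commute.list_prod_right _ _ fun c hc => ?_
  obtain ⟨j, rfl⟩ := (List.mem_ofFn' _ _).1 hc
  exact x_commute_lam H (Nat.sub_le n _)

/-- The subtraction of `m` in the definition of `expo` is exact, as `ℓ_j < i_j` for all `j`. -/
theorem expo_cons {m a b : ℕ} (hb : b < a) {i l : Fin m → ℕ} (hl : l ∈ indexJ i) :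
    expo (Fin.cons a i : Fin (m + 1) → ℕ) (Fin.cons b l) = a - b - 1 + expo i l := by
  have h : m ≤ ∑ j, (i j - l j) := by
    have : ∑ _j : Fin m, 1 ≤ ∑ j, (i j - l j) := Finset.sum_le_sum fun j _ => by
      have := Finset.mem_Ico.1 (Fintype.mem_piFinset.1 hl j)
      omega
    simpa using this
  rw [expo, expo, Fin.sum_univ_succ]
  simp only [Fin.cons_zero, Fin.cons_succ]
  omega

theorem tildeWord_two_mul {m : ℕ} (l : Fin m → ℕ) (q : ℕ) :
    tildeWord α n lam l (2 * q) = x α n lam := if_pos (by omega)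

theorem snoc_tildeWord {m : ℕ} (l : Fin m → ℕ) :
    Fin.snoc (α := fun _ => MonogenicExt α n lam) (fun p : Fin (2 * m) => tildeWord α n lam l p)
      (x α n lam) = fun p : Fin (2 * m + 1) => tildeWord α n lam l p := by
  funext p
  induction p using Fin.lastCases with
  | last => rw [Fin.snoc_last, Fin.val_last, tildeWord_two_mul]
  | cast p => rw [Fin.snoc_castSucc, Fin.val_castSucc]

theorem snoc_tildeWord_cons {m : ℕ} (b : ℕ) (l : Fin m → ℕ) :
    Fin.snoc (α := fun _ => MonogenicExt α n lam)
      (fun p : Fin (2 * m + 1) => tildeWord α n lam l p) (x α n lam ^ b) =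
      fun p : Fin (2 * m + 2) => tildeWord α n lam (Fin.cons b l : Fin (m + 1) → ℕ) p := by
  funext p
  induction p using Fin.lastCases with
  | last =>
    have h : (2 * m + 1) / 2 = m := by omega
    rw [Fin.snoc_last, Fin.val_last, tildeWord, if_neg (by omega), dif_pos (by omega)]
    congr 1
    have e : Fin.rev ⟨(2 * m + 1) / 2, by omega⟩ = (0 : Fin (m + 1)) :=
      Fin.ext (by rw [Fin.val_rev, Fin.val_zero]; dsimp only; omega)
    rw [e, Fin.cons_zero]
  | cast p =>
    rw [Fin.snoc_castSucc, Fin.val_castSucc, tildeWord, tildeWord]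
    split_ifs with h1 h2 h3 h4
    · rfl
    · have e : Fin.rev (⟨(p : ℕ) / 2, h3⟩ : Fin (m + 1)) = (Fin.rev ⟨(p : ℕ) / 2, h2⟩).succ :=
        Fin.ext (by rw [Fin.val_rev, Fin.val_succ, Fin.val_rev]; dsimp only; omega)
      rw [e, Fin.cons_succ]
    all_goals omega

theorem xbarProd_succ (m : ℕ) (i : ℕ → ℕ) : xbarProd α n lam (m + 1) i =
    xbarProd α n lam m i * xbar α n lam (i (2 * m) + i (2 * m + 1)) := by
  rw [xbarProd, List.range_succ, List.map_append, List.prod_append]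
  simp [xbarProd]

end MonogenicExt

namespace Comparison

variable (H : IsNormalMonic α n lam)

theorem phiOne_odd_of_even (m : ℕ) (h : phiOne H (2 * m) =
    ∑ i ∈ indexI n m, ∑ l ∈ indexJ i, Bar.mk (incl α n lam)
      (lamProd α n lam i * x α n lam ^ expo i l) (fun p : Fin (2 * m) => tildeWord α n lam l p) 1) :
    phiOne H (2 * m + 1) = ∑ i ∈ indexI n m, ∑ l ∈ indexJ i, Bar.mk (incl α n lam)
      (lamProd α n lam i * x α n lam ^ expo i l)
      (fun p : Fin (2 * m + 1) => tildeWord α n lam l p) 1 := by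
  rw [phiOne_succ, ASq.bdOne_of_even (by omega), map_sub, phi'_mk, phi'_mk, Bar.lmul_one,
    Bar.rmul_one, map_sub, Bar.appendOne_lmul, Odd.neg_one_pow ⟨m, rfl⟩, h]
  simp only [map_sum, Bar.appendOne_mk_one, Finset.sum_const_zero, map_zero, zero_sub, neg_smul,
    one_smul, neg_neg]
  simp only [Bar.rmul_mk, one_mul, Bar.appendOne_mk, snoc_tildeWord]

theorem phiOne_even_of_odd (m : ℕ) (h : phiOne H (2 * m + 1) =
    ∑ i ∈ indexI n m, ∑ l ∈ indexJ i, Bar.mk (incl α n lam)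
      (lamProd α n lam i * x α n lam ^ expo i l)
      (fun p : Fin (2 * m + 1) => tildeWord α n lam l p) 1) :
    phiOne H (2 * m + 2) = ∑ i ∈ indexI n (m + 1), ∑ l ∈ indexJ i, Bar.mk (incl α n lam)
      (lamProd α n lam i * x α n lam ^ expo i l)
      (fun p : Fin (2 * m + 2) => tildeWord α n lam l p) 1 := by
  rw [phiOne_succ, ASq.bdOne_of_odd (by omega), Even.neg_one_pow ⟨m + 1, by omega⟩, one_smul,
    sum_indexI_succ, map_sum, map_sum]
  refine Finset.sum_congr rfl fun a ha => ?_
  have ha1 := (Finset.mem_Icc.1 ha).1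
  simp only [sum_indexJ_cons]
  rw [Finset.sum_comm, ASq.derivPow, ← Finset.sum_range_reflect, map_sum, map_sum, map_sum,
    Finset.range_eq_Ico, Finset.sum_eq_sum_Ico_succ_bot (by omega)]
  have key : ∀ b ∈ Finset.Ico 0 a, Bar.appendOne (incl α n lam) (2 * m + 1)
      (phi' H (2 * m + 1) (ASq.lmul α n lam (2 * m + 1) (incl α n lam (lam (n - a)))
        (ASq.mk α n lam (2 * m + 1) (x α n lam ^ (a - 1 - b))
          (x α n lam ^ (a - (a - 1 - b) - 1))))) =
      ∑ i ∈ indexI n m, ∑ l ∈ indexJ i, Bar.appendOne (incl α n lam) (2 * m + 1)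
        (Bar.mk (incl α n lam) (incl α n lam (lam (n - a)) * x α n lam ^ (a - 1 - b) *
          (lamProd α n lam i * x α n lam ^ expo i l))
          (fun p : Fin (2 * m + 1) => tildeWord α n lam l p) (x α n lam ^ b)) := by
    intro b hb
    have hb := (Finset.mem_Ico.1 hb).2
    rw [ASq.lmul_mk, phi'_mk, h, show a - (a - 1 - b) - 1 = b by omega]
    simp only [map_sum, Bar.rmul_mk, Bar.lmul_mk, one_mul]
  -- the term with last letter `x ^ 0` vanishes in the normalized resolution
  rw [key 0 (Finset.mem_Ico.2 ⟨le_rfl, ha1⟩)]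
  simp only [pow_zero, Bar.appendOne_mk_one, Finset.sum_const_zero, zero_add]
  refine Finset.sum_congr rfl fun b hb => ?_
  have hb := Finset.mem_Ico.1 hb
  rw [key b (Finset.mem_Ico.2 ⟨by omega, hb.2⟩)]
  refine Finset.sum_congr rfl fun i _ => Finset.sum_congr rfl fun l hl => ?_
  rw [Bar.appendOne_mk, snoc_tildeWord_cons, lamProd_cons, expo_cons hb.2 hl, pow_add, mul_assoc,
    mul_assoc, ← mul_assoc (x α n lam ^ _), ((x_commute_lamProd H i).pow_left _).eq, mul_assoc,
    Nat.sub_right_comm]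

theorem phiOne_even_odd (m : ℕ) :
    phiOne H (2 * m) = (∑ i ∈ indexI n m, ∑ l ∈ indexJ i, Bar.mk (incl α n lam)
      (lamProd α n lam i * x α n lam ^ expo i l)
      (fun p : Fin (2 * m) => tildeWord α n lam l p) 1) ∧
    phiOne H (2 * m + 1) = ∑ i ∈ indexI n m, ∑ l ∈ indexJ i, Bar.mk (incl α n lam)
      (lamProd α n lam i * x α n lam ^ expo i l)
      (fun p : Fin (2 * m + 1) => tildeWord α n lam l p) 1 := by
  induction m with
  | zero =>
    refine and_iff_left_of_imp (phiOne_odd_of_even H 0) |>.2 ?_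
    rw [indexI, Fintype.piFinset_of_isEmpty, Finset.univ_unique, Finset.sum_singleton, indexJ,
      Fintype.piFinset_of_isEmpty, Finset.univ_unique, Finset.sum_singleton]
    refine (phiOne_zero H).trans ?_
    rw [lamProd, expo, List.ofFn_zero, List.prod_nil, Finset.univ_eq_empty, Finset.sum_empty,
      Nat.sub_zero, pow_zero, mul_one]
    exact congrArg (fun a => Bar.mk (incl α n lam) 1 a 1) (funext fun p => p.elim0)
  | succ m ih =>
    have h := phiOne_even_of_odd H m ih.2
    exact ⟨h, phiOne_odd_of_even H (m + 1) h⟩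

theorem isPhi'_phi' : IsPhi' α n lam (phi' H) := by
  constructor
  · intro m u v
    rw [phi'_mk, (phiOne_even_odd H m).1]
    simp only [map_sum, Bar.rmul_mk, Bar.lmul_mk, one_mul, mul_assoc]
  · intro m u v
    rw [phi'_mk, (phiOne_even_odd H m).2]
    simp only [map_sum, Bar.rmul_mk, Bar.lmul_mk, one_mul, mul_assoc]

theorem psi'_odd_of_even (m : ℕ) (i : ℕ → ℕ) (hi : i (2 * m) < n)
    (h : ∀ u v, psi' H (2 * m) (Bar.mk (incl α n lam) u (fun p : Fin (2 * m) => x α n lam ^ i p) v) =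
      ASq.mk α n lam (2 * m) (u * xbarProd α n lam m i) v) (u v : MonogenicExt α n lam) :
    psi' H (2 * m + 1)
        (Bar.mk (incl α n lam) u (fun p : Fin (2 * m + 1) => x α n lam ^ i p) v) =
      ∑ l ∈ Finset.range (i (2 * m)), ASq.mk α n lam (2 * m + 1)
        (u * xbarProd α n lam m i * x α n lam ^ l) (x α n lam ^ (i (2 * m) - l - 1) * v) := by
  rw [psi'_succ_mk]
  refine (congrArg (fun z => ASq.rmul α n lam (2 * m + 1) v (ASq.contr H (2 * m) z))
    (h u (x α n lam ^ i (2 * m)))).trans ?_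
  rw [ASq.contr_mk_pow H _ hi, ASq.contrPow_of_even (by omega), ASq.derivPow, map_sum, map_sum]
  simp only [ASq.lmul_mk, ASq.rmul_mk]

theorem psi'_even_of_odd (m : ℕ) (i : ℕ → ℕ) (hi : i (2 * m + 1) < n)
    (h : ∀ u v, psi' H (2 * m + 1)
        (Bar.mk (incl α n lam) u (fun p : Fin (2 * m + 1) => x α n lam ^ i p) v) =
      ∑ l ∈ Finset.range (i (2 * m)), ASq.mk α n lam (2 * m + 1)
        (u * xbarProd α n lam m i * x α n lam ^ l) (x α n lam ^ (i (2 * m) - l - 1) * v))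
    (u v : MonogenicExt α n lam) :
    psi' H (2 * m + 2)
        (Bar.mk (incl α n lam) u (fun p : Fin (2 * m + 2) => x α n lam ^ i p) v) =
      ASq.mk α n lam (2 * m + 2) (u * xbarProd α n lam (m + 1) i) v := by
  have hn := H.two_le
  have hc : ∀ (u : MonogenicExt α n lam) (t : ℕ), ASq.contr H (2 * m + 1)
      (ASq.mk α n lam (2 * m + 1) u (x α n lam ^ t)) = ASq.mk α n lam (2 * m + 2)
        (u * incl α n lam (coord H (n - 1) (x α n lam ^ t))) 1 := by
    intro u t
    rw [ASq.contr_mk, Finset.sum_eq_single (n - 1)]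
    · rw [ASq.contrPow_of_odd (by omega), if_pos rfl, pow_map_coord_x_pow, ASq.lmul_mk, mul_one]
    · intro j _ hj
      rw [ASq.contrPow_of_odd (by omega), if_neg hj, map_zero]
    · intro hj
      exact absurd (Finset.mem_range.2 (by omega)) hj
  rw [psi'_succ_mk]
  refine (congrArg (fun z => ASq.rmul α n lam (2 * m + 2) v (ASq.contr H (2 * m + 1) z))
    (h u (x α n lam ^ i (2 * m + 1)))).trans ?_
  rw [map_sum, map_sum, xbarProd_succ, ← sum_pow_mul_coord H _ hi, Finset.mul_sum, Finset.mul_sum,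
    ← ASq.mkHom_apply, map_sum, LinearMap.sum_apply]
  refine Finset.sum_congr rfl fun l _ => ?_
  rw [← pow_add, hc, ASq.rmul_mk, one_mul, ASq.mkHom_apply, mul_assoc, mul_assoc]

theorem psi'_even (m : ℕ) (i : ℕ → ℕ) (hi : ∀ p < 2 * m, i p < n) (u v : MonogenicExt α n lam) :
    psi' H (2 * m) (Bar.mk (incl α n lam) u (fun p : Fin (2 * m) => x α n lam ^ i p) v) =
      ASq.mk α n lam (2 * m) (u * xbarProd α n lam m i) v := by
  induction m generalizing u v with
  | zero =>
    refine (psi'_zero_mk H u _ v).trans ?_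
    rw [xbarProd, List.range_zero, List.map_nil, List.prod_nil, mul_one]
  | succ m ih =>
    exact psi'_even_of_odd H m i (hi _ (by omega)) (psi'_odd_of_even H m i (hi _ (by omega))
      (ih fun p hp => hi p (by omega))) u v

theorem isPsi'_psi' : IsPsi' α n lam (psi' H) :=
  ⟨fun m u v i hi => psi'_even H m i (fun p hp => (hi p hp).2) u v, fun m u v i hi =>
    psi'_odd_of_even H m i (hi _ (by omega)).2
      (psi'_even H m i fun p hp => (hi p (by omega)).2) u v⟩

section Coefficients

variable (M : Type*) [AddCommGroup M] [Module k M] [Module (MonogenicExt α n lam) M]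
  [Module (MonogenicExt α n lam)ᵐᵒᵖ M]
  [SMulCommClass (MonogenicExt α n lam) (MonogenicExt α n lam)ᵐᵒᵖ M]
  [IsScalarTower k (MonogenicExt α n lam) M] [IsScalarTower k (MonogenicExt α n lam)ᵐᵒᵖ M]

theorem isPhi_phi : IsPhi α n lam (phi M H) := by
  -- the coefficients `λ_i` commute with all the letters, so they may be moved to the left of `y`
  have key : ∀ {r m : ℕ} (y : M) (i l : Fin m → ℕ), Hoch.pair (incl α n lam) M r y
      (Bar.mk (incl α n lam) (lamProd α n lam i * x α n lam ^ expo i l)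
        (fun p : Fin r => tildeWord α n lam l p) 1) =
      Hoch.mk (incl α n lam) (lamProd α n lam i • op (x α n lam ^ expo i l) • y)
        (fun p : Fin r => tildeWord α n lam l p) := by
    intro r m y i l
    rw [Hoch.pair_mk, one_smul, ← ((x_commute_lamProd H i).pow_left _).eq, op_mul, mul_smul,
      lamProd_eq_incl]
    refine Hoch.mk_op_smul_of_commute _ _ _ _ fun p => ?_
    rw [← lamProd_eq_incl, tildeWord]
    split_ifs
    · exact (x_commute_lamProd H i).symm
    · exact ((x_commute_lamProd H i).pow_left _).symm
    · exact Commute.one_right _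
  constructor
  · intro m y
    rw [phi_mk, (phiOne_even_odd H m).1]
    simp only [map_sum, key]
  · intro m y
    rw [phi_mk, (phiOne_even_odd H m).2]
    simp only [map_sum, key]

theorem isPsi_psi : IsPsi α n lam (psi M H) := by
  constructor
  · intro m y i hi
    rw [← Hoch.pair_mk_one, psi_pair, (isPsi'_psi' H).1 m 1 1 i hi, CS.pair_mk, one_smul, one_mul]
  · intro m y i hi
    rw [← Hoch.pair_mk_one, psi_pair, (isPsi'_psi' H).2 m 1 1 i hi, map_sum]
    simp only [CS.pair_mk, one_mul, mul_one]

end Coefficients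

end Comparison

end

open MonogenicExt in
theorem theorem2p1 {k K : Type*} [CommRing k] [Ring K] [Algebra k K] (α : K →ₐ[k] K)
    (n : ℕ) (hn : 2 ≤ n) (lam : ℕ → K) (lam_zero : lam 0 = 1)
    (α_lam : ∀ i, 1 ≤ i → i ≤ n → α (lam i) = lam i)
    (lam_mul : ∀ i, 1 ≤ i → i ≤ n → ∀ c : K, lam i * c = (α ^ i) c * lam i)
    (M : Type*) [AddCommGroup M] [Module k M]
    [Module (MonogenicExt α n lam) M] [Module (MonogenicExt α n lam)ᵐᵒᵖ M]
    [SMulCommClass (MonogenicExt α n lam) (MonogenicExt α n lam)ᵐᵒᵖ M]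
    [IsScalarTower k (MonogenicExt α n lam) M] [IsScalarTower k (MonogenicExt α n lam)ᵐᵒᵖ M] :
    -- (1) the small complex and its homology
    ∃ d : ∀ r, CS α n lam M (r + 1) →ₗ[k] CS α n lam M r,
      IsSmallBoundary α n lam d ∧
      (∀ r, d r ∘ₗ d (r + 1) = 0) ∧
      (∀ r, Hoch.b (incl α n lam) M r ∘ₗ Hoch.b (incl α n lam) M (r + 1) = 0) ∧
      (∀ r, Nonempty (complexHomology d r ≃ₗ[k] RelHochschildHomology α n lam M r)) ∧
      -- (2) the chain maps
      ∃ (φ : ∀ r, CS α n lam M r →ₗ[k] Hoch (incl α n lam) M r)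
        (ψ : ∀ r, Hoch (incl α n lam) M r →ₗ[k] CS α n lam M r),
        IsPhi α n lam φ ∧ IsPsi α n lam ψ ∧
        (∀ r, Hoch.b (incl α n lam) M r ∘ₗ φ (r + 1) = φ r ∘ₗ d r) ∧
        (∀ r, d r ∘ₗ ψ (r + 1) = ψ r ∘ₗ Hoch.b (incl α n lam) M r) ∧
        -- (3) one composition is the identity, the other is homotopic to it
        (∀ r, ψ r ∘ₗ φ r = LinearMap.id) ∧
        ∃ (φ' : ∀ r, ASq α n lam r →ₗ[k] Bar (incl α n lam) r)
          (ψ' : ∀ r, Bar (incl α n lam) r →ₗ[k] ASq α n lam r)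
          (ω' : ∀ r, Bar (incl α n lam) r →ₗ[k] Bar (incl α n lam) (r + 1))
          (ω : ∀ r, Hoch (incl α n lam) M r →ₗ[k] Hoch (incl α n lam) M (r + 1)),
          IsPhi' α n lam φ' ∧ IsPsi' α n lam ψ' ∧ IsOmega' α n lam φ' ψ' ω' ∧
          (∀ (r : ℕ) (y : M) (a : Fin r → MonogenicExt α n lam),
            ω r (Hoch.mk (incl α n lam) y a) = EnvTensor.beta (incl α n lam) (r + 1)
              (EnvTensor.tmul (incl α n lam) y (ω' r (Bar.mk (incl α n lam) 1 a 1)))) ∧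
          φ 0 ∘ₗ ψ 0 - LinearMap.id = Hoch.b (incl α n lam) M 0 ∘ₗ ω 0 ∧
          ∀ r, φ (r + 1) ∘ₗ ψ (r + 1) - LinearMap.id =
            Hoch.b (incl α n lam) M (r + 1) ∘ₗ ω (r + 1) + ω r ∘ₗ Hoch.b (incl α n lam) M r := by
  have H : IsNormalMonic α n lam := ⟨hn, lam_zero, α_lam, lam_mul⟩
  refine ⟨CS.d M H, CS.isSmallBoundary_d H, CS.d_comp_d H, Comparison.b_comp_b M,
    nonempty_complexHomology_equiv (Comparison.phi M H) (Comparison.psi M H)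
      (Comparison.omega M H) (Comparison.b_comp_phi M H) (Comparison.d_comp_psi M H)
      (Comparison.psi_comp_phi M H) (Comparison.phi_comp_psi_zero M H)
      (Comparison.phi_comp_psi_succ M H),
    Comparison.phi M H, Comparison.psi M H, Comparison.isPhi_phi H M, Comparison.isPsi_psi H M,
    Comparison.b_comp_phi M H, Comparison.d_comp_psi M H, Comparison.psi_comp_phi M H,
    Comparison.phi' H, Comparison.psi' H, Comparison.omega' H, Comparison.omega M H,
    Comparison.isPhi'_phi' H, Comparison.isPsi'_psi' H, Comparison.isOmega'_omega' H,
    fun r y a => ?_, Comparison.phi_comp_psi_zero M H, Comparison.phi_comp_psi_succ M H⟩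
  rw [← Hoch.pair_mk_one, Comparison.omega_pair, Hoch.pair_apply]
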